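/- Let $\xi_1,\dots,\xi_n\in\mathbb Z^d$ be weights of the torus $(\mathbb C^\times)^d$ and let $b_1,\dots,b_n\in\mathbb C$ be flavor parameters. Put $Y=\mathbb Z^d$, $\mathfrak t_{\mathbb R}=\mathbb R^d$, $\mathfrak t=\mathbb C^d$. The quantized abelian Coulomb branch $\mathcal A=\mathcal A(\xi,b)$ is the free $\mathbb C[\mathfrak t]$-module with basis $r^\lambda$ ($\lambda\in Y$) and with the multiplication $$r^\lambda f=f(\cdot+\lambda)\,r^\lambda,\qquad r^\lambda r^\mu=\prod_{i=1}^nA_i(\lambda,\mu)\;r^{\lambda+\mu},$$ where, for $m=\xi_i(\lambda)$, $k=\xi_i(\mu)$, $e=\min(|m|,|k|)$, one has $A_i=\prod_{j=1}^{e}(\xi_i+b_i+m-j+\tfrac12)$ if $m\ge0\ge k$, $A_i=\prod_{j=1}^{e}(\xi_i+b_i+m+j-\tfrac12)$ if $m\le0\le k$, and $A_i=1$ otherwise. For $\zeta\in\mathbb C^d$ let $g_\zeta$ be the automorphism that is the identity on $\mathbb C[\mathfrak t]$ and multiplies $r^\lambda$ by $e^{2\pi\mathrm i\zeta(\lambda)}$.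 A linear map $T\colon\mathcal A\to\mathbb C$ with $T(ab)=T(b\,g_\zeta(a))$ for all $a,b$ is called a $\zeta$-twisted trace. **Weight functions.** If $\xi_i\neq0$, write $\xi_i=k_i\eta_i$ with $\eta_i\in\mathbb Z^d$ primitive and $k_i\ge1$, and put $b_{i,q}=\frac1{k_i}\bigl(b_i+\frac{k_i-1}2-q\bigr)$ for $0\le q<k_i$ (so if $\xi_i$ is primitive, then $\eta_i=\xi_i$ and $b_{i,0}=b_i$ is the only such number). A $\zeta$-weight function for $(\xi,b)$ is a meromorphic function $v$ on $\mathfrak t$ that decays exponentially on $\mathfrak t_{\mathbb R}$, satisfies $v(z+\mathrm i\lambda)=e^{2\pi\mathrm i\zeta(\lambda)}v(z)$ for all $\lambda\in Y$, and for which $$\prod_{(i,q)\,:\,\xi_i\ne0,\ |\operatorname{Re}b_{i,q}|<\frac12}\bigl(e^{2\pi\eta_i}+e^{2\pi\mathrm ib_{i,q}}\bigr)\,v$$ is entire. **Exponential fractions.** Let $U\subset\mathfrak t_{\mathbb R}$ be an affine subspace. An exponential fraction on $U$ is a function $w$ on $U$ of the form $\sum_\mu S_\mu e^\mu\big/\prod_\lambda(e^{\lambda/2}-e^{2\pi\mathrm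 is_\lambda}e^{-\lambda/2})$, with a finite sum and a finite product, that is regular (has no poles) on $U$. Here the $S_\mu$ are polynomials, the $\mu$ are complex linear forms, the $\lambda$ are real linear forms not constant on $U$, and $s_\lambda\in\mathbb C$. **Proposition.** Let $T$ be a $\zeta$-twisted trace on $\mathcal A$ such that $$T(R)=\sum_U\int_UR(\mathrm iz)w_U(z)\,dz\qquad\text{for all }R\in\mathbb C[\mathfrak t],$$ where the sum is over finitely many distinct affine subspaces $U\subset\mathfrak t_{\mathbb R}$ and each $w_U$ is an exponentially decaying exponential fraction on $U$. Then each term is a trace: there are $\zeta$-twisted traces $T_{(U)}$ on $\mathcal A$ with $T=\sum_UT_{(U)}$ and $T_{(U)}(R)=\int_UR(\mathrm iz)w_U(z)\,dz$ for all $R\in\mathbb C[\mathfrak t]$. More precisely, let $w_U\not\equiv0$, let $U=p+U_0$ with $U_0$ linear and $p\in U$, and let $Y_U=Y\cap U_0$. Then $Y_U$ is a lattice of rank $\dim U$ that spans $U_0$. Let $\mathcal A_U$ be the quantized abelian Coulomb branch of the torus with cocharacter lattice $Y_U$, with weights $\xi_i|_{Y_U}$ and flavors $b_i+\mathrm i\xi_i(p)$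 (equal to $b_i$ if $p=0$). There are 1. a surjective algebra homomorphism $\phi\colon\mathcal A\to\mathcal A_U$ with $\phi(r^\lambda R)=0$ for $\lambda\notin Y_U$ and $\phi(r^\lambda R)=r^\lambda\cdot R(\cdot+\mathrm ip)|_{(U_0)_{\mathbb C}}$ for $\lambda\in Y_U$; 2. a $\zeta|_{Y_U}$-twisted trace $T_U$ on $\mathcal A_U$ with $T_{(U)}=T_U\circ\phi$ and $T_U(Q)=\int Q(\mathrm ix)v(x)\,dx$ for all polynomials $Q$, where the integral is over $\mathbb R^{\dim U}\cong U_0$ in coordinates given by any chosen $\mathbb Z$-basis of $Y_U$, and $v$ is a $\zeta|_{Y_U}$-weight function for the data of $\mathcal A_U$ that equals $x\mapsto c\,w_U(p+x)$ on $U_0$ for a constant $c>0$. In particular the poles of $w_U$ come only from the restricted weights whose flavors have real part in $(-\frac12,\frac12)$; if $\xi_i|_{Y_U}$ is primitive, this is the condition $|\operatorname{Re}b_i|<\frac12$. -/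

import Mathlib

namespace AbelianCoulomb

/-- The data of a quantized abelian Coulomb branch: the weights `ξ_1, …, ξ_n` of a representation of
the torus `(ℂˣ)^d`, as vectors of the character lattice `ℤ^d`, and flavor parameters
`b_1, …, b_n`. -/
structure CoulombData (d n : ℕ) where
  weight : Fin n → Fin d → ℤ
  flavor : Fin n → ℂ

/-- The algebra `ℂ[𝔱]` of polynomial functions on the Lie algebra `𝔱 = ℂ^d`. -/
abbrev CPoly (d : ℕ) : Type := MvPolynomial (Fin d) ℂ

/-- The pairing `ξ(λ)` of a character with a cocharacter. -/
def pair {d : ℕ} (ξ l : Fin d → ℤ) : ℤ := ∑ k, ξ k * l k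

/-- The shift of the argument: `(shift l f)(x) = f(x + l)`. -/
noncomputable def shift {d : ℕ} (l : Fin d → ℤ) : CPoly d →ₐ[ℂ] CPoly d :=
  MvPolynomial.aeval fun k => MvPolynomial.X k + MvPolynomial.C (l k : ℂ)

/-- The factor of one weight in the product `r^λ r^μ`, where `x = ξ + b`, `m = ξ(λ)`, `k = ξ(μ)`.
It is `1` if `m` and `k` have the same sign; otherwise, with `e = min |m| |k|`, it is
`∏_{j=1}^{e} (x + m - j + 1/2)` if `m ≥ 0 ≥ k` and
`∏_{j=1}^{e} (x + m + j - 1/2)` if `m ≤ 0 ≤ k`. -/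
noncomputable def factor {B : Type*} [CommRing B] [Algebra ℂ B] (x : B) (m k : ℤ) : B :=
  if 0 ≤ m ∧ k ≤ 0 then
    ∏ j ∈ Finset.range (min m.natAbs k.natAbs), (x + algebraMap ℂ B (m - (j + 1) + 1 / 2))
  else if m ≤ 0 ∧ 0 ≤ k then
    ∏ j ∈ Finset.range (min m.natAbs k.natAbs), (x + algebraMap ℂ B (m + (j + 1) - 1 / 2))
  else 1

/-- The product of `x + 1/2, x + 3/2, …, x + m - 1/2` (empty if `m ≤ 0`). -/
noncomputable def rising {B : Type*} [CommRing B] [Algebra ℂ B] (x : B) (m : ℤ) : B :=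
  ∏ j ∈ Finset.range m.toNat, (x + algebraMap ℂ B (j + 1 / 2))

theorem rising_natAdd {B : Type*} [CommRing B] [Algebra ℂ B] (x : B) (a b : ℕ) :
    rising x (a + b : ℕ) = rising x a * rising (x + algebraMap ℂ B a) b := by
  simp only [rising, Int.toNat_natCast, Finset.prod_range_add]
  congr 1
  refine Finset.prod_congr rfl fun j _ => ?_
  rw [add_assoc, ← map_add]; congr 2; push_cast; ring

theorem prod_reflect_rising {B : Type*} [CommRing B] [Algebra ℂ B] (x : B) (a q : ℕ) :
    ∏ j ∈ Finset.range q, (x + algebraMap ℂ B (((a + q : ℕ) : ℂ) - (j + 1) + 1 / 2)) =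
      rising (x + algebraMap ℂ B a) q := by
  simp only [rising, Int.toNat_natCast]
  rw [← Finset.prod_range_reflect]
  refine Finset.prod_congr rfl fun j hj => ?_
  have hj' := Finset.mem_range.1 hj
  rw [add_assoc x, ← map_add]; congr 2
  have : ((q - 1 - j : ℕ) : ℂ) = q - 1 - j := by
    rw [Nat.cast_sub (by omega), Nat.cast_sub (by omega)]; simp
  rw [this]; push_cast; ring

theorem rising_mul_rising {B : Type*} [CommRing B] [Algebra ℂ B] (x : B) (m k : ℤ) :
    rising x m * rising (x + algebraMap ℂ B m) k = factor x m k * rising x (m + k) := by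
  have rneg : ∀ (y : B) (t : ℤ), t ≤ 0 → rising y t = 1 := by
    intro y t ht; simp [rising, Int.toNat_of_nonpos ht]
  rcases le_total 0 m with hm | hm <;> rcases le_total 0 k with hk | hk
  · obtain ⟨a, rfl⟩ := Int.eq_ofNat_of_zero_le hm
    obtain ⟨b, rfl⟩ := Int.eq_ofNat_of_zero_le hk
    have h1 : factor x (a : ℤ) (b : ℤ) = 1 := by
      unfold factor
      split_ifs with h h'
      · have : b = 0 := by omega
        simp [this]
      · have : a = 0 := by omega
        simp [this]
      · rfl
    have := rising_natAdd x a b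
    rw [h1, one_mul]; push_cast at this ⊢; exact this.symm
  · obtain ⟨a, rfl⟩ := Int.eq_ofNat_of_zero_le hm
    obtain ⟨q, hq⟩ := Int.eq_ofNat_of_zero_le (neg_nonneg.2 hk)
    obtain rfl : k = -(q : ℤ) := by omega
    rw [rneg _ _ hk, mul_one]
    unfold factor
    rw [if_pos ⟨hm, hk⟩]
    simp only [Int.natAbs_natCast, Int.natAbs_neg]
    rcases le_total q a with h | h
    · obtain ⟨c, rfl⟩ := Nat.exists_eq_add_of_le' h
      rw [min_eq_right h, show ((c + q : ℕ) : ℤ) + -(q : ℤ) = (c : ℕ) by push_cast; ring]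
      have := prod_reflect_rising x c q
      rw [rising_natAdd, mul_comm]
      push_cast at this ⊢
      rw [this]
    · rw [min_eq_left h, rneg _ (_ + _) (by omega), mul_one]
      have := prod_reflect_rising x 0 a
      simp only [zero_add, Nat.cast_zero, map_zero, add_zero] at this
      push_cast at this ⊢
      exact this.symm
  · obtain ⟨q, hq⟩ := Int.eq_ofNat_of_zero_le (neg_nonneg.2 hm)
    obtain rfl : m = -(q : ℤ) := by omega
    obtain ⟨a, rfl⟩ := Int.eq_ofNat_of_zero_le hk
    rw [rneg _ _ hm, one_mul]
    have key : factor x (-(q : ℤ)) (a : ℤ) =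
        rising (x + algebraMap ℂ B ((-(q : ℤ) : ℤ) : ℂ)) ((min q a : ℕ) : ℤ) := by
      unfold factor rising
      simp only [Int.natAbs_natCast, Int.natAbs_neg, Int.toNat_natCast]
      split_ifs with h h'
      · have h0 : q = 0 := by omega
        simp [h0]
      · refine Finset.prod_congr rfl fun j _ => ?_
        rw [add_assoc x, ← map_add]; congr 2; ring
      · exact absurd ⟨hm, hk⟩ h'
    rw [key]
    rcases le_total q a with h | h
    · obtain ⟨c, rfl⟩ := Nat.exists_eq_add_of_le h
      rw [min_eq_left h, rising_natAdd,
        show -(q : ℤ) + ((q + c : ℕ) : ℤ) = (c : ℕ) by push_cast; ring]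
      congr 2
      rw [add_assoc, ← map_add]; simp
    · rw [min_eq_right h, rneg x _ (by omega), mul_one]
  · have h1 : factor x m k = 1 := by
      unfold factor
      split_ifs with h h'
      · have : m = 0 := by omega
        simp [this]
      · have : k = 0 := by omega
        simp [this]
      · rfl
    rw [rneg _ _ hm, rneg _ _ hk, rneg _ _ (by omega), h1]

theorem map_factor {B B' : Type*} [CommRing B] [Algebra ℂ B] [CommRing B'] [Algebra ℂ B']
    (f : B →ₐ[ℂ] B') (x : B) (m k : ℤ) : f (factor x m k) = factor (f x) m k := by
  unfold factor
  split_ifs <;> simp only [map_prod, map_add, map_one, AlgHom.commutes]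

theorem factor_assoc {B : Type*} [CommRing B] [Algebra ℂ B] (x : B) (l m k : ℤ) :
    factor x l m * factor x (l + m) k =
      factor (x + algebraMap ℂ B l) m k * factor x l (m + k) := by
  suffices H : factor (Polynomial.X : Polynomial ℂ) l m * factor Polynomial.X (l + m) k =
      factor (Polynomial.X + algebraMap ℂ (Polynomial ℂ) l) m k * factor Polynomial.X l (m + k) by
    have := congrArg (Polynomial.aeval x) H
    simpa only [map_mul, map_factor, map_add, AlgHom.commutes, Polynomial.aeval_X] using this
  have hne : rising (Polynomial.X : Polynomial ℂ) (l + m + k) ≠ 0 :=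
    Finset.prod_ne_zero_iff.2 fun j _ => Polynomial.X_add_C_ne_zero _
  refine mul_right_cancel₀ hne ?_
  have e1 := rising_mul_rising (Polynomial.X : Polynomial ℂ) l m
  have e2 := rising_mul_rising (Polynomial.X : Polynomial ℂ) (l + m) k
  have e3 := rising_mul_rising (Polynomial.X + algebraMap ℂ (Polynomial ℂ) l) m k
  have e4 := rising_mul_rising (Polynomial.X : Polynomial ℂ) l (m + k)
  rw [Int.cast_add, map_add, ← add_assoc] at e2
  rw [← add_assoc] at e4
  rw [mul_assoc, ← e2, ← mul_assoc, ← e1, mul_assoc, e3, mul_assoc, ← e4]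
  ring

variable {d n : ℕ}

/-- The element `ξ_i + b_i` of `ℂ[𝔱]`. -/
noncomputable def CoulombData.form (D : CoulombData d n) (i : Fin n) : CPoly d :=
  ∑ k, MvPolynomial.C (D.weight i k : ℂ) * MvPolynomial.X k + MvPolynomial.C (D.flavor i)

/-- The structure constant in `r^λ r^μ = (structConst λ μ) r^{λ+μ}`. -/
noncomputable def CoulombData.structConst (D : CoulombData d n) (l m : Fin d → ℤ) : CPoly d :=
  ∏ i, factor (D.form i) (pair (D.weight i) l) (pair (D.weight i) m)

theorem pair_add (ξ l m : Fin d → ℤ) : pair ξ (l + m) = pair ξ l + pair ξ m := by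
  simp [pair, mul_add, Finset.sum_add_distrib]

theorem pair_zero (ξ : Fin d → ℤ) : pair ξ 0 = 0 := by simp [pair]

theorem shift_form (D : CoulombData d n) (i : Fin n) (l : Fin d → ℤ) :
    shift l (D.form i) = D.form i + algebraMap ℂ (CPoly d) (pair (D.weight i) l) := by
  simp only [shift, CoulombData.form, pair, map_add, map_sum, map_mul, MvPolynomial.aeval_X,
    MvPolynomial.algHom_C, mul_add, Finset.sum_add_distrib, MvPolynomial.algebraMap_eq]
  push_cast
  simp only [map_sum, map_mul]
  ring

theorem shift_zero (f : CPoly d) : shift 0 f = f := by simp [shift]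

theorem shift_add (l m : Fin d → ℤ) (f : CPoly d) : shift (l + m) f = shift l (shift m f) := by
  rw [← AlgHom.comp_apply]
  congr 1
  apply MvPolynomial.algHom_ext
  intro k
  simp only [shift, AlgHom.comp_apply, MvPolynomial.aeval_X, map_add, MvPolynomial.algHom_C,
    MvPolynomial.algebraMap_eq, Pi.add_apply, Int.cast_add]
  ring

theorem structConst_assoc (D : CoulombData d n) (l m k : Fin d → ℤ) :
    D.structConst l m * D.structConst (l + m) k =
      shift l (D.structConst m k) * D.structConst l (m + k) := by
  simp only [CoulombData.structConst, map_prod, ← Finset.prod_mul_distrib, map_factor, shift_form,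
    pair_add, factor_assoc]

theorem factor_zero_left {B : Type*} [CommRing B] [Algebra ℂ B] (x : B) (k : ℤ) :
    factor x 0 k = 1 := by simp [factor]

theorem factor_zero_right {B : Type*} [CommRing B] [Algebra ℂ B] (x : B) (k : ℤ) :
    factor x k 0 = 1 := by simp [factor]

theorem structConst_zero_left (D : CoulombData d n) (l : Fin d → ℤ) : D.structConst 0 l = 1 := by
  simp [CoulombData.structConst, pair_zero, factor_zero_left]

theorem structConst_zero_right (D : CoulombData d n) (l : Fin d → ℤ) : D.structConst l 0 = 1 := by
  simp [CoulombData.structConst, pair_zero, factor_zero_right]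

/-- The quantized abelian Coulomb branch: the free `ℂ[𝔱]`-module on the basis `r^λ`, `λ ∈ ℤ^d`;
an element is written `∑ f_λ r^λ`, with finitely many nonzero coefficients `f_λ` on the left. -/
def CoulombBranch (_D : CoulombData d n) : Type := (Fin d → ℤ) →₀ CPoly d

namespace CoulombBranch

variable {D : CoulombData d n}

noncomputable instance : AddCommGroup (CoulombBranch D) :=
  inferInstanceAs (AddCommGroup ((Fin d → ℤ) →₀ CPoly d))

noncomputable instance : Module ℂ (CoulombBranch D) :=
  inferInstanceAs (Module ℂ ((Fin d → ℤ) →₀ CPoly d))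

/-- The element `f r^λ`. -/
noncomputable def mono (D : CoulombData d n) (l : Fin d → ℤ) : CPoly d →ₗ[ℂ] CoulombBranch D :=
  Finsupp.lsingle l

/-- The bilinear multiplication with `(f r^λ)(h r^μ) = f · shift λ h · structConst λ μ · r^{λ+μ}`;
that is, `r^λ f = (shift λ f) r^λ` and `r^λ r^μ = structConst λ μ · r^{λ+μ}`. -/
noncomputable def mulMap (D : CoulombData d n) :
    CoulombBranch D →ₗ[ℂ] CoulombBranch D →ₗ[ℂ] CoulombBranch D :=
  Finsupp.lsum ℂ fun l => LinearMap.flip (Finsupp.lsum ℂ fun m => LinearMap.flip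
    (LinearMap.mk₂ ℂ (fun f h => mono D (l + m) (f * shift l h * D.structConst l m))
      (fun f f' h => by rw [add_mul, add_mul, map_add])
      (fun c f h => by rw [smul_mul_assoc, smul_mul_assoc, map_smul])
      (fun f h h' => by rw [map_add, mul_add, add_mul, map_add])
      (fun c f h => by rw [map_smul, mul_smul_comm, smul_mul_assoc, map_smul])))

noncomputable instance : Mul (CoulombBranch D) := ⟨fun a b => mulMap D a b⟩

noncomputable instance : One (CoulombBranch D) := ⟨mono D 0 1⟩

theorem mul_def (a b : CoulombBranch D) : a * b = mulMap D a b := rfl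

theorem one_def : (1 : CoulombBranch D) = mono D 0 1 := rfl

theorem mono_mul_mono (l m : Fin d → ℤ) (f h : CPoly d) :
    mono D l f * mono D m h = mono D (l + m) (f * shift l h * D.structConst l m) := by
  rw [mul_def]
  unfold mulMap
  conv_lhs => unfold mono
  erw [Finsupp.lsum_single, LinearMap.flip_apply, Finsupp.lsum_single]
  rfl

@[elab_as_elim]
theorem induct {P : CoulombBranch D → Prop} (a : CoulombBranch D)
    (add : ∀ a b, P a → P b → P (a + b)) (mono : ∀ l f, P (mono D l f)) : P a := by
  refine Finsupp.induction_linear (motive := P) a ?_ (fun f g hf hg => add f g hf hg)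
    (fun l f => mono l f)
  have := mono 0 0
  rwa [map_zero] at this

protected theorem left_distrib (a b c : CoulombBranch D) : a * (b + c) = a * b + a * c := by
  simp only [mul_def, map_add]

protected theorem right_distrib (a b c : CoulombBranch D) : (a + b) * c = a * c + b * c := by
  simp only [mul_def, map_add, LinearMap.add_apply]

protected theorem mul_assoc' (a b c : CoulombBranch D) : a * b * c = a * (b * c) := by
  refine induct a (fun a a' h h' => ?_) fun l f => ?_
  · rw [CoulombBranch.right_distrib, CoulombBranch.right_distrib, h, h',
      CoulombBranch.right_distrib]
  refine induct b (fun b b' h h' => ?_) fun m g => ?_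
  · rw [CoulombBranch.left_distrib, CoulombBranch.right_distrib, h, h',
      CoulombBranch.right_distrib, CoulombBranch.left_distrib]
  refine induct c (fun c c' h h' => ?_) fun k e => ?_
  · rw [CoulombBranch.left_distrib, h, h', CoulombBranch.left_distrib, CoulombBranch.left_distrib]
  rw [mono_mul_mono, mono_mul_mono, mono_mul_mono, mono_mul_mono, add_assoc l m k]
  have key : f * shift l g * D.structConst l m * shift (l + m) e * D.structConst (l + m) k =
      f * shift l (g * shift m e * D.structConst m k) * D.structConst l (m + k) := by
    have h := structConst_assoc D l m k
    rw [map_mul, map_mul, ← shift_add]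
    linear_combination f * shift l g * shift (l + m) e * h
  rw [key]

noncomputable instance : Ring (CoulombBranch D) :=
  { (inferInstance : AddCommGroup (CoulombBranch D)) with
    mul := (· * ·)
    one := 1
    left_distrib := CoulombBranch.left_distrib
    right_distrib := CoulombBranch.right_distrib
    zero_mul := fun a => by simp only [mul_def, map_zero, LinearMap.zero_apply]
    mul_zero := fun a => by simp only [mul_def, map_zero]
    mul_assoc := CoulombBranch.mul_assoc'
    one_mul := fun a => by
      refine induct a (fun a b h h' => ?_) fun l f => ?_
      · rw [CoulombBranch.left_distrib, h, h']
      · rw [one_def, mono_mul_mono, shift_zero, structConst_zero_left, zero_add, one_mul, mul_one]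
    mul_one := fun a => by
      refine induct a (fun a b h h' => ?_) fun l f => ?_
      · rw [CoulombBranch.right_distrib, h, h']
      · rw [one_def, mono_mul_mono, map_one, structConst_zero_right, add_zero, mul_one, mul_one] }

noncomputable instance : Algebra ℂ (CoulombBranch D) :=
  Algebra.ofModule
    (fun c a b => by simp only [mul_def, map_smul, LinearMap.smul_apply])
    (fun c a b => by simp only [mul_def, map_smul])

/-- The basis element `r^λ`. -/
noncomputable def r (D : CoulombData d n) (l : Fin d → ℤ) : CoulombBranch D := mono D l 1

/-- The inclusion of `ℂ[𝔱]`. -/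
noncomputable def ofPoly (D : CoulombData d n) : CPoly d →ₗ[ℂ] CoulombBranch D := mono D 0

/-- The number `e^{2πiζ(λ)}`. -/
noncomputable def phase (ζ : Fin d → ℂ) (l : Fin d → ℤ) : ℂ :=
  Complex.exp (2 * Real.pi * Complex.I * ∑ k, ζ k * (l k : ℂ))

/-- The underlying linear map of `twist`. -/
noncomputable def twistLin (D : CoulombData d n) (ζ : Fin d → ℂ) :
    CoulombBranch D →ₗ[ℂ] CoulombBranch D :=
  Finsupp.lsum ℂ fun l => phase ζ l • mono D l

theorem twistLin_mono (ζ : Fin d → ℂ) (l : Fin d → ℤ) (f : CPoly d) :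
    twistLin D ζ (mono D l f) = phase ζ l • mono D l f := by
  unfold twistLin
  conv_lhs => unfold mono
  erw [Finsupp.lsum_single]
  rfl

theorem phase_add (ζ : Fin d → ℂ) (l m : Fin d → ℤ) :
    phase ζ (l + m) = phase ζ l * phase ζ m := by
  rw [phase, phase, phase, ← Complex.exp_add, ← mul_add, ← Finset.sum_add_distrib]
  simp only [Pi.add_apply, Int.cast_add, mul_add]

/-- The automorphism `g = e^{2πiζ}`: it is the identity on `ℂ[𝔱]` and multiplies `r^λ` by
`e^{2πiζ(λ)}`. -/
noncomputable def twist (D : CoulombData d n) (ζ : Fin d → ℂ) :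
    CoulombBranch D →ₐ[ℂ] CoulombBranch D :=
  AlgHom.ofLinearMap (twistLin D ζ)
    (by rw [one_def, twistLin_mono]; simp [phase])
    (fun a b => by
      refine induct a (fun a a' h h' => ?_) fun l f => ?_
      · rw [add_mul, map_add, h, h', map_add, add_mul]
      refine induct b (fun b b' h h' => ?_) fun m g => ?_
      · rw [mul_add, map_add, h, h', map_add, mul_add]
      rw [mono_mul_mono, twistLin_mono, twistLin_mono, twistLin_mono, smul_mul_smul_comm,
        mono_mul_mono, phase_add])

/-- A linear functional `T` with `T(ab) = T(b g(a))` for `g = e^{2πiζ}`. -/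
def IsTwistedTrace (ζ : Fin d → ℂ) (T : CoulombBranch D →ₗ[ℂ] ℂ) : Prop :=
  ∀ a b, T (a * b) = T (b * twist D ζ a)

end CoulombBranch

/-! ### Integral traces -/

/-- The largest `k ≥ 0` such that `ξ_i` is `k` times a character (`0` if `ξ_i = 0`). -/
def CoulombData.content (D : CoulombData d n) (i : Fin n) : ℕ :=
  Finset.univ.gcd fun k => (D.weight i k).natAbs

/-- If `ξ_i = kη` with `η` primitive, then the factor of `(ξ_i, b_i)` in each product `r^λ r^{-λ}`
is, up to a positive constant, that of `k` copies of `η` with flavors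
`(b_i + (k-1)/2 - q)/k`, `q = 0, …, k-1`. If `ξ_i` is primitive, the only one is `b_i`. -/
noncomputable def CoulombData.primFlavor (D : CoulombData d n) (i : Fin n) (q : ℕ) : ℂ :=
  (D.flavor i + ((D.content i : ℂ) - 1) / 2 - q) / D.content i

open Classical in
/-- The product of `e^{2πη} + e^{2πib}` over all primitive characters `η = ξ_i / content`, with
multiplicity `content`, and their flavors `b` as above, that satisfy `|Re b| < 1/2`. -/
noncomputable def CoulombData.denom (D : CoulombData d n) (z : Fin d → ℂ) : ℂ :=
  ∏ i, ∏ q ∈ (Finset.range (D.content i)).filter fun q => |(D.primFlavor i q).re| < 1 / 2,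
    (Complex.exp (2 * Real.pi * ((∑ k, (D.weight i k : ℂ) * z k) / D.content i)) +
      Complex.exp (2 * Real.pi * Complex.I * D.primFlavor i q))

/-- The meromorphic weight functions on `𝔱` that give integral traces: `denom · w` is entire, `w` is
quasi-periodic, and `w` decays exponentially on `𝔱_ℝ = ℝ^d`. The values of `w` on the zero set of
`denom`, which does not meet `ℝ^d`, are irrelevant. -/
structure IsTraceWeight (D : CoulombData d n) (ζ : Fin d → ℂ) (w : (Fin d → ℂ) → ℂ) : Prop where
  decay : ∃ C ε : ℝ, 0 < ε ∧ ∀ x : Fin d → ℝ, ‖w fun k => (x k : ℂ)‖ ≤ C * Real.exp (-ε * ‖x‖)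
  quasiperiodic : ∀ (l : Fin d → ℤ) (z : Fin d → ℂ), D.denom z ≠ 0 →
    w (fun k => z k + Complex.I * (l k : ℂ)) = CoulombBranch.phase ζ l * w z
  entire : ∃ E : (Fin d → ℂ) → ℂ, Differentiable ℂ E ∧
    ∀ z, D.denom z ≠ 0 → D.denom z * w z = E z

/-- `𝔱_ℝ = ℝ^d`. -/
abbrev RealLie (d : ℕ) : Type := EuclideanSpace ℝ (Fin d)

/-- `w` decays exponentially on the affine subspace `U`. -/
def ExpDecayOn (U : AffineSubspace ℝ (RealLie d)) (w : RealLie d → ℂ) : Prop :=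
  ∃ C ε : ℝ, 0 < ε ∧ ∀ x ∈ U, ‖w x‖ ≤ C * Real.exp (-ε * ‖x‖)

/-- `w` is, on the affine subspace `U`, an exponential fraction
`(∑ S_μ e^μ) / ∏ (e^{λ/2} - e^{2πis} e^{-λ/2})` that is regular on `U`. The sum is finite, the `S_μ`
are polynomials, the `μ` are complex linear forms; the product is finite, the `λ` are real linear
forms that are not constant on `U`, and `s ∈ ℂ` may depend on the factor. -/
def IsExpFractionOn (U : AffineSubspace ℝ (RealLie d)) (w : RealLie d → ℂ) : Prop :=
  ContinuousOn w (U : Set (RealLie d)) ∧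
  ∃ (M N : ℕ) (S : Fin M → CPoly d) (μ : Fin M → Fin d → ℂ) (lam : Fin N → Fin d → ℝ)
    (s : Fin N → ℂ),
    (∀ j, ∃ u ∈ U.direction, ∑ k, lam j k * u k ≠ 0) ∧
    ∀ x ∈ U,
      w x * ∏ j, (Complex.exp (((∑ k, lam j k * x k : ℝ) : ℂ) / 2) -
          Complex.exp (2 * Real.pi * Complex.I * s j) *
            Complex.exp (-(((∑ k, lam j k * x k : ℝ) : ℂ) / 2))) =
        ∑ l, MvPolynomial.eval (fun k => (x k : ℂ)) (S l) *
          Complex.exp (∑ k, μ l k * (x k : ℂ))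

/-- The integral `∫_U R(iz) w(z) dz` over `U` with respect to Lebesgue measure, computed with the base
point `p ∈ U`, on which it does not depend. -/
noncomputable def termIntegral (U : AffineSubspace ℝ (RealLie d)) (p : RealLie d)
    (w : RealLie d → ℂ) (R : CPoly d) : ℂ :=
  ∫ u : U.direction,
    MvPolynomial.eval (fun k => Complex.I * (((u : RealLie d) + p) k : ℂ)) R *
      w ((u : RealLie d) + p)
    ∂(stdOrthonormalBasis ℝ U.direction).toBasis.addHaar

/-! ### The Coulomb branch attached to an affine subspace -/

/-- A cocharacter as a vector of `𝔱_ℝ`. -/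
noncomputable def toReal (l : Fin d → ℤ) : RealLie d := WithLp.toLp 2 fun k => (l k : ℝ)

/-- The lattice of the cocharacters that lie in the linear subspace `W` of `𝔱_ℝ`. -/
def latticeIn (W : Submodule ℝ (RealLie d)) : Submodule ℤ (Fin d → ℤ) where
  carrier := {l | toReal l ∈ W}
  add_mem' {l m} hl hm := by
    have : toReal (l + m) = toReal l + toReal m := by ext k; simp [toReal]
    simpa [this] using W.add_mem hl hm
  zero_mem' := by
    have : toReal (0 : Fin d → ℤ) = 0 := by ext k; simp [toReal]
    simp [this]
  smul_mem' c l hl := by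
    have : toReal (c • l) = (c : ℝ) • toReal l := by ext k; simp [toReal]
    change toReal (c • l) ∈ W
    rw [this]; exact W.smul_mem (c : ℝ) hl

variable {W : Submodule ℝ (RealLie d)} {m : ℕ}

/-- The weights and flavors for the affine subspace `p + W`, in terms of a basis of `latticeIn W`: the
weights are restricted to `latticeIn W`, and `b_i` becomes the constant term `b_i + iξ_i(p)` of the
restriction of `ξ_i + b_i` to `i(p + W)`. If `p = 0`, the flavors do not change. -/
noncomputable def CoulombData.restrict (D : CoulombData d n)
    (B : Module.Basis (Fin m) ℤ (latticeIn W)) (p : RealLie d) : CoulombData m n where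
  weight i k := pair (D.weight i) (B k : Fin d → ℤ)
  flavor i := D.flavor i + Complex.I * ∑ k, (D.weight i k : ℂ) * (p k : ℂ)

/-- The restriction of a polynomial to the complexification of `i(p + W)`, in the coordinates of the
basis: `x ↦ R(∑ x_k B_k + ip)`. -/
noncomputable def restrictPoly (B : Module.Basis (Fin m) ℤ (latticeIn W)) (p : RealLie d) :
    CPoly d →ₐ[ℂ] CPoly m :=
  MvPolynomial.aeval fun l =>
    ∑ k, MvPolynomial.C (((B k : Fin d → ℤ) l : ℤ) : ℂ) * MvPolynomial.X k +
      MvPolynomial.C (Complex.I * (p l : ℂ))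

/-- The restriction of `ζ` to `latticeIn W`, in the coordinates of the basis. -/
noncomputable def restrictTwist (B : Module.Basis (Fin m) ℤ (latticeIn W)) (ζ : Fin d → ℂ) :
    Fin m → ℂ :=
  fun k => ∑ l, ζ l * (((B k : Fin d → ℤ) l : ℤ) : ℂ)

/-- The cocharacter `∑ a_k B_k`. -/
noncomputable def latticePoint (B : Module.Basis (Fin m) ℤ (latticeIn W)) (a : Fin m → ℤ) : Fin d → ℤ :=
  ∑ k, a k • (B k : Fin d → ℤ)

/-- The point `p + ∑ x_k B_k` of `p + W`. -/
noncomputable def realPoint (B : Module.Basis (Fin m) ℤ (latticeIn W)) (p : RealLie d)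
    (x : Fin m → ℝ) : RealLie d :=
  p + ∑ k, x k • toReal (B k : Fin d → ℤ)

end AbelianCoulomb

open AbelianCoulomb

/-! The commutator with a coordinate function shows that a twisted trace kills `f r^λ` for `λ ≠ 0`.
So a trace is a functional on polynomials, and the trace condition becomes `T(shift λ (R P)) =
e^{2πiζ(λ)} T(R P)` for all `λ` and `R`, where `P = structConst (-λ) λ` is a product of affine
functions. The task is to pass from this identity for a sum of integrals to the same identity for
each integral, and then to read off the poles of each integrand.

Separation (`weakTermTrace_of_sum`). The induction goes from large subspaces to small ones. If `U_j`
does not contain `U`, a product of two affine functions vanishes on `iU_j`, both before and after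
the shift, but not identically on `iU`. Let `q` be the product of these over all such `j`. Replacing
`R` by `R q` leaves only the subspaces containing `U`; the strictly larger ones satisfy the identity
by induction. Hence the term of `U` satisfies it up to the factor `q`. Along a complex line in the
direction `λ` through a real point where `q` does not vanish, `q` has no zeros in the open strip
that matters below.

Rationality (`WeakTermTrace.exists_factor_eq_zero`). If `λ` is not parallel to `U`, an affine
function that is a nonzero constant on `iU` and zero on `iU + λ` turns the identity into `q P w = 0`
on `iU`. So a factor of `P` vanishes there: some weight is constant on `U` but nonzero on `λ`.
Cocharacters outside the direction of `U` are thus detected by weights that vanish on it. This makes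
the direction rational, and it makes restriction to the sublattice multiplicative.

Removal of `q`. In lattice coordinates the integrand is a function `V` on `ℝ^m`, the restriction of
a quotient of entire functions. Exponential decay makes moments determine functions, so the identity
splits into identities on the lines in the direction `λ`: `∫ p(s-i) Q(s-i) V(s) ds = c ∫ p(s) Q(s)
V(s) ds` with `Q = q P` and all polynomials `p`. It extends to Gaussians times `e^{iys}`. A contour
shift and the injectivity of the Fourier transform then give `V(z+i) = c V(z)`
(`LineQuotient.quasi_periodic`). Now the identity says that `Q V` times a test function has equal
integrals over the two boundary lines of the strip `-1 ≤ Im z ≤ 0`. A pole inside could be reduced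
by a polynomial to the only pole, a simple one, and its residue would separate the two integrals
(`LineQuotient.order_nonneg`). So `Q V`, and hence `P V`, has no poles inside, and a contour shift
yields the identity without `q` (`LineQuotient.shiftIdentity_of_mul`).

Poles (`WeakTraceIdentity.numerator_eq_zero`). A possible polar hyperplane of `V` is a level set of
a linear form `Λ`. It is crossed by a line in a lattice direction on which the weights proportional
to `Λ` take their minimal values. Quasi-periodicity moves the pole into `-1 < Im ≤ 0`. There it is
absent (real line) or is cancelled by a zero of `P`, which by minimality is a simple zero of a
factor of `P` and a zero of the matching factor of `denom`. Dividing out the factors `e^Λ - σ` one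
at a time shows that `denom · V` is entire. -/

section Proof

/-! ### Contour shifts in a strip -/

open MeasureTheory Filter Topology Complex

/-- The exceptional set accumulates nowhere, hence is null. This lets the poles of a meromorphic
function on a line be ignored under the integral. -/
theorem ae_of_forall_eventually_nhdsNE {p : ℝ → Prop} (h : ∀ s₀, ∀ᶠ s in 𝓝[≠] s₀, p s) :
    ∀ᵐ s, p s := by
  have h1 : {s | p s} ∈ codiscreteWithin (Set.univ : Set ℝ) := by
    rw [mem_codiscreteWithin_iff_forall_mem_nhdsNE]
    intro x _
    filter_upwards [h x] with s hs using Or.inl hs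
  have := ae_restrict_le_codiscreteWithin (μ := (volume : Measure ℝ)) MeasurableSet.univ h1
  rwa [Measure.restrict_univ] at this

theorem tendsto_ofReal_add_nhdsNE (w : ℂ) (s₀ : ℝ) :
    Tendsto (fun s : ℝ => (s : ℂ) + w) (𝓝[≠] s₀) (𝓝[≠] ((s₀ : ℂ) + w)) := by
  refine tendsto_nhdsWithin_of_tendsto_nhds_of_eventually_within _ ?_ ?_
  · exact ((by fun_prop : Continuous fun s : ℝ => (s : ℂ) + w).tendsto s₀).mono_left
      nhdsWithin_le_nhds
  · filter_upwards [self_mem_nhdsWithin] with s hs h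
    exact hs (by simpa using h)

theorem ae_line_of_forall_eventually_nhdsNE {p : ℂ → Prop} (w : ℂ)
    (h : ∀ s : ℝ, ∀ᶠ z in 𝓝[≠] ((s : ℂ) + w), p z) : ∀ᵐ s : ℝ, p ((s : ℂ) + w) :=
  ae_of_forall_eventually_nhdsNE fun s => (tendsto_ofReal_add_nhdsNE w s).eventually (h s)

theorem integrable_line_of_bound {Ψ : ℂ → ℂ} {M R₀ t : ℝ}
    (hc : Continuous fun s : ℝ => Ψ (s + t * I))
    (hb : ∀ s : ℝ, R₀ ≤ |s| → ‖Ψ (s + t * I)‖ ≤ M / (1 + s ^ 2)) :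
    Integrable fun s : ℝ => Ψ (s + t * I) := by
  have h1 : ∃ K, ∀ s : ℝ, ‖Ψ (s + t * I)‖ ≤ K * (1 + s ^ 2)⁻¹ := by
    obtain ⟨K, hK⟩ := (isCompact_Icc (a := -|R₀|) (b := |R₀|)).exists_bound_of_continuousOn
      hc.continuousOn
    refine ⟨max M (K * (1 + R₀ ^ 2)), fun s => ?_⟩
    have hpos : 0 < 1 + s ^ 2 := by positivity
    rcases le_total R₀ |s| with h | h
    · refine (hb s h).trans ?_
      rw [div_eq_mul_inv]
      gcongr
      exact le_max_left _ _
    · have h' : |s| ≤ |R₀| := h.trans (le_abs_self _)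
      have hs : ‖Ψ (s + t * I)‖ ≤ K := hK s (abs_le.1 h')
      have hK0 : 0 ≤ K := (norm_nonneg _).trans hs
      have h2 : s ^ 2 ≤ R₀ ^ 2 := sq_le_sq.2 h'
      calc ‖Ψ (s + t * I)‖ ≤ K := hs
        _ = K * (1 + s ^ 2) * (1 + s ^ 2)⁻¹ := by field_simp
        _ ≤ K * (1 + R₀ ^ 2) * (1 + s ^ 2)⁻¹ := by gcongr
        _ ≤ _ := by gcongr; exact le_max_right _ _
  obtain ⟨K, hK⟩ := h1
  refine (integrable_inv_one_add_sq.const_mul K).mono' hc.aestronglyMeasurable ?_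
  exact Eventually.of_forall hK

/-- Cauchy's theorem on the rectangle `[-T, T] × [-1, 0]`: the vertical sides contribute at most `M
/ (1 + T²)` each, which tends to `0`. -/
theorem contour_shift_of_continuousOn {Ψ : ℂ → ℂ} {M R₀ : ℝ}
    (ha : ∀ z : ℂ, -1 ≤ z.im → z.im ≤ 0 → DifferentiableAt ℂ Ψ z)
    (hb : ∀ z : ℂ, -1 ≤ z.im → z.im ≤ 0 → R₀ ≤ |z.re| → ‖Ψ z‖ ≤ M / (1 + z.re ^ 2)) :
    (Integrable fun s : ℝ => Ψ s) ∧ (Integrable fun s : ℝ => Ψ (s - I)) ∧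
      ∫ s : ℝ, Ψ (s - I) = ∫ s : ℝ, Ψ s := by
  have hline : ∀ t : ℝ, -1 ≤ t → t ≤ 0 → Integrable fun s : ℝ => Ψ (s + t * I) := by
    intro t h1 h2
    refine integrable_line_of_bound (M := M) (R₀ := R₀) ?_ ?_
    · refine continuous_iff_continuousAt.2 fun s => ?_
      have h3 : ContinuousAt Ψ ((s : ℂ) + t * I) :=
        (ha _ (by simpa using h1) (by simpa using h2)).continuousAt
      exact ContinuousAt.comp (f := fun s : ℝ => (s : ℂ) + t * I) h3 (by fun_prop)
    · intro s hs
      have := hb (s + t * I) (by simpa using h1) (by simpa using h2) (by simpa using hs)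
      simpa using this
  have i0 : Integrable fun s : ℝ => Ψ s := by simpa using hline 0 (by norm_num) le_rfl
  have i1 : Integrable fun s : ℝ => Ψ (s - I) := by
    simpa [sub_eq_add_neg] using hline (-1) le_rfl (by norm_num)
  refine ⟨i0, i1, ?_⟩
  have hrect : ∀ T : ℝ, (∫ s in -T..T, Ψ (s - I)) - (∫ s in -T..T, Ψ s) =
      -(I * ∫ y in (-1 : ℝ)..0, Ψ (T + y * I)) + I * ∫ y in (-1 : ℝ)..0, Ψ (-T + y * I) := by
    intro T
    have := integral_boundary_rect_eq_zero_of_differentiableOn Ψ (-T - I) (T)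
      (fun z hz => by
        have h2 := hz.2
        simp only [sub_im, neg_im, ofReal_im, I_im, Set.mem_preimage] at h2
        rw [Set.uIcc_of_le (by norm_num)] at h2
        exact (ha z (by simpa using h2.1) (by simpa using h2.2)).differentiableWithinAt)
    simp only [sub_re, neg_re, ofReal_re, I_re, sub_im, neg_im, ofReal_im, I_im, sub_zero,
      neg_zero, zero_sub, ofReal_neg, ofReal_one, neg_mul, one_mul, ofReal_zero, zero_mul,
      add_zero, smul_eq_mul, ← sub_eq_add_neg] at this
    linear_combination this
  have hside : ∀ σ : ℝ, |σ| = 1 →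
      Tendsto (fun T : ℝ => ∫ y in (-1 : ℝ)..0, Ψ ((σ * T : ℝ) + y * I)) atTop (𝓝 0) := by
    intro σ hσ
    have hlim : Tendsto (fun T : ℝ => M / (1 + T ^ 2)) atTop (𝓝 0) := by
      refine Tendsto.div_atTop tendsto_const_nhds ?_
      exact tendsto_atTop_add_const_left _ _ (tendsto_pow_atTop two_ne_zero)
    refine squeeze_zero_norm' ?_ hlim
    filter_upwards [eventually_ge_atTop (max R₀ 0)] with T hT
    have hT0 : 0 ≤ T := (le_max_right _ _).trans hT
    have hTa : |σ * T| = T := by rw [abs_mul, hσ, one_mul, abs_of_nonneg hT0]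
    have := intervalIntegral.norm_integral_le_of_norm_le_const (a := (-1 : ℝ)) (b := 0)
      (f := fun y : ℝ => Ψ ((σ * T : ℝ) + y * I)) (C := M / (1 + T ^ 2)) (fun y hy => by
        rw [Set.uIoc_of_le (by norm_num)] at hy
        have := hb ((σ * T : ℝ) + y * I) (by simpa using hy.1.le) (by simpa using hy.2)
          (by simpa [hTa, -ofReal_mul] using (le_max_left _ _).trans hT)
        have h4 : (σ * T) ^ 2 = T ^ 2 := by rw [← sq_abs, hTa]
        simpa [-ofReal_mul, h4] using this)
    simpa using this
  have hl : Tendsto (fun T : ℝ => (∫ s in -T..T, Ψ (s - I)) - (∫ s in -T..T, Ψ s)) atTop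
      (𝓝 ((∫ s : ℝ, Ψ (s - I)) - ∫ s : ℝ, Ψ s)) :=
    (intervalIntegral_tendsto_integral i1 tendsto_neg_atTop_atBot tendsto_id).sub
      (intervalIntegral_tendsto_integral i0 tendsto_neg_atTop_atBot tendsto_id)
  have hr : Tendsto (fun T : ℝ => -(I * ∫ y in (-1 : ℝ)..0, Ψ (T + y * I)) +
      I * ∫ y in (-1 : ℝ)..0, Ψ (-T + y * I)) atTop (𝓝 0) := by
    have h1 := (hside 1 (by simp)).const_mul I
    have h2 := (hside (-1) (by simp)).const_mul I
    simp only [one_mul, neg_one_mul, mul_zero, ofReal_neg] at h1 h2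
    simpa using h1.neg.add h2
  have := tendsto_nhds_unique (hl.congr hrect) hr
  exact sub_eq_zero.1 this

/-- Contour shift for a meromorphic function without poles in the closed strip. -/
theorem contour_shift {Φ : ℂ → ℂ} {M R₀ : ℝ} (hm : ∀ z, MeromorphicAt Φ z)
    (ho : ∀ z : ℂ, -1 ≤ z.im → z.im ≤ 0 → 0 ≤ meromorphicOrderAt Φ z)
    (hb : ∀ z : ℂ, -1 ≤ z.im → z.im ≤ 0 → R₀ ≤ |z.re| →
      AnalyticAt ℂ Φ z ∧ ‖Φ z‖ ≤ M / (1 + z.re ^ 2)) :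
    (Integrable fun s : ℝ => Φ s) ∧ (Integrable fun s : ℝ => Φ (s - I)) ∧
      ∫ s : ℝ, Φ (s - I) = ∫ s : ℝ, Φ s := by
  have hM : MeromorphicOn Φ Set.univ := fun z _ => hm z
  -- The normal form fills in the removable singularities: it is analytic in the closed strip, and
  -- it agrees with `Φ` wherever `Φ` is analytic and almost everywhere on each horizontal line.
  set Ψ := toMeromorphicNFOn Φ Set.univ with hΨ
  have hNF : ∀ z, MeromorphicNFAt Ψ z := fun z =>
    meromorphicNFOn_toMeromorphicNFOn Φ Set.univ (Set.mem_univ z)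
  have han : ∀ z : ℂ, -1 ≤ z.im → z.im ≤ 0 → AnalyticAt ℂ Ψ z := fun z h1 h2 => by
    rw [← (hNF z).meromorphicOrderAt_nonneg_iff_analyticAt, hΨ,
      meromorphicOrderAt_toMeromorphicNFOn hM (Set.mem_univ z)]
    exact ho z h1 h2
  have heq : ∀ z, AnalyticAt ℂ Φ z → Ψ z = Φ z := fun z hz => by
    simp [hΨ, toMeromorphicNFOn, hM, ← (toMeromorphicNFAt_eq_self.2 hz.meromorphicNFAt).symm]
  have key := contour_shift_of_continuousOn (Ψ := Ψ) (M := M) (R₀ := R₀)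
    (fun z h1 h2 => (han z h1 h2).differentiableAt)
    (fun z h1 h2 h3 => by rw [heq z (hb z h1 h2 h3).1]; exact (hb z h1 h2 h3).2)
  have hae : ∀ w : ℂ, ∀ᵐ s : ℝ, Ψ ((s : ℂ) + w) = Φ ((s : ℂ) + w) := fun w =>
    ae_line_of_forall_eventually_nhdsNE w fun s =>
      hM.toMeromorphicNFOn_eq_self_on_nhdsNE (Set.mem_univ _)
  have h0 : (fun s : ℝ => Ψ s) =ᵐ[volume] fun s : ℝ => Φ s := by
    filter_upwards [hae 0] with s hs
    simpa using hs
  have h1 : (fun s : ℝ => Ψ (s - I)) =ᵐ[volume] fun s : ℝ => Φ (s - I) := by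
    filter_upwards [hae (-I)] with s hs
    simpa [sub_eq_add_neg] using hs
  refine ⟨key.1.congr h0, key.2.1.congr h1, ?_⟩
  rw [← integral_congr_ae h0, ← integral_congr_ae h1]
  exact key.2.2

/-! ### A kernel that detects a simple pole -/

theorem norm_kernel_le {a b z : ℂ} (hre : b.re = a.re) (hz : 2 * |a.re| + 1 ≤ |z.re|) :
    ‖((z - a) * (z - b))⁻¹‖ ≤ 8 / (1 + z.re ^ 2) := by
  have h1 : |z.re - a.re| ≤ ‖z - a‖ := by simpa using abs_re_le_norm (z - a)
  have h2 : |z.re - a.re| ≤ ‖z - b‖ := by simpa [hre] using abs_re_le_norm (z - b)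
  have h3 : |z.re| - |a.re| ≤ |z.re - a.re| := abs_sub_abs_le_abs_sub _ _
  have h4 : 1 ≤ |z.re| := by linarith [abs_nonneg a.re]
  have h5 : |z.re| / 2 ≤ |z.re - a.re| := by linarith
  -- Since `|Re z| ≥ 1`, one has `(Re z)² / 4 ≥ (1 + (Re z)²) / 8`; hence the constant 8.
  have h6 : (1 + z.re ^ 2) / 8 ≤ ‖z - a‖ * ‖z - b‖ := by
    have : (|z.re| / 2) * (|z.re| / 2) ≤ ‖z - a‖ * ‖z - b‖ :=
      mul_le_mul (h5.trans h1) (h5.trans h2) (by positivity) (norm_nonneg _)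
    rw [← sq_abs z.re]
    nlinarith
  rw [norm_inv, norm_mul]
  calc (‖z - a‖ * ‖z - b‖)⁻¹ ≤ ((1 + z.re ^ 2) / 8)⁻¹ := inv_anti₀ (by positivity) h6
    _ = _ := by rw [inv_div]

theorem integrable_kernel {a b : ℂ} (hre : b.re = a.re) (t : ℝ)
    (hne : ∀ s : ℝ, ((s : ℂ) + t * I - a) * (s + t * I - b) ≠ 0) :
    Integrable fun s : ℝ => (((s : ℂ) + t * I - a) * (s + t * I - b))⁻¹ := by
  refine integrable_line_of_bound (Ψ := fun z => ((z - a) * (z - b))⁻¹) (M := 8)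
    (R₀ := 2 * |a.re| + 1) (Continuous.inv₀ (by fun_prop) hne) fun s hs => ?_
  simpa using norm_kernel_le (z := (s : ℂ) + t * I) hre (by simpa using hs)

/-- The kernel `1 / ((z - a) (z - b))`, where `b` is the reflection of `a` in the line
`Im z = -1`, has different integrals over the two boundary lines of the strip around `a`. -/
theorem integral_kernel_ne {a b : ℂ} (ha : -1 < a.im) (ha' : a.im < 0)
    (hb : b = starRingEnd ℂ a - 2 * I) :
    ∫ s : ℝ, (((s : ℂ) - I - a) * (s - I - b))⁻¹ ≠ ∫ s : ℝ, (((s : ℂ) - a) * (s - b))⁻¹ := by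
  have hbre : b.re = a.re := by simp [hb]
  have hbim : b.im = -a.im - 2 := by simp [hb]
  have hza : ∀ s : ℝ, (s : ℂ) - a ≠ 0 := fun s h => by
    have := congrArg Complex.im h; simp at this; linarith
  have hzb : ∀ s : ℝ, (s : ℂ) - b ≠ 0 := fun s h => by
    have := congrArg Complex.im h; simp [hbim] at this; linarith
  have hab : a - b ≠ 0 := fun h => by
    have := congrArg Complex.im h; simp [hbim] at this; linarith
  have hint : Integrable fun s : ℝ => (((s : ℂ) - a) * (s - b))⁻¹ := by
    simpa using integrable_kernel hbre 0 (fun s => by simpa using ⟨hza s, hzb s⟩)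
  -- This is why `b` is the reflection of `a`: on the lower line the integrand is `1 / |s - i -
  -- a|²`, so its integral is positive.
  have hconj : ∀ s : ℝ, (s : ℂ) - I - b = starRingEnd ℂ ((s : ℂ) - I - a) := fun s => by
    apply Complex.ext <;> simp [hbre, hbim]; ring
  have hzc : ∀ s : ℝ, (s : ℂ) - I - a ≠ 0 := fun s h => by
    have := congrArg Complex.im h; simp at this; linarith
  have hzd : ∀ s : ℝ, (s : ℂ) - I - b ≠ 0 := fun s => by
    rw [hconj]; exact (map_ne_zero _).2 (hzc s)
  have hint' : Integrable fun s : ℝ => (((s : ℂ) - I - a) * (s - I - b))⁻¹ := by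
    simpa [sub_eq_add_neg] using integrable_kernel hbre (-1) (fun s => by
      simpa [sub_eq_add_neg] using ⟨hzc s, hzd s⟩)
  -- the upper line
  have h0 : ∫ s : ℝ, (((s : ℂ) - a) * (s - b))⁻¹ = 0 := by
    -- Both `a` and `b` lie below the real line, so `s - a` and `s - b` have positive imaginary
    -- parts and their quotient is never a nonpositive real. Hence the principal logarithm gives a
    -- global primitive, which tends to `log 1 = 0` at both ends.
    have hslit : ∀ s : ℝ, ((s : ℂ) - a) / (s - b) ∈ slitPlane := by
      intro s
      rw [mem_slitPlane_iff_not_le_zero]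
      intro hle
      obtain ⟨hr, hi⟩ := Complex.le_def.1 hle
      set q := ((s : ℂ) - a) / (s - b) with hq
      have h1 : (s : ℂ) - a = q * (s - b) := by rw [hq, div_mul_cancel₀ _ (hzb s)]
      have h2 := congrArg Complex.im h1
      simp only [sub_im, ofReal_im, mul_im, hi, zero_im, zero_mul, add_zero, zero_sub, hbim] at h2
      simp only [zero_re] at hr
      nlinarith
    have hderiv : ∀ s : ℝ, HasDerivAt (fun s : ℝ => log (((s : ℂ) - a) / (s - b)) / (a - b))
        (((s : ℂ) - a) * (s - b))⁻¹ s := by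
      intro s
      have h1 : HasDerivAt (fun z : ℂ => log ((z - a) / (z - b)) / (a - b))
          (((s : ℂ) - a) * (s - b))⁻¹ s := by
        have := ((((hasDerivAt_id (s : ℂ)).sub_const a).div ((hasDerivAt_id (s : ℂ)).sub_const b)
          (hzb s)).clog (hslit s)).div_const (a - b)
        refine this.congr_deriv ?_
        have := hza s
        have := hzb s
        simp only [id, Pi.div_apply]
        field_simp
        ring
      exact h1.comp_ofReal
    have hlim : ∀ l : Filter ℝ, Tendsto (fun s : ℝ => ‖(s : ℂ) - b‖) l atTop →
        Tendsto (fun s : ℝ => log (((s : ℂ) - a) / (s - b)) / (a - b)) l (𝓝 0) := by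
      intro l hl
      have h1 : Tendsto (fun s : ℝ => 1 + (b - a) * ((s : ℂ) - b)⁻¹) l (𝓝 (1 + (b - a) * 0)) := by
        refine tendsto_const_nhds.add (tendsto_const_nhds.mul ?_)
        exact tendsto_inv₀_cobounded.comp (tendsto_norm_atTop_iff_cobounded.1 hl)
      rw [mul_zero, add_zero] at h1
      have h2 : Tendsto (fun s : ℝ => ((s : ℂ) - a) / (s - b)) l (𝓝 1) := by
        refine h1.congr fun s => ?_
        have := hzb s
        field_simp
        ring
      have h3 := ((continuousAt_clog one_mem_slitPlane).tendsto.comp h2).div_const (a - b)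
      simpa using h3
    have hnorm : ∀ s : ℝ, |s| - ‖b‖ ≤ ‖(s : ℂ) - b‖ := fun s => by
      simpa using norm_sub_norm_le (s : ℂ) b
    have := integral_of_hasDerivAt_of_tendsto hderiv hint
      (hlim atBot (tendsto_atTop_mono hnorm (tendsto_atTop_add_const_right _ _
        tendsto_abs_atBot_atTop)))
      (hlim atTop (tendsto_atTop_mono hnorm (tendsto_atTop_add_const_right _ _
        tendsto_abs_atTop_atTop)))
    rw [this, sub_zero]
  -- the lower line
  have h1 : ∀ s : ℝ, (((s : ℂ) - I - a) * (s - I - b))⁻¹ =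
      (((normSq ((s : ℂ) - I - a))⁻¹ : ℝ) : ℂ) := fun s => by
    rw [hconj, mul_conj, ofReal_inv]
  rw [h0]
  simp only [h1] at hint' ⊢
  rw [integral_complex_ofReal]
  have hpos : ∀ s : ℝ, 0 < (normSq ((s : ℂ) - I - a))⁻¹ := fun s => by
    have := hzc s
    exact inv_pos.2 (normSq_pos.2 this)
  have hint2 : Integrable fun s : ℝ => (normSq ((s : ℂ) - I - a))⁻¹ := by
    simpa using hint'.re
  have := (integral_pos_iff_support_of_nonneg (fun s => (hpos s).le) hint2).2 (by
    have : Function.support (fun s : ℝ => (normSq ((s : ℂ) - I - a))⁻¹) = Set.univ := by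
      ext s; simpa using (hzc s)
    rw [this]; simp)
  exact_mod_cast this.ne'

/-! ### Moments of exponentially decaying functions determine their Fourier and Gaussian integrals
-/

section ExpMoments

variable {X : Type*} [MeasurableSpace X] {μ : Measure X} {h l : X → ℂ} {ε K : ℝ}

theorem norm_cexp_I_mul_le {y w : ℂ} (hK : |w.im| ≤ K) :
    ‖cexp (I * y * w)‖ ≤ Real.exp (|y.re| * K + |y.im| * ‖w‖) := by
  rw [Complex.norm_exp, Real.exp_le_exp]
  have h1 : (I * y * w).re = -(y.re * w.im) - y.im * w.re := by simp; ring
  have h2 : -(y.re * w.im) ≤ |y.re| * K := by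
    refine (neg_le_abs _).trans ?_
    rw [abs_mul]; gcongr
  have h3 : -(y.im * w.re) ≤ |y.im| * ‖w‖ := by
    refine (neg_le_abs _).trans ?_
    rw [abs_mul]; gcongr; exact abs_re_le_norm w
  rw [h1]; linarith

theorem differentiableOn_integral_cexp (hl : AEStronglyMeasurable l μ)
    (hK : ∀ x, |(l x).im| ≤ K) (hi : Integrable (fun x => (Real.exp (ε * ‖l x‖) : ℂ) * h x) μ)
    (hh : AEStronglyMeasurable h μ) :
    DifferentiableOn ℂ (fun y : ℂ => ∫ x, cexp (I * y * l x) * h x ∂μ) {y | |y.im| < ε} := by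
  intro y₀ hy₀
  simp only [Set.mem_ofPred_eq] at hy₀
  -- Half the distance to the boundary of the strip. The reserve `e^{δ‖l‖}` absorbs the factor `l`
  -- that differentiation in `y` produces.
  set δ := (ε - |y₀.im|) / 2 with hδ
  have hδ0 : 0 < δ := by rw [hδ]; linarith
  set c := Real.exp ((|y₀.re| + δ) * |K|) with hc
  have hb : ∀ y ∈ Metric.ball y₀ δ, ∀ x,
      ‖cexp (I * y * l x)‖ ≤ c * Real.exp ((ε - δ) * ‖l x‖) := by
    intro y hy x
    rw [Metric.mem_ball, dist_eq_norm] at hy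
    have h1 : |y.re| ≤ |y₀.re| + δ := by
      have := (abs_re_le_norm (y - y₀)).trans hy.le
      rw [sub_re] at this
      have := abs_sub_abs_le_abs_sub y.re y₀.re
      linarith
    have h2 : |y.im| ≤ ε - δ := by
      have := (abs_im_le_norm (y - y₀)).trans hy.le
      rw [sub_im] at this
      have := abs_sub_abs_le_abs_sub y.im y₀.im
      linarith
    refine (norm_cexp_I_mul_le ((hK x).trans (le_abs_self K))).trans ?_
    rw [hc, ← Real.exp_add, Real.exp_le_exp]
    gcongr
  have hcont : ∀ y : ℂ, AEStronglyMeasurable (fun x => cexp (I * y * l x) * h x) μ := fun y =>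
    (continuous_exp.comp_aestronglyMeasurable (hl.const_mul (I * y))).mul hh
  refine (hasDerivAt_integral_of_dominated_loc_of_deriv_le (μ := μ)
    (F := fun y x => cexp (I * y * l x) * h x)
    (F' := fun y x => I * l x * (cexp (I * y * l x) * h x))
    (bound := fun x => c / δ * ‖(Real.exp (ε * ‖l x‖) : ℂ) * h x‖)
    (Metric.ball_mem_nhds y₀ hδ0) (Eventually.of_forall hcont) ?_
    ((hl.const_mul I).mul (hcont y₀)) ?_ (hi.norm.const_mul _) ?_).2.differentiableAt.differentiableWithinAt
  · refine (hi.norm.const_mul c).mono' (hcont y₀) (Eventually.of_forall fun x => ?_)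
    rw [norm_mul, norm_mul, ← mul_assoc]
    gcongr
    refine (hb y₀ (Metric.mem_ball_self hδ0) x).trans ?_
    rw [norm_real, Real.norm_of_nonneg (Real.exp_pos _).le]
    gcongr
    linarith
  · refine Eventually.of_forall fun x y hy => ?_
    rw [norm_mul, norm_mul, norm_mul, norm_I, one_mul, norm_mul, norm_real,
      Real.norm_of_nonneg (Real.exp_pos _).le]
    have h1 : δ * ‖l x‖ ≤ Real.exp (δ * ‖l x‖) := by
      linarith [Real.add_one_le_exp (δ * ‖l x‖)]
    have h2 : ‖l x‖ * Real.exp ((ε - δ) * ‖l x‖) ≤ δ⁻¹ * Real.exp (ε * ‖l x‖) := by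
      have : Real.exp (ε * ‖l x‖) = Real.exp (δ * ‖l x‖) * Real.exp ((ε - δ) * ‖l x‖) := by
        rw [← Real.exp_add]; congr 1; ring
      rw [this, ← mul_assoc]
      gcongr
      rw [inv_mul_eq_div, le_div_iff₀ hδ0]; linarith
    calc ‖l x‖ * (‖cexp (I * y * l x)‖ * ‖h x‖)
        ≤ ‖l x‖ * ((c * Real.exp ((ε - δ) * ‖l x‖)) * ‖h x‖) := by gcongr; exact hb y hy x
      _ = c * (‖l x‖ * Real.exp ((ε - δ) * ‖l x‖)) * ‖h x‖ := by ring
      _ ≤ c * (δ⁻¹ * Real.exp (ε * ‖l x‖)) * ‖h x‖ := by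
          gcongr
      _ = _ := by ring
  · refine Eventually.of_forall fun x y _ => ?_
    have h1 : HasDerivAt (fun y : ℂ => I * y * l x) (I * l x) y := by
      simpa using ((hasDerivAt_id y).const_mul I).mul_const (l x)
    refine (h1.cexp.mul_const (h x)).congr_deriv ?_
    ring

theorem hasSum_integral_cexp (hl : AEStronglyMeasurable l μ)
    (hi : Integrable (fun x => (Real.exp (ε * ‖l x‖) : ℂ) * h x) μ)
    (hh : AEStronglyMeasurable h μ) {y : ℂ} (hy : ‖y‖ ≤ ε) :
    HasSum (fun n : ℕ => (I * y) ^ n / (n.factorial : ℂ) * ∫ x, l x ^ n * h x ∂μ)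
      (∫ x, cexp (I * y * l x) * h x ∂μ) := by
  have hs : ∀ x, HasSum (fun n : ℕ => ‖y‖ ^ n * ‖l x‖ ^ n / n.factorial * ‖h x‖)
      (Real.exp (‖y‖ * ‖l x‖) * ‖h x‖) := fun x => by
    have := (NormedSpace.expSeries_div_hasSum_exp (𝔸 := ℝ) (‖y‖ * ‖l x‖)).mul_right ‖h x‖
    rw [← Real.exp_eq_exp_ℝ] at this
    simpa only [mul_pow] using this
  have := hasSum_integral_of_dominated_convergence (μ := μ)
    (F := fun (n : ℕ) x => (I * y) ^ n / (n.factorial : ℂ) * (l x ^ n * h x))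
    (f := fun x => cexp (I * y * l x) * h x)
    (fun n x => ‖y‖ ^ n * ‖l x‖ ^ n / n.factorial * ‖h x‖)
    (fun n => ((hl.pow n).mul hh).const_mul _)
    (fun n => Eventually.of_forall fun x => by
      simp only [norm_mul, norm_div, norm_pow, norm_I, one_mul, norm_natCast]
      apply le_of_eq; ring)
    (Eventually.of_forall fun x => (hs x).summable)
    (by
      simp only [fun x => (hs x).tsum_eq]
      refine hi.norm.mono' ?_ (Eventually.of_forall fun x => ?_)
      · exact (Real.continuous_exp.comp_aestronglyMeasurable
          ((hl.norm).const_mul ‖y‖)).mul hh.norm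
      · rw [norm_mul, norm_mul, norm_norm, norm_real]
        gcongr
        rw [Real.norm_of_nonneg (Real.exp_pos _).le, Real.norm_of_nonneg (Real.exp_pos _).le]
        gcongr)
    (Eventually.of_forall fun x => by
      have := (NormedSpace.expSeries_div_hasSum_exp (𝔸 := ℂ) (I * y * l x)).mul_right (h x)
      rw [← Complex.exp_eq_exp_ℂ] at this
      refine this.congr_fun fun n => ?_
      rw [mul_pow]; ring)
  simpa only [integral_const_mul] using this

/-- Two exponentially decaying functionals that agree on polynomials agree on exponentials. -/
theorem integral_cexp_eq_of_moments {h₁ l₁ h₂ l₂ : X → ℂ} (hε : 0 < ε)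
    (hl₁ : AEStronglyMeasurable l₁ μ) (hl₂ : AEStronglyMeasurable l₂ μ)
    (hK₁ : ∀ x, |(l₁ x).im| ≤ K) (hK₂ : ∀ x, |(l₂ x).im| ≤ K)
    (hh₁ : AEStronglyMeasurable h₁ μ) (hh₂ : AEStronglyMeasurable h₂ μ)
    (hi₁ : Integrable (fun x => (Real.exp (ε * ‖l₁ x‖) : ℂ) * h₁ x) μ)
    (hi₂ : Integrable (fun x => (Real.exp (ε * ‖l₂ x‖) : ℂ) * h₂ x) μ)
    (heq : ∀ n : ℕ, ∫ x, l₁ x ^ n * h₁ x ∂μ = ∫ x, l₂ x ^ n * h₂ x ∂μ) (y : ℝ) :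
    ∫ x, cexp (I * y * l₁ x) * h₁ x ∂μ = ∫ x, cexp (I * y * l₂ x) * h₂ x ∂μ := by
  -- Both sides are holomorphic in this strip, and on a disc around `0` they are the power series
  -- formed from the moments; the identity theorem carries the equality to all real `y`.
  set s : Set ℂ := {y | |y.im| < ε} with hs
  have hso : IsOpen s := isOpen_lt (continuous_abs.comp continuous_im) continuous_const
  have hsc : IsPreconnected s := by
    have : s = im ⁻¹' (Metric.ball 0 ε) := by ext; simp [hs]
    rw [this]
    exact ((convex_ball (0 : ℝ) ε).is_linear_preimage
      imCLM.toLinearMap.isLinear).isPreconnected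
  have d := ((differentiableOn_integral_cexp hl₁ hK₁ hi₁ hh₁).analyticOnNhd hso)
  have d' := ((differentiableOn_integral_cexp hl₂ hK₂ hi₂ hh₂).analyticOnNhd hso)
  have := d.eqOn_of_preconnected_of_eventuallyEq d' hsc (z₀ := 0) (by simpa [hs] using hε) ?_
  · exact this (x := (y : ℂ)) (by simpa [hs] using hε)
  · filter_upwards [Metric.ball_mem_nhds (0 : ℂ) hε] with y hy
    have hy' : ‖y‖ ≤ ε := by simpa using (mem_ball_zero_iff.1 hy).le
    refine (hasSum_integral_cexp hl₁ hi₁ hh₁ hy').unique ?_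
    simpa only [heq] using hasSum_integral_cexp hl₂ hi₂ hh₂ hy'

theorem integrable_gaussian_prod [SFinite μ] (hl : AEStronglyMeasurable l μ)
    (hK : ∀ x, |(l x).im| ≤ K) (hi : Integrable h μ) (y : ℝ) :
    Integrable (fun p : X × ℝ => cexp (I * (p.2 + y : ℝ) * l p.1) *
      (cexp (-(1 / 2) * (p.2 : ℂ) ^ 2)) * h p.1) (μ.prod volume) := by
  have hg : Integrable (fun t : ℝ => Real.exp (-(1 / 2) * t ^ 2 + |K| * t) +
      Real.exp (-(1 / 2) * t ^ 2 + -|K| * t)) := by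
    have : ∀ c : ℝ, Integrable (fun t : ℝ => Real.exp (-(1 / 2) * t ^ 2 + c * t)) := fun c => by
      have := (integrable_cexp_quadratic (b := 1 / 2) (by norm_num) c 0).norm
      refine this.congr (Eventually.of_forall fun t => ?_)
      simp only [Complex.norm_exp]
      congr 1
      simp [← ofReal_pow]
    exact (this _).add (this _)
  have hb := (hi.norm.const_mul (Real.exp (|y| * |K|))).mul_prod hg
  refine hb.mono' ?_ (Eventually.of_forall fun p => ?_)
  · refine AEStronglyMeasurable.mul (AEStronglyMeasurable.mul ?_ ?_) hi.1.comp_fst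
    · refine continuous_exp.comp_aestronglyMeasurable (AEStronglyMeasurable.mul ?_ hl.comp_fst)
      have : Continuous fun t : ℝ => I * ((t + y : ℝ) : ℂ) := by fun_prop
      exact (this.aestronglyMeasurable (μ := volume)).comp_snd
    · have : Continuous fun t : ℝ => cexp (-(1 / 2) * (t : ℂ) ^ 2) := by fun_prop
      exact (this.aestronglyMeasurable (μ := volume)).comp_snd
  · rw [norm_mul, norm_mul]
    have h1 : ‖cexp (I * (p.2 + y : ℝ) * l p.1)‖ ≤ Real.exp (|y| * |K|) * Real.exp (|K| * |p.2|) := by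
      refine (norm_cexp_I_mul_le ((hK p.1).trans (le_abs_self K))).trans ?_
      rw [← Real.exp_add, Real.exp_le_exp, ofReal_re, ofReal_im, abs_zero, zero_mul, add_zero]
      nlinarith [abs_add_le p.2 y, abs_nonneg K]
    have h2 : ‖cexp (-(1 / 2) * (p.2 : ℂ) ^ 2)‖ = Real.exp (-(1 / 2) * p.2 ^ 2) := by
      rw [Complex.norm_exp]; congr 1; simp [← ofReal_pow]
    have h3 : Real.exp (|K| * |p.2|) * Real.exp (-(1 / 2) * p.2 ^ 2) ≤
        Real.exp (-(1 / 2) * p.2 ^ 2 + |K| * p.2) + Real.exp (-(1 / 2) * p.2 ^ 2 + -|K| * p.2) := by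
      rw [← Real.exp_add]
      rcases le_total 0 p.2 with h | h
      · rw [abs_of_nonneg h, add_comm]
        exact le_add_of_nonneg_right (Real.exp_pos _).le
      · rw [abs_of_nonpos h, add_comm, mul_neg, ← neg_mul]
        exact le_add_of_nonneg_left (Real.exp_pos _).le
    calc _ ≤ Real.exp (|y| * |K|) * Real.exp (|K| * |p.2|) * Real.exp (-(1 / 2) * p.2 ^ 2) *
          ‖h p.1‖ := by rw [h2]; gcongr
      _ = Real.exp (|y| * |K|) * ‖h p.1‖ *
          (Real.exp (|K| * |p.2|) * Real.exp (-(1 / 2) * p.2 ^ 2)) := by ring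
      _ ≤ _ := by gcongr

/-- A Gaussian is a superposition of exponentials `e^{itl}` with Gaussian weights in `t`, so Fubini
reduces Gaussian integrals to exponential ones. -/
theorem integral_gaussian_mul_eq [SFinite μ] (hl : AEStronglyMeasurable l μ)
    (hK : ∀ x, |(l x).im| ≤ K) (hi : Integrable h μ) (y : ℝ) :
    ∫ x, cexp (-(l x) ^ 2 / 2) * cexp (I * y * l x) * h x ∂μ =
      ((Real.pi / (1 / 2 : ℂ)) ^ (1 / 2 : ℂ))⁻¹ * ∫ t : ℝ, cexp (-(1 / 2) * (t : ℂ) ^ 2) *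
        ∫ x, cexp (I * (t + y : ℝ) * l x) * h x ∂μ := by
  have hC : ((Real.pi : ℂ) / (1 / 2 : ℂ)) ^ (1 / 2 : ℂ) ≠ 0 := by
    rw [Ne, cpow_eq_zero_iff]
    simp [Real.pi_ne_zero]
  have hF := integrable_gaussian_prod hl hK hi y
  have h1 : ∀ x, cexp (-(l x) ^ 2 / 2) * cexp (I * y * l x) * h x =
      ((Real.pi / (1 / 2 : ℂ)) ^ (1 / 2 : ℂ))⁻¹ * ∫ t : ℝ, cexp (I * (t + y : ℝ) * l x) *
      (cexp (-(1 / 2) * (t : ℂ) ^ 2)) * h x := by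
    intro x
    have := fourierIntegral_gaussian (b := 1 / 2) (by norm_num) (l x)
    have h2 : ∀ t : ℝ, cexp (I * (t + y : ℝ) * l x) * (cexp (-(1 / 2) * (t : ℂ) ^ 2)) * h x =
        cexp (I * l x * t) * cexp (-(1 / 2) * (t : ℂ) ^ 2) * (cexp (I * y * l x) * h x) := by
      intro t
      have : cexp (I * (t + y : ℝ) * l x) = cexp (I * l x * t) * cexp (I * y * l x) := by
        rw [← Complex.exp_add]; congr 1; push_cast; ring
      rw [this]; ring
    simp only [h2]
    rw [integral_mul_const, this]
    have h3 : -(l x) ^ 2 / (4 * (1 / 2)) = -(l x) ^ 2 / 2 := by ring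
    rw [h3]
    field_simp
  simp only [h1]
  rw [integral_const_mul]
  congr 1
  rw [integral_integral_swap (f := fun x t => cexp (I * (t + y : ℝ) * l x) *
      (cexp (-(1 / 2) * (t : ℂ) ^ 2)) * h x) hF]
  refine integral_congr_ae (Eventually.of_forall fun t => ?_)
  simp only
  rw [← integral_const_mul]
  refine integral_congr_ae (Eventually.of_forall fun x => ?_)
  simp only
  ring

/-- Two exponentially decaying functionals that agree on polynomials agree on Gaussians. -/
theorem integral_gaussian_eq_of_moments [SFinite μ] {h₁ l₁ h₂ l₂ : X → ℂ} (hε : 0 < ε)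
    (hl₁ : AEStronglyMeasurable l₁ μ) (hl₂ : AEStronglyMeasurable l₂ μ)
    (hK₁ : ∀ x, |(l₁ x).im| ≤ K) (hK₂ : ∀ x, |(l₂ x).im| ≤ K)
    (hh₁ : Integrable h₁ μ) (hh₂ : Integrable h₂ μ)
    (hi₁ : Integrable (fun x => (Real.exp (ε * ‖l₁ x‖) : ℂ) * h₁ x) μ)
    (hi₂ : Integrable (fun x => (Real.exp (ε * ‖l₂ x‖) : ℂ) * h₂ x) μ)
    (heq : ∀ n : ℕ, ∫ x, l₁ x ^ n * h₁ x ∂μ = ∫ x, l₂ x ^ n * h₂ x ∂μ) (y : ℝ) :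
    ∫ x, cexp (-(l₁ x) ^ 2 / 2) * cexp (I * y * l₁ x) * h₁ x ∂μ =
      ∫ x, cexp (-(l₂ x) ^ 2 / 2) * cexp (I * y * l₂ x) * h₂ x ∂μ := by
  rw [integral_gaussian_mul_eq hl₁ hK₁ hh₁, integral_gaussian_mul_eq hl₂ hK₂ hh₂]
  congr 2
  ext t
  rw [integral_cexp_eq_of_moments hε hl₁ hl₂ hK₁ hK₂ hh₁.1 hh₂.1 hi₁ hi₂ heq]

end ExpMoments

/-! ### Clearing poles, growth estimates and Fourier uniqueness -/

/-- Near `x` the only possible pole is `x` itself, and a power of `X - x` clears it. Compactness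
makes finitely many such powers suffice. -/
theorem exists_polynomial_mul_order_nonneg {G : ℂ → ℂ} (hm : ∀ z, MeromorphicAt G z) {S : Set ℂ}
    (hS : IsCompact S) :
    ∃ p : Polynomial ℂ, p ≠ 0 ∧ ∀ z ∈ S, 0 ≤ meromorphicOrderAt (fun w => p.eval w * G w) z := by
  have hpm : ∀ (p : Polynomial ℂ) z, AnalyticAt ℂ (fun w => p.eval w) z := fun p z =>
    p.differentiable.analyticAt z
  refine hS.induction_on ⟨1, one_ne_zero, by simp⟩ ?_ ?_ ?_
  · rintro s t hst ⟨p, hp, h⟩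
    exact ⟨p, hp, fun z hz => h z (hst hz)⟩
  · rintro s t ⟨p, hp, h⟩ ⟨p', hp', h'⟩
    refine ⟨p' * p, mul_ne_zero hp' hp, ?_⟩
    rintro z (hz | hz)
    · have : (fun w => (p' * p).eval w * G w) = fun w => p'.eval w * (p.eval w * G w) := by
        ext w; simp; ring
      rw [this, fun_meromorphicOrderAt_mul (hpm _ _).meromorphicAt
        ((hpm _ _).meromorphicAt.fun_mul (hm z))]
      exact add_nonneg (hpm _ _).meromorphicOrderAt_nonneg (h z hz)
    · have : (fun w => (p' * p).eval w * G w) = fun w => p.eval w * (p'.eval w * G w) := by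
        ext w; simp; ring
      rw [this, fun_meromorphicOrderAt_mul (hpm _ _).meromorphicAt
        ((hpm _ _).meromorphicAt.fun_mul (hm z))]
      exact add_nonneg (hpm _ _).meromorphicOrderAt_nonneg (h' z hz)
  · intro x _
    obtain ⟨n, hn⟩ := hm x
    have hev := (hm x).eventually_analyticAt
    rw [eventually_nhdsWithin_iff] at hev
    refine ⟨_, mem_nhdsWithin_of_mem_nhds hev, (Polynomial.X - Polynomial.C x) ^ n,
      pow_ne_zero _ (Polynomial.X_sub_C_ne_zero x), fun z hz => ?_⟩
    by_cases hzx : z = x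
    · subst hzx
      refine AnalyticAt.meromorphicOrderAt_nonneg ?_
      simpa using hn
    · exact AnalyticAt.meromorphicOrderAt_nonneg ((hpm _ _).mul (hz hzx))

theorem integral_congr_fun {X : Type*} [MeasurableSpace X] {μ : Measure X} {f g : X → ℂ}
    (h : ∀ x, f x = g x) : ∫ x, f x ∂μ = ∫ x, g x ∂μ := by
  rw [funext h]

theorem integrable_exp_neg_mul_norm {E : Type*} [NormedAddCommGroup E] [NormedSpace ℝ E]
    [FiniteDimensional ℝ E] [MeasurableSpace E] [BorelSpace E] (μ : Measure E)
    [μ.IsAddHaarMeasure] {ε : ℝ} (hε : 0 < ε) :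
    Integrable (fun x => Real.exp (-ε * ‖x‖)) μ := by
  -- The first integer power for which `(1 + ‖x‖)^{-n}` is integrable.
  set n := Module.finrank ℝ E + 1 with hn
  have h1 := (integrable_one_add_norm (μ := μ) (E := E) (r := n) (by simp [hn])).const_mul
    (Real.exp ε * (n.factorial / ε ^ n))
  refine h1.mono' (by fun_prop : Continuous fun x : E => _).aestronglyMeasurable
    (Eventually.of_forall fun x => ?_)
  rw [Real.norm_of_nonneg (Real.exp_pos _).le, Real.rpow_neg (by positivity), Real.rpow_natCast]
  have h2 := Real.pow_div_factorial_le_exp (ε * (1 + ‖x‖)) (by positivity) n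
  rw [mul_pow, mul_add, mul_one, Real.exp_add, div_le_iff₀ (by positivity)] at h2
  rw [neg_mul, Real.exp_neg, ← div_eq_mul_inv, le_div_iff₀ (by positivity),
    inv_mul_le_iff₀ (Real.exp_pos _), ← mul_assoc, ← mul_div_assoc, le_div_iff₀ (by positivity)]
  linarith

theorem norm_le_of_strip {z : ℂ} (hz : |z.im| ≤ 1) : ‖z‖ ≤ |z.re| + 1 :=
  (norm_le_abs_re_add_abs_im z).trans (by linarith)

theorem exists_bound_polynomial_strip (p : Polynomial ℂ) {a : ℝ} (ha : 0 < a) :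
    ∃ C : ℝ, 0 ≤ C ∧ ∀ z : ℂ, |z.im| ≤ 1 → ‖p.eval z‖ ≤ C * Real.exp (a * |z.re|) := by
  induction p using Polynomial.induction_on' with
  | add p q hp hq =>
    obtain ⟨C, hC, h⟩ := hp
    obtain ⟨C', hC', h'⟩ := hq
    refine ⟨C + C', by positivity, fun z hz => ?_⟩
    rw [Polynomial.eval_add, add_mul]
    exact (norm_add_le _ _).trans (add_le_add (h z hz) (h' z hz))
  | monomial n b =>
    refine ⟨‖b‖ * (n.factorial / a ^ n * Real.exp a), by positivity, fun z hz => ?_⟩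
    rw [Polynomial.eval_monomial, norm_mul, norm_pow, mul_assoc]
    gcongr
    have h1 := Real.pow_div_factorial_le_exp (a * ‖z‖) (by positivity) n
    have h2 : Real.exp (a * ‖z‖) ≤ Real.exp a * Real.exp (a * |z.re|) := by
      rw [← Real.exp_add, Real.exp_le_exp]
      nlinarith [norm_le_of_strip hz]
    rw [mul_pow, div_le_iff₀ (by positivity)] at h1
    have h3 : ‖z‖ ^ n ≤ n.factorial / a ^ n * Real.exp (a * ‖z‖) := by
      rw [div_mul_eq_mul_div, le_div_iff₀ (by positivity)]; linarith
    calc ‖z‖ ^ n ≤ n.factorial / a ^ n * Real.exp (a * ‖z‖) := h3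
      _ ≤ n.factorial / a ^ n * (Real.exp a * Real.exp (a * |z.re|)) := by gcongr
      _ = _ := by ring

theorem norm_gaussian_le {z : ℂ} {δ : ℝ} (hδ : 0 ≤ δ) (hz : |z.im| ≤ 1) :
    ‖cexp (-(δ * z ^ 2))‖ ≤ Real.exp δ * Real.exp (-(δ * z.re ^ 2)) := by
  rw [Complex.norm_exp, ← Real.exp_add, Real.exp_le_exp]
  have : (-((δ : ℂ) * z ^ 2)).re = -(δ * (z.re ^ 2 - z.im ^ 2)) := by simp [sq]
  rw [this]
  have : z.im ^ 2 ≤ 1 := (sq_le_one_iff_abs_le_one _).2 hz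
  nlinarith

/-- A Gaussian beats exponential growth in the strip `|Im z| ≤ 1`. -/
theorem exists_bound_gaussian_mul {δ C : ℝ} (hδ : 0 < δ) (hC : 0 ≤ C) :
    ∃ M, ∀ (z : ℂ) (g : ℂ), |z.im| ≤ 1 → ‖g‖ ≤ C * Real.exp (C * |z.re|) →
      ‖cexp (-(δ * z ^ 2)) * g‖ ≤ M / (1 + z.re ^ 2) := by
  -- Half of the Gaussian absorbs the factor `1 + x²`, at the cost of `1 + 2/δ`. The other half
  -- absorbs `e^{Cx}`; completing the square costs `e^{C²/(2δ)}`.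
  refine ⟨Real.exp δ * C * ((1 + 2 / δ) * Real.exp (C ^ 2 / (2 * δ))), fun z g hz hg => ?_⟩
  rw [norm_mul, le_div_iff₀ (by positivity)]
  set x := |z.re| with hx
  have hxx : z.re ^ 2 = x ^ 2 := (sq_abs _).symm
  have h1 : 1 + x ^ 2 ≤ (1 + 2 / δ) * Real.exp (δ / 2 * x ^ 2) := by
    have := Real.add_one_le_exp (δ / 2 * x ^ 2)
    have h2 : (1 + 2 / δ) * (δ / 2 * x ^ 2 + 1) = δ / 2 * x ^ 2 + x ^ 2 + 1 + 2 / δ := by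
      field_simp; ring
    have h3 : 0 ≤ 2 / δ := by positivity
    nlinarith [sq_nonneg x, mul_nonneg hδ.le (sq_nonneg x)]
  have h2 : Real.exp (-(δ * x ^ 2)) * Real.exp (C * x) * Real.exp (δ / 2 * x ^ 2) ≤
      Real.exp (C ^ 2 / (2 * δ)) := by
    rw [← Real.exp_add, ← Real.exp_add, Real.exp_le_exp, le_div_iff₀ (by positivity)]
    nlinarith [sq_nonneg (δ * x - C)]
  calc ‖cexp (-(δ * z ^ 2))‖ * ‖g‖ * (1 + z.re ^ 2)
      ≤ (Real.exp δ * Real.exp (-(δ * x ^ 2))) * (C * Real.exp (C * x)) *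
        ((1 + 2 / δ) * Real.exp (δ / 2 * x ^ 2)) := by
        have := norm_gaussian_le hδ.le hz
        rw [hxx] at *
        gcongr
    _ = Real.exp δ * C * ((1 + 2 / δ) *
        (Real.exp (-(δ * x ^ 2)) * Real.exp (C * x) * Real.exp (δ / 2 * x ^ 2))) := by ring
    _ ≤ _ := by gcongr

/-- A function whose Fourier transform vanishes is zero wherever it is continuous. -/
theorem eq_zero_of_fourier_eq_zero {E : Type*} [NormedAddCommGroup E] [InnerProductSpace ℝ E]
    [FiniteDimensional ℝ E] [MeasurableSpace E] [BorelSpace E] {u : E → ℂ} (hu : Integrable u)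
    (h : ∀ w : E, ∫ x, cexp (I * (inner ℝ x w : ℝ)) * u x = 0) {x : E} (hx : ContinuousAt u x) :
    u x = 0 := by
  have h1 : FourierTransform.fourier u = 0 := by
    ext w
    rw [Real.fourier_eq']
    have := h (-(2 * Real.pi) • w)
    simp only [inner_smul_right] at this
    rw [Pi.zero_apply, ← this]
    refine integral_congr_ae (Eventually.of_forall fun y => ?_)
    simp only [smul_eq_mul]
    congr 2
    push_cast; ring
  have h2 := hu.fourierInv_fourier_eq (by rw [h1]; exact integrable_zero _ _ _) hx
  rw [h1, Real.fourierInv_eq'] at h2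
  simpa using h2.symm

theorem eq_zero_of_fourier_eq_zero_real {u : ℝ → ℂ} (hu : Integrable u)
    (h : ∀ y : ℝ, ∫ s : ℝ, cexp (I * y * s) * u s = 0) {s : ℝ} (hs : ContinuousAt u s) :
    u s = 0 := by
  refine eq_zero_of_fourier_eq_zero hu (fun w => ?_) hs
  rw [← h w]
  refine integral_congr_ae (Eventually.of_forall fun y => ?_)
  simp [mul_assoc]

/-! ### The shift identity on a line: quasi-periodicity and absence of poles -/

/-- The Gaussian test function `e^{-δz²} e^{iyz} p(z)`. -/
noncomputable def gaussTest (δ y : ℝ) (p : Polynomial ℂ) (z : ℂ) : ℂ :=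
  cexp (-(δ * z ^ 2)) * (cexp (I * y * z) * p.eval z)

theorem analyticAt_gaussTest (δ y : ℝ) (p : Polynomial ℂ) (z : ℂ) :
    AnalyticAt ℂ (gaussTest δ y p) z := by
  have : Differentiable ℂ (gaussTest δ y p) := by
    have := p.differentiable
    unfold gaussTest; fun_prop
  exact this.analyticAt z

/-- Meromorphic functions of exponential growth near the ends of the strip `|Im z| ≤ 1`. -/
structure StripGrowth (W : ℂ → ℂ) (R C : ℝ) : Prop where
  mero : ∀ z, MeromorphicAt W z
  nonneg : 0 ≤ C
  ends : ∀ z : ℂ, -1 ≤ z.im → z.im ≤ 0 → R ≤ |z.re| →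
    AnalyticAt ℂ W z ∧ ‖W z‖ ≤ C * Real.exp (C * |z.re|)

theorem StripGrowth.bound_gaussTest {W : ℂ → ℂ} {R C : ℝ} (h : StripGrowth W R C) {δ : ℝ}
    (hδ : 0 < δ) (y : ℝ) (p : Polynomial ℂ) :
    ∃ M, ∀ z : ℂ, -1 ≤ z.im → z.im ≤ 0 → R ≤ |z.re| →
      AnalyticAt ℂ (fun z => gaussTest δ y p z * W z) z ∧
        ‖gaussTest δ y p z * W z‖ ≤ M / (1 + z.re ^ 2) := by
  obtain ⟨C', hC', hp⟩ := exists_bound_polynomial_strip p one_pos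
  have hC := h.nonneg
  set K := max (Real.exp |y| * C' * C) (C + 1) with hK
  have hK0 : 0 ≤ K := (by positivity : 0 ≤ C + 1).trans (le_max_right _ _)
  obtain ⟨M, hM⟩ := exists_bound_gaussian_mul hδ hK0
  refine ⟨M, fun z h1 h2 h3 => ⟨(analyticAt_gaussTest δ y p z).mul (h.ends z h1 h2 h3).1, ?_⟩⟩
  have hz : |z.im| ≤ 1 := abs_le.2 ⟨h1, by linarith⟩
  have hb : ‖cexp (I * y * z) * p.eval z * W z‖ ≤ K * Real.exp (K * |z.re|) := by
    have e1 : ‖cexp (I * y * z)‖ ≤ Real.exp |y| := by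
      refine (norm_cexp_I_mul_le hz).trans ?_
      simp
    calc ‖cexp (I * y * z) * p.eval z * W z‖ = ‖cexp (I * y * z)‖ * ‖p.eval z‖ * ‖W z‖ := by
          rw [norm_mul, norm_mul]
      _ ≤ Real.exp |y| * (C' * Real.exp (1 * |z.re|)) * (C * Real.exp (C * |z.re|)) := by
          gcongr
          · exact hp z hz
          · exact (h.ends z h1 h2 h3).2
      _ = (Real.exp |y| * C' * C) * Real.exp ((C + 1) * |z.re|) := by
          rw [show (C + 1) * |z.re| = 1 * |z.re| + C * |z.re| by ring, Real.exp_add]; ring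
      _ ≤ _ := by
          gcongr
          · exact le_max_left _ _
          · exact le_max_right _ _
  have := hM z _ hz hb
  simpa only [gaussTest, mul_assoc] using this

theorem StripGrowth.contour_shift {W : ℂ → ℂ} {R C : ℝ} (h : StripGrowth W R C) {δ : ℝ}
    (hδ : 0 < δ) (y : ℝ) (p : Polynomial ℂ)
    (ho : ∀ z : ℂ, -1 ≤ z.im → z.im ≤ 0 → 0 ≤ meromorphicOrderAt (fun w => p.eval w * W w) z) :
    (Integrable fun s : ℝ => gaussTest δ y p s * W s) ∧
      (Integrable fun s : ℝ => gaussTest δ y p (s - I) * W (s - I)) ∧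
      ∫ s : ℝ, gaussTest δ y p (s - I) * W (s - I) = ∫ s : ℝ, gaussTest δ y p s * W s := by
  obtain ⟨M, hM⟩ := h.bound_gaussTest hδ y p
  refine _root_.contour_shift (Φ := fun z => gaussTest δ y p z * W z) (M := M) (R₀ := R)
    (fun z => (analyticAt_gaussTest δ y p z).meromorphicAt.mul (h.mero z)) (fun z h1 h2 => ?_) hM
  have hpm : AnalyticAt ℂ (fun w => p.eval w) z := p.differentiable.analyticAt z
  have hg : AnalyticAt ℂ (fun z : ℂ => cexp (-(δ * z ^ 2)) * cexp (I * y * z)) z := by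
    have : Differentiable ℂ (fun z : ℂ => cexp (-(δ * z ^ 2)) * cexp (I * y * z)) := by fun_prop
    exact this.analyticAt z
  have : (fun z => gaussTest δ y p z * W z) =
      fun z => (cexp (-(δ * z ^ 2)) * cexp (I * y * z)) * (p.eval z * W z) := by
    ext w; simp only [gaussTest]; ring
  rw [this, fun_meromorphicOrderAt_mul hg.meromorphicAt (hpm.meromorphicAt.fun_mul (h.mero z))]
  exact add_nonneg hg.meromorphicOrderAt_nonneg (ho z h1 h2)

/-- A continuous exponentially decaying function `V` on the real line that is the restriction of a
quotient `N / D` of entire functions, controlled near the ends of the strip `|Im z| ≤ 1`. -/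
structure LineQuotient (V : ℝ → ℂ) (N D : ℂ → ℂ) : Prop where
  cont : Continuous V
  decay : ∃ C ε : ℝ, 0 < ε ∧ ∀ s, ‖V s‖ ≤ C * Real.exp (-ε * |s|)
  num : Differentiable ℂ N
  den : Differentiable ℂ D
  eq : ∀ s : ℝ, D s * V s = N s
  growth : ∃ R C δ : ℝ, 0 < δ ∧ 0 ≤ C ∧ ∀ z : ℂ, |z.im| ≤ 1 → R ≤ |z.re| →
    δ ≤ ‖D z‖ ∧ ‖N z‖ ≤ C * Real.exp (C * |z.re|)

/-- The shift identity that the trace condition gives on a line. -/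
def ShiftIdentity (V : ℝ → ℂ) (c : ℂ) (Q : Polynomial ℂ) : Prop :=
  ∀ p : Polynomial ℂ, ∫ s : ℝ, p.eval ((s : ℂ) - I) * Q.eval ((s : ℂ) - I) * V s =
    c * ∫ s : ℝ, p.eval (s : ℂ) * Q.eval (s : ℂ) * V s

namespace LineQuotient

variable {V : ℝ → ℂ} {N D : ℂ → ℂ} {c : ℂ} {Q : Polynomial ℂ}

theorem meromorphicAt (h : LineQuotient V N D) (z : ℂ) : MeromorphicAt (fun z => N z / D z) z :=
  (h.num.analyticAt z).meromorphicAt.div (h.den.analyticAt z).meromorphicAt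

theorem exists_ends (h : LineQuotient V N D) : ∃ R C, 0 ≤ C ∧ ∀ z : ℂ, |z.im| ≤ 1 → R ≤ |z.re| →
    D z ≠ 0 ∧ AnalyticAt ℂ (fun z => N z / D z) z ∧ ‖N z / D z‖ ≤ C * Real.exp (C * |z.re|) := by
  obtain ⟨R, C, δ, hδ, hC, hg⟩ := h.growth
  refine ⟨R, max (C / δ) C, hC.trans (le_max_right _ _), fun z h1 h2 => ?_⟩
  obtain ⟨hD, hN⟩ := hg z h1 h2
  have hne : D z ≠ 0 := norm_pos_iff.1 (hδ.trans_le hD)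
  refine ⟨hne, (h.num.analyticAt z).div (h.den.analyticAt z) hne, ?_⟩
  rw [norm_div]
  calc ‖N z‖ / ‖D z‖ ≤ C * Real.exp (C * |z.re|) / δ := by gcongr
    _ = C / δ * Real.exp (C * |z.re|) := by ring
    _ ≤ _ := by
      gcongr
      · exact le_max_left _ _
      · exact le_max_right _ _

theorem stripGrowth (h : LineQuotient V N D) : ∃ R C, StripGrowth (fun z => N z / D z) R C := by
  obtain ⟨R, C, hC, hR⟩ := h.exists_ends
  exact ⟨R, C, h.meromorphicAt, hC, fun z h1 h2 h3 =>
    (hR z (abs_le.2 ⟨h1, by linarith⟩) h3).2⟩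

theorem stripGrowth_add_I (h : LineQuotient V N D) :
    ∃ R C, StripGrowth (fun z => N (z + I) / D (z + I)) R C := by
  obtain ⟨R, C, hC, hR⟩ := h.exists_ends
  refine ⟨R, C, fun z => ?_, hC, fun z h1 h2 h3 => ?_⟩
  · exact ((h.num.comp (differentiable_id.add_const I)).analyticAt z).meromorphicAt.div
      ((h.den.comp (differentiable_id.add_const I)).analyticAt z).meromorphicAt
  · have := hR (z + I) (by simp; exact abs_le.2 ⟨by linarith, by linarith⟩) (by simpa using h3)
    refine ⟨?_, by simpa using this.2.2⟩
    exact AnalyticAt.fun_comp (f := fun z => z + I) this.2.1 (by fun_prop)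

/-- The lower bound for `|D|` near the ends of the strip shows that `D` is not identically zero, so
its zeros are isolated. -/
theorem eventually_den_ne_zero (h : LineQuotient V N D) (z : ℂ) : ∀ᶠ w in 𝓝[≠] z, D w ≠ 0 := by
  obtain ⟨R, C, hC, hR⟩ := h.exists_ends
  have hne : D (|R| : ℝ) ≠ 0 := (hR (|R| : ℝ) (by simp) (by simpa using le_abs_self R)).1
  by_contra hcon
  have hf : ∃ᶠ w in 𝓝[≠] z, D w = 0 := by
    simpa only [Filter.Frequently] using hcon
  exact hne ((h.den.differentiableOn.analyticOnNhd isOpen_univ)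
    |>.eqOn_zero_of_preconnected_of_frequently_eq_zero isPreconnected_univ (Set.mem_univ z) hf
      (Set.mem_univ _))

theorem ae_den_ne_zero (h : LineQuotient V N D) (w : ℂ) : ∀ᵐ s : ℝ, D ((s : ℂ) + w) ≠ 0 :=
  ae_line_of_forall_eventually_nhdsNE w fun _ => h.eventually_den_ne_zero _

theorem ae_eq (h : LineQuotient V N D) : ∀ᵐ s : ℝ, N s / D s = V s := by
  filter_upwards [h.ae_den_ne_zero 0] with s hs
  rw [add_zero] at hs
  rw [← h.eq s, mul_div_cancel_left₀ _ hs]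

theorem decay_mul_polynomial (h : LineQuotient V N D) (p : Polynomial ℂ) (t : ℝ) (ht : |t| ≤ 1) :
    ∃ ε : ℝ, 0 < ε ∧ Integrable (fun s : ℝ => (Real.exp (ε * ‖(s : ℂ) + t * I‖) : ℂ) *
      (p.eval ((s : ℂ) + t * I) * V s)) := by
  obtain ⟨C, ε, hε, hV⟩ := h.decay
  obtain ⟨C', hC', hp⟩ := exists_bound_polynomial_strip p (a := ε / 4) (by positivity)
  have hcont : Continuous fun s : ℝ => (Real.exp (ε / 4 * ‖(s : ℂ) + t * I‖) : ℂ) *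
      (p.eval ((s : ℂ) + t * I) * V s) := by
    have := h.cont
    have := p.continuous
    fun_prop
  have hC : 0 ≤ C := by
    have := (norm_nonneg _).trans (hV 0)
    simpa using this
  refine ⟨ε / 4, by positivity, ?_⟩
  have hint : Integrable fun s : ℝ => Real.exp (ε / 4) * C' * C * Real.exp (-(ε / 2) * |s|) :=
    (integrable_exp_neg_mul_norm (E := ℝ) volume (by positivity : 0 < ε / 2)).const_mul _
  refine hint.mono' hcont.aestronglyMeasurable (Eventually.of_forall fun s => ?_)
  have him : |((s : ℂ) + t * I).im| ≤ 1 := by simpa using ht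
  have e1 : ‖(s : ℂ) + t * I‖ ≤ |s| + 1 := by simpa using norm_le_of_strip him
  have e2 : ‖p.eval ((s : ℂ) + t * I)‖ ≤ C' * Real.exp (ε / 4 * |s|) := by
    simpa using hp _ him
  rw [norm_mul, norm_mul, norm_real, Real.norm_of_nonneg (Real.exp_pos _).le]
  calc _ ≤ Real.exp (ε / 4 * (|s| + 1)) *
        (C' * Real.exp (ε / 4 * |s|) * (C * Real.exp (-ε * |s|))) := by
        gcongr
        exact hV s
    _ = Real.exp (ε / 4) * C' * C *
        (Real.exp (ε / 4 * |s|) * Real.exp (ε / 4 * |s|) * Real.exp (-ε * |s|)) := by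
        rw [mul_add, Real.exp_add, mul_one]; ring
    _ = _ := by
        rw [← Real.exp_add, ← Real.exp_add]; congr 2; ring

theorem integrable_mul_polynomial (h : LineQuotient V N D) (p : Polynomial ℂ) (t : ℝ)
    (ht : |t| ≤ 1) : Integrable (fun s : ℝ => p.eval ((s : ℂ) + t * I) * V s) := by
  obtain ⟨ε, hε, hi⟩ := h.decay_mul_polynomial p t ht
  have := p.continuous
  have := h.cont
  refine hi.mono (by fun_prop : Continuous fun s : ℝ =>
    p.eval ((s : ℂ) + t * I) * V s).aestronglyMeasurable (Eventually.of_forall fun s => ?_)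
  rw [norm_mul _ (p.eval _ * _), norm_real, Real.norm_of_nonneg (Real.exp_pos _).le]
  exact le_mul_of_one_le_left (norm_nonneg _) (Real.one_le_exp (by positivity))

/-- The shift identity extends from polynomials to Gaussian test functions. -/
theorem gaussian_identity (h : LineQuotient V N D) (hQ : ShiftIdentity V c Q) (y : ℝ)
    (p : Polynomial ℂ) :
    ∫ s : ℝ, gaussTest (1 / 2) y p (s - I) * (Q.eval ((s : ℂ) - I) * V s) =
      c * ∫ s : ℝ, gaussTest (1 / 2) y p s * (Q.eval (s : ℂ) * V s) := by
  obtain ⟨ε₁, hε₁, hi₁⟩ := h.decay_mul_polynomial (p * Q) (-1) (by simp)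
  obtain ⟨ε₂, hε₂, hi₂⟩ := h.decay_mul_polynomial (p * Q) 0 (by simp)
  have hj₁ := h.integrable_mul_polynomial (p * Q) (-1) (by simp)
  have hj₂ := h.integrable_mul_polynomial (p * Q) 0 (by simp)
  simp only [ofReal_neg, ofReal_one, neg_mul, one_mul, ofReal_zero, zero_mul, add_zero,
    ← sub_eq_add_neg] at hi₁ hi₂ hj₁ hj₂
  have mono : ∀ {l h : ℝ → ℂ} {e e' : ℝ}, e' ≤ e → Continuous l → Continuous h →
      Integrable (fun s : ℝ => (Real.exp (e * ‖l s‖) : ℂ) * h s) →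
      Integrable (fun s : ℝ => (Real.exp (e' * ‖l s‖) : ℂ) * h s) := by
    intro l g e e' hle hl hg hi
    refine hi.mono (by fun_prop : Continuous fun s : ℝ =>
      (Real.exp (e' * ‖l s‖) : ℂ) * g s).aestronglyMeasurable (Eventually.of_forall fun s => ?_)
    rw [norm_mul, norm_mul, norm_real, norm_real, Real.norm_of_nonneg (Real.exp_pos _).le,
      Real.norm_of_nonneg (Real.exp_pos _).le]
    gcongr
  have hpc := (p * Q).continuous
  have hVc := h.cont
  -- The shift enters through the choice of `l`: `s - i` on one side and `s` on the other, both with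
  -- imaginary part at most `1`. Equality of the `n`-th moments is the shift identity for the
  -- polynomial `X ^ n * p`.
  have := integral_gaussian_eq_of_moments (μ := volume) (K := 1) (ε := min ε₁ ε₂)
    (l₁ := fun s : ℝ => (s : ℂ) - I) (l₂ := fun s : ℝ => (s : ℂ))
    (h₁ := fun s : ℝ => (p * Q).eval ((s : ℂ) - I) * V s)
    (h₂ := fun s : ℝ => c * ((p * Q).eval (s : ℂ) * V s))
    (lt_min hε₁ hε₂) (by fun_prop : Continuous _).aestronglyMeasurable
    (by fun_prop : Continuous _).aestronglyMeasurable (by simp) (by simp) hj₁ (hj₂.const_mul c)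
    (mono (min_le_left _ _) (by fun_prop) (by fun_prop) hi₁)
    (by
      have := (mono (min_le_right ε₁ ε₂) (by fun_prop) (by fun_prop) hi₂).const_mul c
      refine this.congr (Eventually.of_forall fun s => ?_)
      simp only; ring)
    (fun n => by
      have := hQ (Polynomial.X ^ n * p)
      simp only [Polynomial.eval_mul, Polynomial.eval_pow, Polynomial.eval_X] at this ⊢
      rw [← integral_const_mul] at this
      refine (integral_congr_fun fun s => ?_).trans (this.trans (integral_congr_fun fun s => ?_)) <;>
        ring) y
  rw [← integral_const_mul]
  have e1 : ∀ z : ℂ, cexp (-z ^ 2 / 2) = cexp (-(((1 / 2 : ℝ) : ℂ) * z ^ 2)) := fun z => by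
    congr 1; push_cast; ring
  simp only [e1] at this
  simp only [gaussTest]
  refine (integral_congr_fun fun s => ?_).trans (this.trans (integral_congr_fun fun s => ?_)) <;>
    simp only [Polynomial.eval_mul] <;> ring

end LineQuotient

theorem gaussTest_mul (δ y : ℝ) (p q : Polynomial ℂ) (z : ℂ) :
    gaussTest δ y (p * q) z = gaussTest δ y p z * q.eval z := by
  simp only [gaussTest, Polynomial.eval_mul]; ring

theorem StripGrowth.exists_polynomial {W : ℂ → ℂ} {R C : ℝ} (h : StripGrowth W R C) :
    ∃ p : Polynomial ℂ, p ≠ 0 ∧ ∀ z : ℂ, -1 ≤ z.im → z.im ≤ 0 →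
      0 ≤ meromorphicOrderAt (fun w => p.eval w * W w) z := by
  obtain ⟨p, hp, ho⟩ := exists_polynomial_mul_order_nonneg h.mero
    (isCompact_Icc.reProdIm isCompact_Icc : IsCompact (Set.Icc (-|R|) |R| ×ℂ Set.Icc (-1) 0))
  refine ⟨p, hp, fun z h1 h2 => ?_⟩
  rcases le_total R |z.re| with hR | hR
  · exact ((p.differentiable.analyticAt z).mul (h.ends z h1 h2 hR).1).meromorphicOrderAt_nonneg
  · exact ho z ⟨abs_le.1 (hR.trans (le_abs_self R)), h1, h2⟩

theorem order_polynomial_mul_nonneg {G : ℂ → ℂ} {z : ℂ} (hG : MeromorphicAt G z)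
    (q : Polynomial ℂ) (h : 0 ≤ meromorphicOrderAt G z) :
    0 ≤ meromorphicOrderAt (fun w => q.eval w * G w) z := by
  have hq := q.differentiable.analyticAt z
  rw [fun_meromorphicOrderAt_mul hq.meromorphicAt hG]
  exact add_nonneg hq.meromorphicOrderAt_nonneg h

namespace LineQuotient

variable {V : ℝ → ℂ} {N D : ℂ → ℂ} {c : ℂ} {Q : Polynomial ℂ}

theorem norm_gaussTest_ofReal_le {δ : ℝ} (hδ : 0 ≤ δ) (y : ℝ) (p : Polynomial ℂ) (s : ℝ) :
    ‖gaussTest δ y p s‖ ≤ Real.exp δ * ‖p.eval (s : ℂ)‖ := by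
  rw [gaussTest, norm_mul, norm_mul]
  have h1 := (norm_gaussian_le (z := (s : ℂ)) hδ (by simp)).trans
    (mul_le_of_le_one_right (Real.exp_pos δ).le (Real.exp_le_one_iff.2 (by
      have := mul_nonneg hδ (sq_nonneg (s : ℂ).re); linarith)))
  have h2 : ‖cexp (I * y * s)‖ = 1 := by
    rw [Complex.norm_exp]; simp
  rw [h2, one_mul]
  gcongr

theorem integrable_gaussTest (h : LineQuotient V N D) {δ : ℝ} (hδ : 0 ≤ δ) (y : ℝ)
    (p : Polynomial ℂ) : Integrable fun s : ℝ => gaussTest δ y p s * V s := by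
  have hi := (h.integrable_mul_polynomial p 0 (by simp)).norm.const_mul (Real.exp δ)
  simp only [ofReal_zero, zero_mul, add_zero] at hi
  refine hi.mono' ?_ (Eventually.of_forall fun s => ?_)
  · have h1 : Continuous fun s : ℝ => gaussTest δ y p s := by
      have := p.continuous
      unfold gaussTest; fun_prop
    exact (h1.mul h.cont).aestronglyMeasurable
  · rw [norm_mul, norm_mul, ← mul_assoc]
    gcongr
    exact norm_gaussTest_ofReal_le hδ y p s

/-- Put `W(z) = N(z+i)/D(z+i)`, so that `W(s - i) = V(s)`. Once a polynomial `p` has cleared the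
poles of `W`, the left side of the Gaussian identity can be moved from the line `Im z = -1` to the
real line. The identity then says that the Fourier transform of the function `u` below vanishes, so
`W = c V` on the real line, and the identity theorem applies. -/
theorem quasi_periodic (h : LineQuotient V N D) (hQ : ShiftIdentity V c Q) (hQ0 : Q ≠ 0) (z : ℂ) :
    N (z + I) * D z = c * N z * D (z + I) := by
  obtain ⟨R, C, hG⟩ := h.stripGrowth_add_I
  obtain ⟨p, hp, ho⟩ := hG.exists_polynomial
  have ho' : ∀ z : ℂ, -1 ≤ z.im → z.im ≤ 0 →
      0 ≤ meromorphicOrderAt (fun w => (p * Q).eval w * (N (w + I) / D (w + I))) z := by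
    intro z h1 h2
    have := order_polynomial_mul_nonneg
      ((p.differentiable.analyticAt z).meromorphicAt.fun_mul (hG.mero z)) Q (ho z h1 h2)
    convert this using 2
    ext w
    rw [Polynomial.eval_mul]; ring
  set u : ℝ → ℂ := fun s =>
    gaussTest (1 / 2) 0 (p * Q) s * (N (s + I) / D (s + I) - c * V s) with hu
  have hint : ∀ y : ℝ, Integrable (fun s : ℝ => cexp (I * y * s) * u s) ∧
      ∫ s : ℝ, cexp (I * y * s) * u s = 0 := by
    intro y
    obtain ⟨i1, i2, hcs⟩ := hG.contour_shift one_half_pos y (p * Q) ho'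
    have i3 := (h.integrable_gaussTest one_half_pos.le y (p * Q)).const_mul c
    have e1 : ∀ s : ℝ, cexp (I * y * s) * u s =
        gaussTest (1 / 2) y (p * Q) s * (N (s + I) / D (s + I)) -
          c * (gaussTest (1 / 2) y (p * Q) s * V s) := by
      intro s
      simp only [hu, gaussTest, ofReal_zero, mul_zero, zero_mul, Complex.exp_zero]
      ring
    rw [funext e1]
    refine ⟨i1.sub i3, ?_⟩
    rw [integral_sub i1 i3, ← hcs, sub_eq_zero, integral_const_mul]
    have hg := h.gaussian_identity hQ y p
    simp only [← mul_assoc, ← gaussTest_mul] at hg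
    rw [← hg]
    refine integral_congr_ae ?_
    filter_upwards [h.ae_eq] with s hs
    rw [sub_add_cancel, hs]
  have hu0 : ∀ s : ℝ, D (s + I) ≠ 0 → u s = 0 := by
    intro s hs
    refine eq_zero_of_fourier_eq_zero_real ?_ (fun y => (hint y).2) ?_
    · simpa using (hint 0).1
    · have c1 : ContinuousAt (fun s : ℝ => gaussTest (1 / 2) 0 (p * Q) s) s :=
        ContinuousAt.comp (f := fun s : ℝ => (s : ℂ)) (analyticAt_gaussTest _ _ _ _).continuousAt
          continuous_ofReal.continuousAt
      have c2 : ContinuousAt (fun s : ℝ => N (s + I)) s :=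
        (h.num.continuous.comp (by fun_prop : Continuous fun s : ℝ => (s : ℂ) + I)).continuousAt
      have c3 : ContinuousAt (fun s : ℝ => D (s + I)) s :=
        (h.den.continuous.comp (by fun_prop : Continuous fun s : ℝ => (s : ℂ) + I)).continuousAt
      exact c1.mul ((c2.div c3 hs).sub (h.cont.continuousAt.const_mul c))
  have hHd : Differentiable ℂ fun z => N (z + I) * D z - c * N z * D (z + I) := by
    have := h.num
    have := h.den
    fun_prop
  -- The zeros of `p Q`, `D(s)` and `D(s + i)` on the real line form a null set; off it the
  -- vanishing of `u` gives the identity.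
  have hae : ∀ᵐ s : ℝ, N (s + I) * D s - c * N s * D (s + I) = 0 := by
    have hfin : ∀ᵐ s : ℝ, (p * Q).eval (s : ℂ) ≠ 0 := by
      have hz := ((p * Q).finite_setOfPred_isRoot (mul_ne_zero hp hQ0)).preimage
        ofReal_injective.injOn
      filter_upwards [hz.countable.ae_notMem volume] with s hs h0
      exact hs h0
    filter_upwards [h.ae_den_ne_zero I, h.ae_den_ne_zero 0, hfin] with s h1 h2 h3
    have h4 := hu0 s h1
    have h5 : gaussTest (1 / 2) 0 (p * Q) s ≠ 0 := by
      simp only [gaussTest]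
      exact mul_ne_zero (exp_ne_zero _) (mul_ne_zero (exp_ne_zero _) h3)
    have h6 : N (s + I) / D (s + I) - c * V s = 0 :=
      (mul_eq_zero.1 h4).resolve_left h5
    rw [div_sub' h1, div_eq_zero_iff, or_iff_left h1] at h6
    linear_combination D s * h6 + c * D (s + I) * h.eq s
  have hall : ∀ s : ℝ, N (s + I) * D s - c * N s * D (s + I) = 0 := by
    have : (fun s : ℝ => N (s + I) * D s - c * N s * D (s + I)) = fun _ => (0 : ℂ) := by
      refine Continuous.ae_eq_iff_eq volume ?_ continuous_const |>.1 hae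
      exact hHd.continuous.comp continuous_ofReal
    exact congrFun this
  have := (hHd.differentiableOn.analyticOnNhd isOpen_univ).eqOn_zero_of_preconnected_of_frequently_eq_zero
    isPreconnected_univ (Set.mem_univ ((0 : ℝ) + 0 : ℂ)) (by
      refine (tendsto_ofReal_add_nhdsNE 0 0).frequently (Eventually.frequently ?_)
      refine Eventually.of_forall fun s => ?_
      simpa using hall s)
  exact sub_eq_zero.1 (this (Set.mem_univ z))

/-- The quotient `N / D` is multiplied by `c` under `z ↦ z + i`, away from zeros of `D`. -/
theorem quotient_sub_I (h : LineQuotient V N D) (hQ : ShiftIdentity V c Q) (hQ0 : Q ≠ 0) {z : ℂ}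
    (h1 : D z ≠ 0) (h2 : D (z - I) ≠ 0) : N z / D z = c * (N (z - I) / D (z - I)) := by
  have := h.quasi_periodic hQ hQ0 (z - I)
  rw [sub_add_cancel] at this
  field_simp
  linear_combination this

theorem ae_quotient_sub_I (h : LineQuotient V N D) (hQ : ShiftIdentity V c Q) (hQ0 : Q ≠ 0) :
    ∀ᵐ s : ℝ, V s = c * (N (s - I) / D (s - I)) := by
  filter_upwards [h.ae_eq, h.ae_den_ne_zero 0, h.ae_den_ne_zero (-I)] with s h1 h2 h3
  rw [add_zero] at h2
  rw [← sub_eq_add_neg] at h3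
  rw [← h1, h.quotient_sub_I hQ hQ0 h2 h3]

/-- In the open strip, `Q · N / D` has no poles. -/
theorem order_nonneg (h : LineQuotient V N D) (hc : c ≠ 0) (hQ : ShiftIdentity V c Q) (hQ0 : Q ≠ 0)
    {a : ℂ} (ha : -1 < a.im) (ha' : a.im < 0) :
    0 ≤ meromorphicOrderAt (fun z => Q.eval z * (N z / D z)) a := by
  by_contra hneg
  rw [not_le] at hneg
  obtain ⟨R, C, hG⟩ := h.stripGrowth
  set W : ℂ → ℂ := fun z => N z / D z with hW
  have hQm : ∀ z, MeromorphicAt (fun z => Q.eval z * W z) z := fun z =>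
    (Q.differentiable.analyticAt z).meromorphicAt.fun_mul (h.meromorphicAt z)
  obtain ⟨p, hp, ho⟩ := hG.exists_polynomial
  -- The polynomial `p` clears all poles of `W` in the closed strip. Its part `p₂` prime to `X - a`
  -- still clears all of them except the one at `a`.
  obtain ⟨p₂, hpe, hpd⟩ := p.exists_eq_pow_rootMultiplicity_mul_and_not_dvd hp a
  have hp2a : p₂.eval a ≠ 0 := fun h0 => hpd (Polynomial.dvd_iff_isRoot.2 h0)
  lift meromorphicOrderAt (fun z => Q.eval z * W z) a to ℤ using hneg.ne_top with k hk
  have hk0 : k < 0 := by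
    have : (k : WithTop ℤ) < 0 := hk ▸ hneg
    exact_mod_cast this
  -- One less than the pole order of `Q W` at `a`, so that multiplication by `(z - a)^e` leaves a
  -- simple pole.
  set e := (-k - 1).toNat with he
  have hek : (e : ℤ) = -k - 1 := Int.toNat_of_nonneg (by omega)
  set p₁ := (Polynomial.X - Polynomial.C a) ^ e * p₂ with hp₁
  have hlin : ∀ m : ℕ, meromorphicOrderAt (fun z => (z - a) ^ m) a = (m : ℤ) := by
    intro m
    rw [meromorphicOrderAt_eq_int_iff (by fun_prop)]
    exact ⟨fun _ => 1, analyticAt_const, one_ne_zero, Eventually.of_forall fun z => by simp⟩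
  -- away from `a`, the polynomials `p₁ Q` remove all poles
  have ho1 : ∀ z : ℂ, -1 ≤ z.im → z.im ≤ 0 → z ≠ a →
      0 ≤ meromorphicOrderAt (fun w => p₁.eval w * (Q.eval w * W w)) z := by
    intro z h1 h2 hz
    have h3 : 0 ≤ meromorphicOrderAt (fun w => p₂.eval w * W w) z := by
      have := ho z h1 h2
      have e1 : (fun w => p.eval w * W w) =
          (fun w => (w - a) ^ (p.rootMultiplicity a)) * fun w => p₂.eval w * W w := by
        ext w
        conv_lhs => rw [hpe]
        simp [mul_assoc]
      rw [e1, meromorphicOrderAt_mul_of_ne_zero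
        (g := fun w => (w - a) ^ (p.rootMultiplicity a)) (by fun_prop)
        (pow_ne_zero _ (sub_ne_zero.2 hz))] at this
      exact this
    have := order_polynomial_mul_nonneg
      ((p₂.differentiable.analyticAt z).meromorphicAt.fun_mul (h.meromorphicAt z))
      ((Polynomial.X - Polynomial.C a) ^ e * Q) h3
    convert this using 2
    ext w
    simp only [hp₁, Polynomial.eval_mul, Polynomial.eval_pow, Polynomial.eval_sub,
      Polynomial.eval_X, Polynomial.eval_C]
    ring
  set Φ : ℂ → ℂ := fun z => gaussTest (1 / 2) 0 p₁ z * (Q.eval z * W z) with hΦ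
  have hΦm : ∀ z, MeromorphicAt Φ z := fun z =>
    (analyticAt_gaussTest _ _ _ z).meromorphicAt.mul (hQm z)
  have hΦa : meromorphicOrderAt Φ a = ((-1 : ℤ) : WithTop ℤ) := by
    set u : ℂ → ℂ := fun z => cexp (-(((1 / 2 : ℝ) : ℂ) * z ^ 2)) *
      cexp (I * (0 : ℝ) * z) * p₂.eval z with hu
    have hud : Differentiable ℂ u := by
      have := p₂.differentiable
      rw [hu]; fun_prop
    have e1 : Φ = u * ((fun z => (z - a) ^ e) * fun z => Q.eval z * W z) := by
      ext z
      simp only [hΦ, hu, gaussTest, hp₁, Polynomial.eval_mul, Polynomial.eval_pow,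
        Polynomial.eval_sub, Polynomial.eval_X, Polynomial.eval_C, Pi.mul_apply]
      ring
    rw [e1, meromorphicOrderAt_mul_of_ne_zero (hud.analyticAt a)
      (mul_ne_zero (mul_ne_zero (exp_ne_zero _) (exp_ne_zero _)) hp2a),
      meromorphicOrderAt_mul (by fun_prop) (hQm a), hlin, ← hk, ← WithTop.coe_add, hek]
    congr 1
    ring
  obtain ⟨g, hga, hg0, hgev⟩ := (meromorphicOrderAt_eq_int_iff (hΦm a)).1 hΦa
  set b := starRingEnd ℂ a - 2 * I with hb
  have hbre : b.re = a.re := by simp [hb]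
  have hbim : b.im = -a.im - 2 := by simp [hb]
  have hab : a - b ≠ 0 := fun h => by
    have := congrArg Complex.im h; simp [hbim] at this; linarith
  -- The residue of `Φ` at `a` is `g a` and that of `κ` is `1 / (a - b)`; hence `Φ - ρ κ` has no
  -- pole at `a`.
  set ρ := g a * (a - b) with hρ
  have hρ0 : ρ ≠ 0 := mul_ne_zero hg0 hab
  set κ : ℂ → ℂ := fun z => ((z - a) * (z - b))⁻¹ with hκ
  have hκm : ∀ z, MeromorphicAt κ z := fun z => by rw [hκ]; fun_prop
  have hzb : ∀ z : ℂ, -1 ≤ z.im → z - b ≠ 0 := fun z hz h => by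
    have := congrArg Complex.im h; simp [hbim] at this; linarith
  have hκa : ∀ z : ℂ, -1 ≤ z.im → z ≠ a → AnalyticAt ℂ κ z := fun z hz hza => by
    have := sub_ne_zero.2 hza
    exact AnalyticAt.inv (by fun_prop) (mul_ne_zero this (hzb z hz))
  -- the difference has no pole at `a`
  have hdiff : ∀ z : ℂ, -1 ≤ z.im → z.im ≤ 0 →
      0 ≤ meromorphicOrderAt (fun z => Φ z - ρ * κ z) z := by
    intro z h1 h2
    by_cases hza : z = a
    · subst hza
      -- The difference is `n(w) / (w - z)` with `n(z) = 0`, so `dslope` is its analytic extension.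
      set n : ℂ → ℂ := fun w => g w - ρ / (w - b) with hn
      have hna : AnalyticAt ℂ n z := hga.sub (analyticAt_const.div (by fun_prop) (hzb z h1))
      have hn0 : n z = 0 := by
        simp only [hn, hρ]; field_simp; ring
      obtain ⟨q, hq⟩ := hna
      have hds : AnalyticAt ℂ (dslope n z) z := ⟨_, hq.has_fpower_series_dslope_fslope⟩
      rw [meromorphicOrderAt_congr (f₂ := dslope n z)]
      · exact hds.meromorphicOrderAt_nonneg
      · have hb' : ∀ᶠ w in 𝓝[≠] z, w - b ≠ 0 :=
          (((continuous_id.sub continuous_const).continuousAt (x := z)).eventually_ne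
            (hzb z h1)).filter_mono nhdsWithin_le_nhds
        filter_upwards [hgev, self_mem_nhdsWithin, hb'] with w hw hwz hwb
        have hwz' : w - z ≠ 0 := sub_ne_zero.2 hwz
        rw [dslope_of_ne _ hwz, slope_def_field, hn0, hw]
        simp only [hκ, hn, smul_eq_mul, zpow_neg, zpow_one, sub_zero]
        field_simp
    · have h3 : 0 ≤ meromorphicOrderAt Φ z := by
        set u : ℂ → ℂ := fun z => cexp (-(((1 / 2 : ℝ) : ℂ) * z ^ 2)) *
          cexp (I * (0 : ℝ) * z) with hu
        have hud : Differentiable ℂ u := by rw [hu]; fun_prop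
        have e1 : Φ = u * fun w => p₁.eval w * (Q.eval w * W w) := by
          ext w
          simp only [hΦ, hu, gaussTest, Pi.mul_apply]
          ring
        rw [e1, meromorphicOrderAt_mul_of_ne_zero (hud.analyticAt z)
          (mul_ne_zero (exp_ne_zero _) (exp_ne_zero _))]
        exact ho1 z h1 h2 hza
      have h4 : AnalyticAt ℂ (fun z => -(ρ * κ z)) z :=
        (analyticAt_const.mul (hκa z h1 hza)).neg
      have := meromorphicOrderAt_add (hΦm z) h4.meromorphicAt
      have e2 : (fun z => Φ z - ρ * κ z) = Φ + fun z => -(ρ * κ z) := by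
        ext w; simp [sub_eq_add_neg]
      rw [e2]
      exact (le_min h3 h4.meromorphicOrderAt_nonneg).trans this
  obtain ⟨M, hM⟩ := hG.bound_gaussTest one_half_pos 0 (p₁ * Q)
  have hcs := contour_shift (Φ := fun z => Φ z - ρ * κ z) (M := M + ‖ρ‖ * 8)
    (R₀ := max R (2 * |a.re| + 1)) (fun z => (hΦm z).fun_sub ((MeromorphicAt.const ρ z).fun_mul (hκm z)))
    hdiff (fun z h1 h2 h3 => by
      have h4 := hM z h1 h2 ((le_max_left _ _).trans h3)
      have h5 := norm_kernel_le (z := z) hbre ((le_max_right _ _).trans h3)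
      have hza : z ≠ a := by
        rintro rfl
        have := (le_max_right _ _).trans h3
        linarith [abs_nonneg z.re]
      have e3 : (fun z => gaussTest (1 / 2) 0 (p₁ * Q) z * W z) = Φ := by
        ext w; simp only [hΦ, gaussTest_mul, mul_assoc]
      rw [e3] at h4
      have h6 : ‖Φ z‖ ≤ M / (1 + z.re ^ 2) := by
        have := h4.2
        rwa [gaussTest_mul, mul_assoc] at this
      refine ⟨h4.1.sub (analyticAt_const.mul (hκa z h1 hza)), ?_⟩
      refine (norm_sub_le _ _).trans ?_
      rw [norm_mul ρ (κ z), add_div, mul_div_assoc]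
      gcongr)
  have hk0 : Integrable fun s : ℝ => κ s := by
    have := integrable_kernel hbre 0 (fun s => mul_ne_zero (fun h => by
      have := congrArg Complex.im h; simp at this; linarith) (hzb _ (by simp)))
    refine this.congr (Eventually.of_forall fun s => ?_)
    simp only [hκ, ofReal_zero, zero_mul, add_zero]
  have hk1 : Integrable fun s : ℝ => κ (s - I) := by
    have := integrable_kernel hbre (-1) (fun s => mul_ne_zero (fun h => by
      have := congrArg Complex.im h; simp at this; linarith) (hzb _ (by simp)))
    simpa [hκ, sub_eq_add_neg] using this
  obtain ⟨j0, j1, hj⟩ := hcs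
  have hΦ0 : Integrable fun s : ℝ => Φ s := by
    refine (j0.add (hk0.const_mul ρ)).congr (Eventually.of_forall fun s => ?_)
    simp
  have hΦ1 : Integrable fun s : ℝ => Φ (s - I) := by
    refine (j1.add (hk1.const_mul ρ)).congr (Eventually.of_forall fun s => ?_)
    simp
  rw [integral_sub hΦ1 (hk1.const_mul ρ), integral_sub hΦ0 (hk0.const_mul ρ),
    integral_const_mul, integral_const_mul] at hj
  have hg := h.gaussian_identity hQ 0 p₁
  -- By quasi-periodicity `V(s) = c W(s - i)` almost everywhere. So the Gaussian identity says that
  -- `Φ` has the same integral over both lines; since `Φ - ρ κ` does as well, so would `κ`, which is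
  -- impossible.
  have f1 : ∫ s : ℝ, gaussTest (1 / 2) 0 p₁ (s - I) * (Q.eval ((s : ℂ) - I) * V s) =
      c * ∫ s : ℝ, Φ (s - I) := by
    rw [← integral_const_mul]
    refine integral_congr_ae ?_
    filter_upwards [h.ae_quotient_sub_I hQ hQ0] with s hs
    rw [hs]
    simp only [hΦ, hW]
    ring
  have f2 : ∫ s : ℝ, gaussTest (1 / 2) 0 p₁ s * (Q.eval (s : ℂ) * V s) = ∫ s : ℝ, Φ s := by
    refine integral_congr_ae ?_
    filter_upwards [h.ae_eq] with s hs
    rw [← hs]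
  rw [f1, f2] at hg
  rw [mul_left_cancel₀ hc hg] at hj
  have : ρ * ∫ s : ℝ, κ (s - I) = ρ * ∫ s : ℝ, κ s := by linear_combination -hj
  exact integral_kernel_ne ha ha' hb (mul_left_cancel₀ hρ0 this)

end LineQuotient

theorem norm_gaussTest_zero_le {δ : ℝ} (hδ : 0 ≤ δ) (p : Polynomial ℂ) {z : ℂ} (hz : |z.im| ≤ 1) :
    ‖gaussTest δ 0 p z‖ ≤ Real.exp δ * ‖p.eval z‖ := by
  rw [gaussTest, norm_mul, norm_mul]
  have h1 := (norm_gaussian_le (z := z) hδ hz).trans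
    (mul_le_of_le_one_right (Real.exp_pos δ).le (Real.exp_le_one_iff.2 (by
      have := mul_nonneg hδ (sq_nonneg z.re); linarith)))
  have h2 : ‖cexp (I * (0 : ℝ) * z)‖ = 1 := by simp
  rw [h2, one_mul]
  gcongr

namespace LineQuotient

variable {V : ℝ → ℂ} {N D : ℂ → ℂ} {c : ℂ} {Q : Polynomial ℂ}

/-- At a pole the quotient would be unbounded, whereas it agrees near `s` on the real line with the
continuous function `V`. -/
theorem order_nonneg_of_real (h : LineQuotient V N D) (s : ℝ) :
    0 ≤ meromorphicOrderAt (fun z => N z / D z) (s : ℂ) := by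
  by_contra hneg
  rw [not_le] at hneg
  have h1 := tendsto_norm_cobounded_atTop.comp (tendsto_cobounded_of_meromorphicOrderAt_neg hneg)
  have h2 : Tendsto (fun t : ℝ => (t : ℂ)) (𝓝[≠] s) (𝓝[≠] (s : ℂ)) := by
    simpa using tendsto_ofReal_add_nhdsNE 0 s
  have h3 := h1.comp h2
  have h4 : Tendsto (fun t => ‖V t‖) (𝓝[≠] s) (𝓝 ‖V s‖) :=
    (h.cont.norm.tendsto s).mono_left nhdsWithin_le_nhds
  refine not_tendsto_nhds_of_tendsto_atTop h3 ‖V s‖ (h4.congr' ?_)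
  filter_upwards [h2.eventually (h.eventually_den_ne_zero s)] with t ht
  simp only [Function.comp_apply]
  rw [← h.eq t, mul_div_cancel_left₀ _ ht]

theorem tendsto_integral_gaussTest (h : LineQuotient V N D) (p : Polynomial ℂ) {t : ℝ}
    (ht : |t| ≤ 1) :
    Tendsto (fun n : ℕ => ∫ s : ℝ, gaussTest (1 / (n + 1)) 0 p ((s : ℂ) + t * I) * V s) atTop
      (𝓝 (∫ s : ℝ, p.eval ((s : ℂ) + t * I) * V s)) := by
  have hV := h.cont
  have hp := p.continuous
  refine tendsto_integral_of_dominated_convergence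
    (fun s => Real.exp 1 * ‖p.eval ((s : ℂ) + t * I) * V s‖) (fun n => ?_)
    ((h.integrable_mul_polynomial p t ht).norm.const_mul _) (fun n => ?_) ?_
  · refine Continuous.aestronglyMeasurable ?_
    unfold gaussTest
    fun_prop
  · refine Eventually.of_forall fun s => ?_
    have hn : (1 : ℝ) / (n + 1) ≤ 1 := by
      rw [div_le_one (by positivity)]; linarith [(Nat.cast_nonneg n : (0 : ℝ) ≤ n)]
    rw [norm_mul, norm_mul, ← mul_assoc]
    gcongr
    refine (norm_gaussTest_zero_le (by positivity) p (by simpa using ht)).trans ?_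
    gcongr
  · refine Eventually.of_forall fun s => ?_
    refine Tendsto.mul_const _ ?_
    have h0 : Tendsto (fun n : ℕ => (1 : ℝ) / (n + 1)) atTop (𝓝 0) :=
      tendsto_one_div_add_atTop_nhds_zero_nat
    have hc : Continuous fun δ : ℝ => gaussTest δ 0 p ((s : ℂ) + t * I) := by
      unfold gaussTest; fun_prop
    have := (hc.tendsto 0).comp h0
    simpa [gaussTest, Function.comp_def] using this

/-- A polynomial factor without zeros in the open strip can be removed from the shift identity. -/
theorem shiftIdentity_of_mul (h : LineQuotient V N D) (hc : c ≠ 0) {q P : Polynomial ℂ}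
    (hQ : ShiftIdentity V c (q * P)) (hQ0 : q * P ≠ 0)
    (hq : ∀ z : ℂ, -1 < z.im → z.im < 0 → q.eval z ≠ 0) : ShiftIdentity V c P := by
  intro p
  have hWm := h.meromorphicAt
  -- `P V` has no poles in the closed strip: on the upper line because `V` is continuous, on the
  -- lower line by quasi-periodicity, and inside because `q P V` has none and `q` has no zeros
  -- there.
  have ho : ∀ z : ℂ, -1 ≤ z.im → z.im ≤ 0 →
      0 ≤ meromorphicOrderAt (fun w => P.eval w * (N w / D w)) z := by
    intro z h1 h2
    rcases h2.eq_or_lt with h2 | h2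
    · obtain ⟨s, rfl⟩ : ∃ s : ℝ, z = s := ⟨z.re, by apply Complex.ext <;> simp [h2]⟩
      exact order_polynomial_mul_nonneg (hWm _) P (h.order_nonneg_of_real s)
    rcases h1.eq_or_lt with h1 | h1
    · refine order_polynomial_mul_nonneg (hWm _) P ?_
      obtain ⟨s, hs⟩ : ∃ s : ℝ, z + I = s := ⟨z.re, by apply Complex.ext <;> simp [← h1]⟩
      have h3 := h.order_nonneg_of_real s
      rw [← hs] at h3
      have h4 : meromorphicOrderAt (fun w => N w / D w) z =
          meromorphicOrderAt (fun w => c⁻¹ * (N (w + I) / D (w + I))) z := by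
        refine meromorphicOrderAt_congr ?_
        have t1 : Tendsto (fun w : ℂ => w + I) (𝓝[≠] z) (𝓝[≠] (z + I)) := by
          refine tendsto_nhdsWithin_of_tendsto_nhds_of_eventually_within _ ?_ ?_
          · exact ((continuous_id.add continuous_const).tendsto z).mono_left nhdsWithin_le_nhds
          · filter_upwards [self_mem_nhdsWithin] with w hw h
            exact hw (add_right_cancel h)
        filter_upwards [h.eventually_den_ne_zero z, t1.eventually (h.eventually_den_ne_zero (z + I))]
          with w h5 h6
        have := h.quotient_sub_I (z := w + I) hQ hQ0 h6 (by rwa [add_sub_cancel_right])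
        rw [this, add_sub_cancel_right, inv_mul_cancel_left₀ hc]
      have h7 : (fun w => c⁻¹ * (N (w + I) / D (w + I))) =
          (fun _ => c⁻¹) * ((fun w => N w / D w) ∘ fun w => w + I) := rfl
      rw [h4, h7, meromorphicOrderAt_mul_of_ne_zero analyticAt_const (inv_ne_zero hc),
        meromorphicOrderAt_comp_add_const_eq_meromorphicOrderAt]
      exact h3
    · have h3 := h.order_nonneg hc hQ hQ0 h1 h2
      have e1 : (fun z => (q * P).eval z * (N z / D z)) =
          (fun z => q.eval z) * fun z => P.eval z * (N z / D z) := by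
        ext w; simp [mul_assoc]
      rw [e1, meromorphicOrderAt_mul_of_ne_zero (q.differentiable.analyticAt z) (hq z h1 h2)] at h3
      exact h3
  obtain ⟨R, C, hG⟩ := h.stripGrowth
  -- The Gaussian factor makes the contour shift legitimate and is removed at the end by `δ =
  -- 1/(n+1) → 0`.
  have hid : ∀ n : ℕ, ∫ s : ℝ, gaussTest (1 / (n + 1)) 0 (p * P) ((s : ℂ) + (-1 : ℝ) * I) * V s =
      c * ∫ s : ℝ, gaussTest (1 / (n + 1)) 0 (p * P) ((s : ℂ) + (0 : ℝ) * I) * V s := by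
    intro n
    obtain ⟨i1, i2, hcs⟩ := hG.contour_shift (δ := 1 / (n + 1)) (by positivity) 0 (p * P)
      (fun z h1 h2 => by
        have := order_polynomial_mul_nonneg
          ((P.differentiable.analyticAt z).meromorphicAt.fun_mul (hWm z)) p (ho z h1 h2)
        convert this using 2
        ext w
        rw [Polynomial.eval_mul]; ring)
    have e1 : ∫ s : ℝ, gaussTest (1 / (n + 1)) 0 (p * P) ((s : ℂ) + (0 : ℝ) * I) * V s =
        ∫ s : ℝ, gaussTest (1 / (n + 1)) 0 (p * P) s * (N s / D s) := by
      refine integral_congr_ae ?_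
      filter_upwards [h.ae_eq] with s hs
      simp [hs]
    rw [e1, ← hcs, ← integral_const_mul]
    refine integral_congr_ae ?_
    filter_upwards [h.ae_quotient_sub_I hQ hQ0] with s hs
    rw [hs]
    simp only [ofReal_neg, ofReal_one, neg_mul, one_mul, ← sub_eq_add_neg]
    ring
  have t1 := h.tendsto_integral_gaussTest (p * P) (t := -1) (by simp)
  have t2 := (h.tendsto_integral_gaussTest (p * P) (t := 0) (by simp)).const_mul c
  have := tendsto_nhds_unique t1 (t2.congr fun n => (hid n).symm)
  simpa [sub_eq_add_neg] using this

end LineQuotient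

/-! ### Exponentially decaying functions on a Euclidean space -/

/-- Exponential decay of a function on a normed space. -/
def ExpDecay {E : Type*} [Norm E] (F : E → ℂ) : Prop :=
  ∃ C ε : ℝ, 0 < ε ∧ ∀ x, ‖F x‖ ≤ C * Real.exp (-ε * ‖x‖)

namespace ExpDecay

variable {E : Type*} [NormedAddCommGroup E] [InnerProductSpace ℝ E] [FiniteDimensional ℝ E]
  [MeasurableSpace E] [BorelSpace E] {F : E → ℂ}

theorem const_nonneg {C ε : ℝ} (h : ∀ x, ‖F x‖ ≤ C * Real.exp (-ε * ‖x‖)) : 0 ≤ C := by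
  have := (norm_nonneg _).trans (h 0)
  simpa using this

theorem integrable_of_isAddHaarMeasure (h : ExpDecay F) (hF : Continuous F) (μ : Measure E)
    [μ.IsAddHaarMeasure] : Integrable F μ := by
  obtain ⟨C, ε, hε, hC⟩ := h
  exact ((integrable_exp_neg_mul_norm μ hε).const_mul C).mono' hF.aestronglyMeasurable
    (Eventually.of_forall hC)

theorem integrable (h : ExpDecay F) (hF : Continuous F) : Integrable F :=
  h.integrable_of_isAddHaarMeasure hF volume

/-- A continuous exponentially decaying function all of whose moments vanish is zero. -/
theorem eq_zero_of_moments (h : ExpDecay F) (hF : Continuous F)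
    (hm : ∀ (w : E) (n : ℕ), ∫ x, ((inner ℝ x w : ℝ) : ℂ) ^ n * F x = 0) (x : E) : F x = 0 := by
  refine eq_zero_of_fourier_eq_zero (h.integrable hF) (fun w => ?_) hF.continuousAt
  obtain ⟨C, ε, hε, hC⟩ := h
  have hC0 := const_nonneg hC
  -- Small enough that `e^{e |⟨x, w⟩|}` uses up at most half of the decay of `F`.
  set e := ε / (2 * (‖w‖ + 1)) with he
  have he0 : 0 < e := by positivity
  have hew : e * ‖w‖ ≤ ε / 2 := by
    rw [he, div_mul_eq_mul_div, div_le_iff₀ (by positivity)]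
    nlinarith [norm_nonneg w]
  have hi : Integrable fun x => (Real.exp (e * ‖((inner ℝ x w : ℝ) : ℂ)‖) : ℂ) * F x := by
    refine ((integrable_exp_neg_mul_norm (E := E) volume (half_pos hε)).const_mul C).mono'
      (by fun_prop : Continuous _).aestronglyMeasurable (Eventually.of_forall fun x => ?_)
    rw [norm_mul, norm_real, norm_real, Real.norm_of_nonneg (Real.exp_pos _).le]
    calc _ ≤ Real.exp (ε / 2 * ‖x‖) * (C * Real.exp (-ε * ‖x‖)) := by
          have h1 : e * ‖inner ℝ x w‖ ≤ ε / 2 * ‖x‖ :=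
            calc e * ‖inner ℝ x w‖ ≤ e * (‖x‖ * ‖w‖) := by
                  gcongr; exact norm_inner_le_norm x w
              _ = e * ‖w‖ * ‖x‖ := by ring
              _ ≤ _ := by gcongr
          exact mul_le_mul (Real.exp_le_exp.2 h1) (hC x) (norm_nonneg _) (Real.exp_pos _).le
      _ = C * (Real.exp (ε / 2 * ‖x‖) * Real.exp (-ε * ‖x‖)) := by ring
      _ = _ := by rw [← Real.exp_add]; congr 2; ring
  have := integral_cexp_eq_of_moments (μ := (volume : Measure E)) (K := 0) (ε := e)
    (l₁ := fun x : E => ((inner ℝ x w : ℝ) : ℂ)) (l₂ := fun x : E => ((inner ℝ x w : ℝ) : ℂ))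
    (h₁ := F) (h₂ := fun _ => 0) he0
    (by fun_prop : Continuous _).aestronglyMeasurable
    (by fun_prop : Continuous _).aestronglyMeasurable (by simp) (by simp) hF.aestronglyMeasurable
    aestronglyMeasurable_const hi (by simp)
    (fun n => by simp [hm w n]) 1
  simpa using this

/-- The integral over the line in the direction `l` depends continuously on the base point. -/
theorem continuous_integral_line (h : ExpDecay F) (hF : Continuous F) {l : E} (hl : l ≠ 0) :
    Continuous fun x => ∫ s : ℝ, F (x + s • l) := by
  obtain ⟨C, ε, hε, hC⟩ := h
  have hC0 := const_nonneg hC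
  refine continuous_iff_continuousAt.2 fun x₀ => ?_
  have hpos : 0 < ε * ‖l‖ := mul_pos hε (norm_pos_iff.2 hl)
  refine continuousAt_of_dominated
    (bound := fun s => C * Real.exp (ε * (‖x₀‖ + 1)) * Real.exp (-(ε * ‖l‖) * ‖s‖))
    (Eventually.of_forall fun x => (by fun_prop : Continuous _).aestronglyMeasurable) ?_
    ((integrable_exp_neg_mul_norm volume hpos).const_mul _)
    (Eventually.of_forall fun s => (by fun_prop : Continuous _).continuousAt)
  filter_upwards [Metric.ball_mem_nhds x₀ one_pos] with x hx
  refine Eventually.of_forall fun s => (hC _).trans ?_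
  rw [mul_assoc, ← Real.exp_add]
  have h1 : ‖x‖ ≤ ‖x₀‖ + 1 := by
    have := norm_le_norm_add_norm_sub' x x₀
    rw [mem_ball_iff_norm] at hx; linarith
  have h2 : ‖s‖ * ‖l‖ ≤ ‖x + s • l‖ + ‖x‖ := by
    rw [← norm_smul]
    calc ‖s • l‖ = ‖(x + s • l) - x‖ := by rw [add_sub_cancel_left]
      _ ≤ _ := norm_sub_le _ _
  gcongr
  nlinarith

end ExpDecay

/-! ### Slicing an integral into parallel lines -/

section Slice

variable {E : Type*} [NormedAddCommGroup E] [InnerProductSpace ℝ E] [FiniteDimensional ℝ E]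
  [MeasurableSpace E] [BorelSpace E]

/-- The coordinate along `l ≠ 0`. -/
noncomputable def lineCoord (l : E) : E →ₗ[ℝ] ℝ := (‖l‖ ^ 2)⁻¹ • (innerₛₗ ℝ l : E →ₗ[ℝ] ℝ)

theorem lineCoord_apply (l x : E) : lineCoord l x = (‖l‖ ^ 2)⁻¹ * inner ℝ l x := rfl

theorem lineCoord_self {l : E} (hl : l ≠ 0) : lineCoord l l = 1 := by
  rw [lineCoord_apply, real_inner_self_eq_norm_sq, inv_mul_cancel₀]
  exact pow_ne_zero _ (norm_ne_zero_iff.2 hl)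

theorem inner_eq_zero_of_mem_ker {l x : E} (hl : l ≠ 0) (hx : x ∈ LinearMap.ker (lineCoord l)) :
    inner ℝ l x = 0 := by
  rw [LinearMap.mem_ker, lineCoord_apply] at hx
  exact (mul_eq_zero.1 hx).resolve_left (inv_ne_zero (pow_ne_zero _ (norm_ne_zero_iff.2 hl)))

/-- The decomposition of `E` into the hyperplane orthogonal to `l` and the line spanned by `l`. -/
noncomputable def sliceEquiv {l : E} (hl : l ≠ 0) :
    (LinearMap.ker (lineCoord l) × ℝ) ≃L[ℝ] E :=
  LinearEquiv.toContinuousLinearEquiv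
    { toFun := fun x => x.1 + x.2 • l
      map_add' := fun x y => by simp only [Prod.fst_add, Prod.snd_add, Submodule.coe_add, add_smul]; abel
      map_smul' := fun c x => by
        simp only [Prod.smul_fst, Prod.smul_snd, Submodule.coe_smul, smul_add, smul_smul,
          RingHom.id_apply, smul_eq_mul]
      invFun := fun y => (⟨y - lineCoord l y • l, by
        rw [LinearMap.mem_ker, map_sub, map_smul, lineCoord_self hl]; simp⟩, lineCoord l y)
      left_inv := fun x => by
        have hx : lineCoord l (x.1 : E) = 0 := x.1.2
        ext <;> simp [hx, lineCoord_self hl]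
      right_inv := fun y => by simp }

theorem sliceEquiv_apply {l : E} (hl : l ≠ 0) (x : LinearMap.ker (lineCoord l) × ℝ) :
    sliceEquiv hl x = x.1 + x.2 • l := rfl

/-- Product measure in the coordinates (hyperplane, line) is a Haar measure, hence Lebesgue measure
up to a factor. Only the nonvanishing of the factor is needed. -/
theorem exists_integral_eq_slice {l : E} (hl : l ≠ 0) : ∃ κ : ℝ, κ ≠ 0 ∧ ∀ F : E → ℂ,
    Continuous F → ExpDecay F →
    ∫ y, F y = κ * ∫ x : LinearMap.ker (lineCoord l), ∫ s : ℝ, F (x + s • l) := by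
  set μ : Measure (LinearMap.ker (lineCoord l) × ℝ) := volume.prod volume with hμ
  have hh : (μ.map (sliceEquiv hl)).IsAddHaarMeasure := ContinuousLinearEquiv.isAddHaarMeasure_map _ _
  set κ := Measure.addHaarScalarFactor (volume : Measure E) (μ.map (sliceEquiv hl)) with hκ
  have hpos : 0 < κ := Measure.addHaarScalarFactor_pos_of_isAddHaarMeasure _ _
  have heq : (volume : Measure E) = κ • μ.map (sliceEquiv hl) :=
    Measure.isAddLeftInvariant_eq_smul _ _
  refine ⟨κ, by exact_mod_cast hpos.ne', fun F hF hd => ?_⟩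
  have hi := hd.integrable_of_isAddHaarMeasure hF (μ.map (sliceEquiv hl))
  rw [heq, integral_smul_nnreal_measure, NNReal.smul_def, Complex.real_smul]
  congr 1
  have e : μ.map (sliceEquiv hl) = μ.map (sliceEquiv hl).toHomeomorph.toMeasurableEquiv := rfl
  rw [e] at hi ⊢
  rw [MeasureTheory.integral_map_equiv, hμ, integral_prod]
  · rfl
  · exact (integrable_map_equiv _ _).1 hi

theorem norm_add_smul_ge {l : E} (hl : l ≠ 0) (x : LinearMap.ker (lineCoord l)) (s : ℝ) :
    (‖x‖ + ‖l‖ * ‖s‖) / 2 ≤ ‖(x : E) + s • l‖ := by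
  have h0 : inner ℝ (x : E) (s • l) = 0 := by
    rw [inner_smul_right, real_inner_comm, inner_eq_zero_of_mem_ker hl x.2, mul_zero]
  have h1 := norm_add_sq_eq_norm_sq_add_norm_sq_real h0
  rw [norm_smul, Submodule.norm_coe] at h1
  have h2 := norm_nonneg ((x : E) + s • l)
  have h3 := mul_nonneg (norm_nonneg l) (norm_nonneg s)
  nlinarith [norm_nonneg x, sq_nonneg (‖x‖ - ‖l‖ * ‖s‖)]

/-- If all moments of `F` in the directions orthogonal to `l` vanish, then so do its integrals over
the lines in the direction `l`. -/
theorem integral_line_eq_zero {l : E} (hl : l ≠ 0) {F : E → ℂ} (hF : Continuous F) (hd : ExpDecay F)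
    (hm : ∀ (w : E) (n : ℕ), inner ℝ l w = 0 → ∫ y, ((inner ℝ y w : ℝ) : ℂ) ^ n * F y = 0) (x : E) :
    ∫ s : ℝ, F (x + s • l) = 0 := by
  obtain ⟨κ, hκ, hs⟩ := exists_integral_eq_slice hl
  have hcl := hd.continuous_integral_line hF hl
  have hcm : Continuous fun x : LinearMap.ker (lineCoord l) => ∫ s : ℝ, F (x + s • l) :=
    hcl.comp continuous_subtype_val
  -- As a function on the hyperplane the line integral is continuous and exponentially decaying, and
  -- by Fubini its moments are those of `F` in directions orthogonal to `l`.
  have key : ∀ x : LinearMap.ker (lineCoord l), ∫ s : ℝ, F (x + s • l) = 0 := by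
    refine ExpDecay.eq_zero_of_moments ?_ hcm fun w n => ?_
    · obtain ⟨C, ε, hε, hC⟩ := hd
      have hC0 := ExpDecay.const_nonneg hC
      have hpos : 0 < ε * ‖l‖ / 2 := by have := norm_pos_iff.2 hl; positivity
      have hi := integrable_exp_neg_mul_norm (E := ℝ) volume hpos
      refine ⟨C * ∫ s : ℝ, Real.exp (-(ε * ‖l‖ / 2) * ‖s‖), ε / 2, half_pos hε, fun x => ?_⟩
      rw [mul_right_comm, ← integral_const_mul]
      refine norm_integral_le_of_norm_le (hi.const_mul _) (Eventually.of_forall fun s => ?_)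
      refine (hC _).trans ?_
      rw [mul_assoc, ← Real.exp_add]
      gcongr
      have := norm_add_smul_ge hl x s
      nlinarith
    · have hw : inner ℝ l (w : E) = 0 := inner_eq_zero_of_mem_ker hl w.2
      have hd' : ExpDecay fun y => ((inner ℝ y (w : E) : ℝ) : ℂ) ^ n * F y := by
        obtain ⟨C, ε, hε, hC⟩ := hd
        have hC0 := ExpDecay.const_nonneg hC
        have ht : Tendsto (fun t : ℝ => t ^ n * Real.exp (-(ε / 2) * t)) atTop (𝓝 0) := by
          have := Real.tendsto_pow_mul_exp_neg_atTop_nhds_zero n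
          have h2 := (this.comp (tendsto_id.const_mul_atTop (half_pos hε))).const_mul
            (((ε / 2) ^ n)⁻¹)
          rw [mul_zero] at h2
          refine h2.congr fun t => ?_
          have : (ε / 2) ^ n ≠ 0 := by positivity
          simp only [Function.comp_apply, id, mul_pow]
          field_simp
        obtain ⟨M, hM⟩ : ∃ M : ℝ, ∀ t : ℝ, 0 ≤ t → t ^ n * Real.exp (-(ε / 2) * t) ≤ M := by
          obtain ⟨a, ha⟩ := eventually_atTop.1 (ht.eventually (gt_mem_nhds one_pos))
          obtain ⟨M, hM⟩ := (isCompact_Icc (a := (0 : ℝ)) (b := a)).exists_bound_of_continuousOn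
            (f := fun t : ℝ => t ^ n * Real.exp (-(ε / 2) * t)) (by fun_prop)
          refine ⟨max M 1, fun t ht => ?_⟩
          rcases le_total t a with h | h
          · exact (le_abs_self _).trans ((hM t ⟨ht, h⟩).trans (le_max_left _ _))
          · exact (ha t h).le.trans (le_max_right _ _)
        refine ⟨‖(w : E)‖ ^ n * C * M, ε / 2, half_pos hε, fun y => ?_⟩
        rw [norm_mul, norm_pow, norm_real]
        calc _ ≤ (‖y‖ * ‖(w : E)‖) ^ n * (C * Real.exp (-ε * ‖y‖)) := by
              gcongr
              · exact norm_inner_le_norm _ _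
              · exact hC y
          _ = ‖(w : E)‖ ^ n * C * (‖y‖ ^ n * Real.exp (-(ε / 2) * ‖y‖)) *
                Real.exp (-(ε / 2) * ‖y‖) := by
              rw [show -ε * ‖y‖ = -(ε / 2) * ‖y‖ + -(ε / 2) * ‖y‖ by ring, Real.exp_add]; ring
          _ ≤ _ := by
              gcongr
              exact hM _ (norm_nonneg y)
      have := hs _ (by fun_prop) hd'
      rw [hm w n hw, eq_comm, mul_eq_zero, or_iff_right (by exact_mod_cast hκ)] at this
      rw [← this]
      refine integral_congr_ae (Eventually.of_forall fun x => ?_)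
      simp only
      rw [← integral_const_mul]
      refine integral_congr_ae (Eventually.of_forall fun s => ?_)
      simp only [inner_add_left, inner_smul_left, hw, Submodule.coe_inner]
      simp
  -- A general base point differs from one in the hyperplane by a translation along the line, which
  -- does not change the integral.
  have e : ∀ s : ℝ, F (x + s • l) =
      F (((sliceEquiv hl).symm x).1 + (((sliceEquiv hl).symm x).2 + s) • l) := by
    intro s
    have := (sliceEquiv hl).apply_symm_apply x
    rw [sliceEquiv_apply] at this
    conv_lhs => rw [← this]
    rw [add_smul, add_assoc]
  simp only [e]
  rw [integral_add_left_eq_self (fun s : ℝ => F (((sliceEquiv hl).symm x).1 + s • l))]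
  exact key _

/-- If the integrals of `F` over the lines in the direction `l` through a dense set of points vanish,
then so does the integral of `F`. -/
theorem integral_eq_zero_of_dense {l : E} (hl : l ≠ 0) {F : E → ℂ} (hF : Continuous F)
    (hd : ExpDecay F) {G : Set E} (hG : Dense G) (h : ∀ x ∈ G, ∫ s : ℝ, F (x + s • l) = 0) :
    ∫ y, F y = 0 := by
  obtain ⟨κ, hκ, hs⟩ := exists_integral_eq_slice hl
  have := (hd.continuous_integral_line hF hl).ext_on hG continuous_const h
  rw [hs F hF hd]
  simp [congrFun this]

end Slice

/-! ### Entire functions on `ℂ^m` and their restriction to `ℝ^m` -/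

section Complexify

variable {m : ℕ}

/-- The inclusion `ℝ^m ⊆ ℂ^m`. -/
noncomputable def cpx : RealLie m →L[ℝ] (Fin m → ℂ) :=
  ContinuousLinearMap.pi fun k => ofRealCLM.comp (EuclideanSpace.proj k : RealLie m →L[ℝ] ℝ)

@[simp] theorem cpx_apply (x : RealLie m) (k : Fin m) : cpx x k = (x k : ℂ) := rfl

theorem cpx_smul (s : ℝ) (x : RealLie m) : cpx (s • x) = (s : ℂ) • cpx x := by
  ext k; simp

theorem norm_cpx_le (x : RealLie m) : ‖cpx x‖ ≤ ‖x‖ := by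
  refine (pi_norm_le_iff_of_nonneg (norm_nonneg _)).2 fun k => ?_
  rw [cpx_apply, norm_real]
  exact PiLp.norm_apply_le x k

/-- Every point of `ℂ^m` is `x + iy` with `x, y` real. -/
theorem exists_cpx_add (z : Fin m → ℂ) : ∃ x y : RealLie m, z = cpx x + I • cpx y :=
  ⟨WithLp.toLp 2 fun k => (z k).re, WithLp.toLp 2 fun k => (z k).im, by
    ext k; simp [mul_comm I, re_add_im]⟩

/-- The complexification of a real linear form. -/
noncomputable def cdot (Λ : Fin m → ℝ) : (Fin m → ℂ) →L[ℂ] ℂ :=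
  ∑ k, (Λ k : ℂ) • ContinuousLinearMap.proj k

theorem cdot_apply (Λ : Fin m → ℝ) (z : Fin m → ℂ) : cdot Λ z = ∑ k, (Λ k : ℂ) * z k := by
  simp [cdot]

theorem cdot_cpx (Λ : Fin m → ℝ) (x : RealLie m) : cdot Λ (cpx x) = ((∑ k, Λ k * x k : ℝ) : ℂ) := by
  simp [cdot_apply]

/-- An entire function vanishing on a real open set vanishes. -/
theorem eq_zero_of_real_ball {F : (Fin m → ℂ) → ℂ} (hF : Differentiable ℂ F) {x₀ : RealLie m} {r : ℝ}
    (hr : 0 < r) (h : ∀ x ∈ Metric.ball x₀ r, F (cpx x) = 0) (z : Fin m → ℂ) : F z = 0 := by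
  have line : ∀ (a b : Fin m → ℂ), (∃ᶠ ζ in 𝓝[≠] (0 : ℂ), F (a + ζ • b) = 0) →
      ∀ ζ : ℂ, F (a + ζ • b) = 0 := by
    intro a b hab ζ
    have hd : Differentiable ℂ fun ζ : ℂ => F (a + ζ • b) :=
      hF.comp (by fun_prop : Differentiable ℂ fun ζ : ℂ => a + ζ • b)
    exact (hd.differentiableOn.analyticOnNhd isOpen_univ).eqOn_zero_of_preconnected_of_frequently_eq_zero
      isPreconnected_univ (Set.mem_univ 0) hab (Set.mem_univ ζ)
  -- For small real `s` the point `x + s y` stays in the ball, so `ζ ↦ F(x + ζ y)` vanishes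
  -- identically, in particular at `ζ = i`. Points near `x₀` in `ℂ^m` are of the form `x + iy` with
  -- `x` in the ball, and from there complex lines reach every point.
  have h1 : ∀ x ∈ Metric.ball x₀ r, ∀ y, F (cpx x + I • cpx y) = 0 := by
    intro x hx y
    refine line _ _ ?_ I
    have t : Tendsto (fun s : ℝ => (s : ℂ)) (𝓝[≠] 0) (𝓝[≠] 0) := by
      have := tendsto_ofReal_add_nhdsNE 0 0
      simpa using this
    refine t.frequently (Eventually.frequently ?_)
    have hc : ∀ᶠ s : ℝ in 𝓝 0, x + s • y ∈ Metric.ball x₀ r :=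
      (by fun_prop : Continuous fun s : ℝ => x + s • y).continuousAt.eventually_mem
        (Metric.isOpen_ball.mem_nhds (by simpa using hx))
    filter_upwards [hc.filter_mono nhdsWithin_le_nhds] with s hs
    rw [← cpx_smul, ← map_add]
    exact h _ hs
  have hev : ∀ᶠ w in 𝓝 (cpx x₀), F w = 0 := by
    rw [Metric.eventually_nhds_iff]
    -- The neighbourhood is taken in the sup norm and the ball in the Euclidean norm; `√m · r / (m +
    -- 1) < r`.
    refine ⟨r / (m + 1), by positivity, fun {w} hw => ?_⟩
    obtain ⟨x, y, rfl⟩ := exists_cpx_add w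
    refine h1 x ?_ y
    rw [dist_pi_lt_iff (by positivity)] at hw
    rw [Metric.mem_ball, EuclideanSpace.dist_eq]
    have h2 : ∀ k, dist (x k) (x₀ k) ≤ r / (m + 1) := fun k => by
      have := (hw k).le
      rw [dist_eq_norm] at this ⊢
      refine le_trans ?_ this
      have := abs_re_le_norm ((cpx x + I • cpx y) k - cpx x₀ k)
      simpa using this
    have h3 : (0 : ℝ) < m + 1 := by positivity
    calc √(∑ k, dist (x k) (x₀ k) ^ 2) ≤ √(∑ _k : Fin m, (r / (m + 1)) ^ 2) := by
          gcongr with k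
          exact h2 k
      _ = √(m * (r / (m + 1)) ^ 2) := by simp
      _ < r := by
          rw [Real.sqrt_lt' hr, div_pow, mul_div_assoc', div_lt_iff₀ (by positivity)]
          have hm : (0 : ℝ) ≤ m := Nat.cast_nonneg m
          nlinarith [sq_pos_of_pos hr, mul_nonneg hm (sq_nonneg r), mul_nonneg (sq_nonneg (m : ℝ)) (sq_nonneg r)]
  have := line (cpx x₀) (z - cpx x₀) (Eventually.frequently (by
    have hc : ∀ᶠ ζ : ℂ in 𝓝 0, F (cpx x₀ + ζ • (z - cpx x₀)) = 0 :=
      (by fun_prop : Continuous fun ζ : ℂ => cpx x₀ + ζ • (z - cpx x₀)).continuousAt.eventually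
        (p := fun w => F w = 0) (by simpa using hev)
    exact hc.filter_mono nhdsWithin_le_nhds)) 1
  simpa using this

theorem dense_real_ne_zero {F : (Fin m → ℂ) → ℂ} (hF : Differentiable ℂ F) (h : ∃ z, F z ≠ 0) :
    Dense {x : RealLie m | F (cpx x) ≠ 0} := by
  obtain ⟨z, hz⟩ := h
  rw [Metric.dense_iff]
  intro x r hr
  by_contra hcon
  rw [Set.not_nonempty_iff_eq_empty] at hcon
  refine hz (eq_zero_of_real_ball hF (x₀ := x) hr (fun y hy => ?_) z)
  by_contra hy'
  exact (Set.ext_iff.1 hcon y).1 ⟨hy, hy'⟩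

theorem isOpen_real_ne_zero {F : (Fin m → ℂ) → ℂ} (hF : Differentiable ℂ F) :
    IsOpen {x : RealLie m | F (cpx x) ≠ 0} :=
  isOpen_ne_fun (hF.continuous.comp cpx.continuous) continuous_const

theorem eq_of_real_eq {F G : (Fin m → ℂ) → ℂ} (hF : Differentiable ℂ F) (hG : Differentiable ℂ G)
    (h : ∀ x : RealLie m, F (cpx x) = G (cpx x)) (z : Fin m → ℂ) : F z = G z :=
  sub_eq_zero.1 (eq_zero_of_real_ball (hF.sub hG) (x₀ := 0) one_pos
    (fun x _ => sub_eq_zero.2 (h x)) z)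

theorem exists_mul_ne_zero {F G : (Fin m → ℂ) → ℂ} (hF : Differentiable ℂ F)
    (hG : Differentiable ℂ G) (h : ∃ z, F z ≠ 0) (h' : ∃ z, G z ≠ 0) : ∃ z, F z * G z ≠ 0 := by
  obtain ⟨x, hx⟩ := ((dense_real_ne_zero hF h).inter_of_isOpen_left (dense_real_ne_zero hG h')
    (isOpen_real_ne_zero hF)).nonempty
  exact ⟨cpx x, mul_ne_zero hx.1 hx.2⟩

end Complexify

/-! ### The shift identity of a lattice vector and its restriction to lines -/

section Polynomials

variable {m : ℕ}

theorem differentiable_eval (R : CPoly m) : Differentiable ℂ fun z : Fin m → ℂ => MvPolynomial.eval z R := by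
  induction R using MvPolynomial.induction_on with
  | C a => simp
  | add p q hp hq => simp only [map_add]; fun_prop
  | mul_X p k hp => simp only [map_mul, MvPolynomial.eval_X]; fun_prop

theorem continuous_eval (R : CPoly m) : Continuous fun z : Fin m → ℂ => MvPolynomial.eval z R :=
  (differentiable_eval R).continuous

theorem exists_norm_eval_le (R : CPoly m) : ∀ a : ℝ, 0 < a → ∃ C : ℝ, 0 ≤ C ∧ ∀ z : Fin m → ℂ,
    ‖MvPolynomial.eval z R‖ ≤ C * Real.exp (a * ‖z‖) := by
  induction R using MvPolynomial.induction_on with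
  | C c =>
    intro a ha
    refine ⟨‖c‖, norm_nonneg _, fun z => ?_⟩
    rw [MvPolynomial.eval_C]
    exact le_mul_of_one_le_right (norm_nonneg _) (Real.one_le_exp (by positivity))
  | add p q hp hq =>
    intro a ha
    obtain ⟨C, hC, h⟩ := hp a ha
    obtain ⟨C', hC', h'⟩ := hq a ha
    refine ⟨C + C', by positivity, fun z => ?_⟩
    rw [map_add, add_mul]
    exact (norm_add_le _ _).trans (add_le_add (h z) (h' z))
  | mul_X p k hp =>
    intro a ha
    obtain ⟨C, hC, h⟩ := hp (a / 2) (half_pos ha)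
    refine ⟨C * (2 / a), by positivity, fun z => ?_⟩
    rw [map_mul, MvPolynomial.eval_X, norm_mul]
    have h1 : ‖z‖ ≤ 2 / a * Real.exp (a / 2 * ‖z‖) := by
      have := Real.add_one_le_exp (a / 2 * ‖z‖)
      rw [div_mul_eq_mul_div, le_div_iff₀ ha]
      linarith
    calc _ ≤ C * Real.exp (a / 2 * ‖z‖) * (2 / a * Real.exp (a / 2 * ‖z‖)) := by
          gcongr
          · exact h z
          · exact (norm_le_pi_norm z k).trans h1
      _ = C * (2 / a) * (Real.exp (a / 2 * ‖z‖) * Real.exp (a / 2 * ‖z‖)) := by ring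
      _ = _ := by rw [← Real.exp_add]; congr 2; ring

/-- The restriction of `R(i·)` to the line `ζ ↦ x + ζ l`. -/
noncomputable def linePoly (x l : RealLie m) : CPoly m →ₐ[ℂ] Polynomial ℂ :=
  MvPolynomial.aeval fun k => Polynomial.C (I * (x k : ℂ)) + Polynomial.C (I * (l k : ℂ)) * Polynomial.X

theorem eval_linePoly (x l : RealLie m) (R : CPoly m) (ζ : ℂ) :
    (linePoly x l R).eval ζ = MvPolynomial.eval (I • (cpx x + ζ • cpx l)) R := by
  have : (Polynomial.evalRingHom ζ).comp (linePoly x l : CPoly m →+* Polynomial ℂ) =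
      MvPolynomial.eval (I • (cpx x + ζ • cpx l)) := by
    refine MvPolynomial.ringHom_ext (fun c => ?_) fun k => ?_
    · simp [linePoly]
    · simp [linePoly]; ring
  exact DFunLike.congr_fun this R

/-- The identity that the trace condition gives for a lattice vector `l`. -/
def MvShiftIdentity (V : RealLie m → ℂ) (l : RealLie m) (c : ℂ) (Q : CPoly m) : Prop :=
  ∀ R : CPoly m, ∫ x, MvPolynomial.eval (I • cpx x + cpx l) (R * Q) * V x =
    c * ∫ x, MvPolynomial.eval (I • cpx x) (R * Q) * V x

variable {V : RealLie m → ℂ} {c : ℂ} {l : RealLie m} {Q : CPoly m}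

theorem ExpDecay.eval_mul (hd : ExpDecay V) (l : RealLie m) (R : CPoly m) :
    ExpDecay fun x => MvPolynomial.eval (I • cpx x + cpx l) R * V x := by
  obtain ⟨C, ε, hε, hC⟩ := hd
  have hC0 := ExpDecay.const_nonneg hC
  obtain ⟨C', hC', h⟩ := exists_norm_eval_le R (ε / 2) (half_pos hε)
  refine ⟨C' * Real.exp (ε / 2 * ‖l‖) * C, ε / 2, half_pos hε, fun x => ?_⟩
  have h1 : ‖I • cpx x + cpx l‖ ≤ ‖x‖ + ‖l‖ := by
    refine (norm_add_le _ _).trans (add_le_add ?_ (norm_cpx_le l))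
    rw [norm_smul, norm_I, one_mul]
    exact norm_cpx_le x
  rw [norm_mul]
  calc _ ≤ C' * Real.exp (ε / 2 * (‖x‖ + ‖l‖)) * (C * Real.exp (-ε * ‖x‖)) := by
        gcongr
        · refine (h _).trans ?_
          gcongr
        · exact hC x
    _ = C' * Real.exp (ε / 2 * ‖l‖) * C * (Real.exp (ε / 2 * ‖x‖) * Real.exp (-ε * ‖x‖)) := by
        rw [mul_add, Real.exp_add]; ring
    _ = _ := by rw [← Real.exp_add]; congr 2; ring

theorem ExpDecay.eval_mul' (hd : ExpDecay V) (R : CPoly m) :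
    ExpDecay fun x => MvPolynomial.eval (I • cpx x) R * V x := by
  simpa using hd.eval_mul 0 R

theorem ExpDecay.const_mul {F : RealLie m → ℂ} (hd : ExpDecay F) (c : ℂ) : ExpDecay fun x => c * F x := by
  obtain ⟨C, ε, hε, hC⟩ := hd
  refine ⟨‖c‖ * C, ε, hε, fun x => ?_⟩
  rw [norm_mul, mul_assoc]
  gcongr
  exact hC x

theorem ExpDecay.sub {F G : RealLie m → ℂ} (hF : ExpDecay F) (hG : ExpDecay G) :
    ExpDecay fun x => F x - G x := by
  obtain ⟨C, ε, hε, hC⟩ := hF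
  obtain ⟨C', ε', hε', hC'⟩ := hG
  have h0 := ExpDecay.const_nonneg hC
  have h0' := ExpDecay.const_nonneg hC'
  refine ⟨C + C', min ε ε', lt_min hε hε', fun x => ?_⟩
  rw [add_mul]
  refine (norm_sub_le _ _).trans (add_le_add ((hC x).trans ?_) ((hC' x).trans ?_))
  · gcongr; exact min_le_left _ _
  · gcongr; exact min_le_right _ _

theorem continuous_shift_bracket (hV : Continuous V) (R : CPoly m) :
    Continuous fun x => MvPolynomial.eval (I • cpx x + cpx l) R * V x -
      c * (MvPolynomial.eval (I • cpx x) R * V x) := by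
  have h1 := (continuous_eval R).comp (by fun_prop : Continuous fun x : RealLie m => I • cpx x + cpx l)
  have h2 := (continuous_eval R).comp (by fun_prop : Continuous fun x : RealLie m => I • cpx x)
  exact (h1.mul hV).sub (continuous_const.mul (h2.mul hV))

theorem expDecay_shift_bracket (hd : ExpDecay V) (R : CPoly m) :
    ExpDecay fun x => MvPolynomial.eval (I • cpx x + cpx l) R * V x -
      c * (MvPolynomial.eval (I • cpx x) R * V x) :=
  (hd.eval_mul l R).sub ((hd.eval_mul' R).const_mul c)

theorem integral_shift_bracket (hV : Continuous V) (hd : ExpDecay V) (R : CPoly m) :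
    ∫ x, (MvPolynomial.eval (I • cpx x + cpx l) R * V x -
      c * (MvPolynomial.eval (I • cpx x) R * V x)) =
    (∫ x, MvPolynomial.eval (I • cpx x + cpx l) R * V x) -
      c * ∫ x, MvPolynomial.eval (I • cpx x) R * V x := by
  have h1 := (continuous_eval R).comp (by fun_prop : Continuous fun x : RealLie m => I • cpx x + cpx l)
  have h2 := (continuous_eval R).comp (by fun_prop : Continuous fun x : RealLie m => I • cpx x)
  rw [integral_sub ((hd.eval_mul l R).integrable (h1.mul hV))
    (((hd.eval_mul' R).integrable (h2.mul hV)).const_mul c), integral_const_mul]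

theorem line_point (x l : RealLie m) (s : ℝ) :
    I • cpx (x + s • l) = I • (cpx x + (s : ℂ) • cpx l) ∧
      I • cpx (x + s • l) + cpx l = I • (cpx x + ((s : ℂ) - I) • cpx l) := by
  refine ⟨by rw [map_add, cpx_smul], ?_⟩
  ext k
  simp only [Pi.add_apply, Pi.smul_apply, cpx_apply, smul_eq_mul, PiLp.add_apply, PiLp.smul_apply,
    ofReal_add, ofReal_mul]
  linear_combination (l k : ℂ) * I_mul_I

/-- The shift identity of a lattice vector restricts to lines. -/
theorem MvShiftIdentity.line (hV : Continuous V) (hd : ExpDecay V) (hl : l ≠ 0)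
    (h : MvShiftIdentity V l c Q) (x : RealLie m)
    (hi : ∀ (p : Polynomial ℂ) (t : ℝ), |t| ≤ 1 →
      Integrable fun s : ℝ => p.eval ((s : ℂ) + t * I) * V (x + s • l)) :
    ShiftIdentity (fun s => V (x + s • l)) c (linePoly x l Q) := by
  intro p
  -- An affine polynomial that recovers the parameter of the line: its value is `s` at `i(x + s l)`
  -- and `s - i` at `i(x + s l) + l`. Composing with it transports polynomials in one variable to
  -- `ℝ^m`.
  set f : CPoly m := ∑ k, MvPolynomial.C (-I * ((‖l‖ ^ 2)⁻¹ * l k : ℝ)) * MvPolynomial.X k -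
    MvPolynomial.C (lineCoord l x : ℂ) with hf
  have hlin : ∀ y : RealLie m, lineCoord l y = ∑ k, ((‖l‖ ^ 2)⁻¹ * l k) * y k := by
    intro y
    rw [lineCoord_apply, PiLp.inner_apply, Finset.mul_sum]
    refine Finset.sum_congr rfl fun k _ => ?_
    simp; ring
  have hf1 : ∀ (s : ℝ), MvPolynomial.eval (I • cpx (x + s • l)) f = s := by
    intro s
    have : ∑ k, -I * ((‖l‖ ^ 2)⁻¹ * l k : ℝ) * (I * ((x + s • l) k : ℂ)) =
        (lineCoord l (x + s • l) : ℂ) := by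
      rw [hlin, ofReal_sum]
      refine Finset.sum_congr rfl fun k _ => ?_
      push_cast
      linear_combination (-((‖l‖ : ℂ) ^ 2)⁻¹ * l k * ((x + s • l) k : ℂ)) * I_mul_I
    simp only [hf, map_sub, map_sum, map_mul, MvPolynomial.eval_C, MvPolynomial.eval_X,
      Pi.smul_apply, cpx_apply, smul_eq_mul]
    rw [this, map_add, map_smul, lineCoord_self hl]
    push_cast; simp
  have hf2 : ∀ (s : ℝ), MvPolynomial.eval (I • cpx (x + s • l) + cpx l) f = s - I := by
    intro s
    have : MvPolynomial.eval (I • cpx (x + s • l) + cpx l) f =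
        MvPolynomial.eval (I • cpx (x + s • l)) f - I * (lineCoord l l : ℂ) := by
      rw [hlin, ofReal_sum, Finset.mul_sum]
      simp only [hf, map_sub, map_sum, map_mul, MvPolynomial.eval_C, MvPolynomial.eval_X,
        Pi.smul_apply, cpx_apply, smul_eq_mul, Pi.add_apply, mul_add, Finset.sum_add_distrib]
      rw [sub_right_comm]
      congr 1
      rw [sub_eq_add_neg, ← Finset.sum_neg_distrib]
      congr 1
      refine Finset.sum_congr rfl fun k _ => ?_
      push_cast; ring
    rw [this, hf1, lineCoord_self hl]; simp
  set R : CPoly m := Polynomial.aeval f p with hR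
  have hRe : ∀ z : Fin m → ℂ, MvPolynomial.eval z R = p.eval (MvPolynomial.eval z f) := by
    intro z
    have := Polynomial.aeval_algHom_apply (MvPolynomial.aeval z : CPoly m →ₐ[ℂ] ℂ) f p
    simpa [hR] using this.symm
  have key := integral_line_eq_zero hl (continuous_shift_bracket (c := c) (l := l) hV (R * Q))
    (expDecay_shift_bracket hd (R * Q)) (fun w n hw => ?_) x
  · have e : ∀ s : ℝ, MvPolynomial.eval (I • cpx (x + s • l) + cpx l) (R * Q) * V (x + s • l) -
        c * (MvPolynomial.eval (I • cpx (x + s • l)) (R * Q) * V (x + s • l)) =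
        p.eval ((s : ℂ) - I) * (linePoly x l Q).eval ((s : ℂ) - I) * V (x + s • l) -
        c * (p.eval (s : ℂ) * (linePoly x l Q).eval (s : ℂ) * V (x + s • l)) := by
      intro s
      rw [map_mul, map_mul, hRe, hRe, hf1, hf2, eval_linePoly, eval_linePoly, (line_point x l s).2,
        (line_point x l s).1]
    rw [integral_congr_fun e, integral_sub, integral_const_mul, sub_eq_zero] at key
    · exact key
    · have := hi (p * linePoly x l Q) (-1) (by simp)
      simpa [sub_eq_add_neg] using this
    · have := hi (p * linePoly x l Q) 0 (by simp)
      simpa using this.const_mul c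
  -- For `w` orthogonal to `l` the function `g`, which is `⟨y, w⟩` at `iy`, is invariant under the
  -- shift by `l`. Powers of `g` can therefore be inserted in the identity, and all transversal
  -- moments vanish.
  · set g : CPoly m := ∑ k, MvPolynomial.C (-I * (w k : ℂ)) * MvPolynomial.X k with hg
    have hg1 : ∀ y : RealLie m, MvPolynomial.eval (I • cpx y) g = ((inner ℝ y w : ℝ) : ℂ) := by
      intro y
      simp only [hg, map_sum, map_mul, MvPolynomial.eval_C, MvPolynomial.eval_X,
        Pi.smul_apply, cpx_apply, smul_eq_mul, PiLp.inner_apply, ofReal_sum]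
      refine Finset.sum_congr rfl fun k _ => ?_
      simp
      linear_combination (-(w k : ℂ) * y k) * I_mul_I
    have hg2 : ∀ y : RealLie m, MvPolynomial.eval (I • cpx y + cpx l) g =
        ((inner ℝ y w : ℝ) : ℂ) := by
      intro y
      have h0 : ∑ k, -I * (w k : ℂ) * (l k : ℂ) = 0 := by
        have : -I * ((inner ℝ l w : ℝ) : ℂ) = ∑ k, -I * (w k : ℂ) * (l k : ℂ) := by
          rw [PiLp.inner_apply, ofReal_sum, Finset.mul_sum]
          refine Finset.sum_congr rfl fun k _ => ?_
          simp; ring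
        rw [← this, hw]; simp
      rw [← hg1]
      simp only [hg, map_sum, map_mul, MvPolynomial.eval_C, MvPolynomial.eval_X,
        Pi.smul_apply, cpx_apply, smul_eq_mul, Pi.add_apply, mul_add, Finset.sum_add_distrib]
      rw [h0, add_zero]
    have := h (g ^ n * R)
    rw [← sub_eq_zero, ← integral_shift_bracket hV hd] at this
    rw [← this]
    refine integral_congr_fun fun y => ?_
    simp only [map_mul, map_pow, hg1, hg2]
    ring

/-- The shift identity of a lattice vector follows from that on a dense set of lines. -/
theorem MvShiftIdentity.of_line (hV : Continuous V) (hd : ExpDecay V) (hl : l ≠ 0)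
    {G : Set (RealLie m)} (hG : Dense G)
    (hi : ∀ x ∈ G, ∀ (p : Polynomial ℂ) (t : ℝ), |t| ≤ 1 →
      Integrable fun s : ℝ => p.eval ((s : ℂ) + t * I) * V (x + s • l))
    (h : ∀ x ∈ G, ShiftIdentity (fun s => V (x + s • l)) c (linePoly x l Q)) :
    MvShiftIdentity V l c Q := by
  intro R
  rw [← sub_eq_zero, ← integral_shift_bracket hV hd]
  refine integral_eq_zero_of_dense hl (continuous_shift_bracket hV _) (expDecay_shift_bracket hd _)
    hG fun x hx => ?_
  have e : ∀ s : ℝ, MvPolynomial.eval (I • cpx (x + s • l) + cpx l) (R * Q) * V (x + s • l) -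
      c * (MvPolynomial.eval (I • cpx (x + s • l)) (R * Q) * V (x + s • l)) =
      (linePoly x l R).eval ((s : ℂ) - I) * (linePoly x l Q).eval ((s : ℂ) - I) * V (x + s • l) -
      c * ((linePoly x l R).eval (s : ℂ) * (linePoly x l Q).eval (s : ℂ) * V (x + s • l)) := by
    intro s
    rw [map_mul, map_mul, eval_linePoly, eval_linePoly, eval_linePoly, eval_linePoly,
      (line_point x l s).2, (line_point x l s).1]
  rw [integral_congr_fun e, integral_sub, integral_const_mul, sub_eq_zero]
  · exact h x hx (linePoly x l R)
  · have := hi x hx (linePoly x l R * linePoly x l Q) (-1) (by simp)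
    simpa [sub_eq_add_neg] using this
  · have := hi x hx (linePoly x l R * linePoly x l Q) 0 (by simp)
    simpa using this.const_mul c

end Polynomials

/-! ### Quotients by products of functions `e^Λ - σ` -/

section ExpQuotient

variable {m : ℕ}

/-- The entire function `e^Λ - σ`. -/
noncomputable def expFactor (Λ : Fin m → ℝ) (σ : ℂ) (z : Fin m → ℂ) : ℂ := cexp (cdot Λ z) - σ

/-- A finite product of functions `e^Λ - σ`. -/
noncomputable def expDen {κ : Type*} [Fintype κ] (Λ : κ → Fin m → ℝ) (σ : κ → ℂ) (z : Fin m → ℂ) : ℂ :=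
  ∏ j, expFactor (Λ j) (σ j) z

theorem differentiable_expFactor (Λ : Fin m → ℝ) (σ : ℂ) : Differentiable ℂ (expFactor Λ σ) := by
  unfold expFactor; fun_prop

variable {κ : Type*} [Fintype κ]

theorem differentiable_finsetProd {κ : Type*} (s : Finset κ) (f : κ → (Fin m → ℂ) → ℂ)
    (hf : ∀ j, Differentiable ℂ (f j)) : Differentiable ℂ fun z => ∏ j ∈ s, f j z := by
  classical
  exact fun z => (HasFDerivAt.finsetProd fun j _ => (hf j z).hasFDerivAt).differentiableAt

theorem differentiable_expDen (Λ : κ → Fin m → ℝ) (σ : κ → ℂ) : Differentiable ℂ (expDen Λ σ) :=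
  differentiable_finsetProd _ _ fun j => differentiable_expFactor (Λ j) (σ j)

theorem cdot_line (Λ : Fin m → ℝ) (x l : RealLie m) (ζ : ℂ) :
    cdot Λ (cpx x + ζ • cpx l) = ((∑ k, Λ k * x k : ℝ) : ℂ) + ((∑ k, Λ k * l k : ℝ) : ℂ) * ζ := by
  rw [map_add, map_smul, cdot_cpx, cdot_cpx, smul_eq_mul, mul_comm ζ]

/-- If `b ≠ 0`, the modulus of the exponential depends only on `Re ζ` and at the ends is far above
or far below `|σ|`. If `b = 0`, the difference is a constant, nonzero by hypothesis. -/
theorem exists_le_norm_exp_sub {a b : ℝ} {σ : ℂ} (hσ : σ ≠ 0) (h : cexp a - σ ≠ 0) :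
    ∃ R δ : ℝ, 0 < δ ∧ ∀ ζ : ℂ, R ≤ |ζ.re| → δ ≤ ‖cexp (a + b * ζ) - σ‖ := by
  rcases eq_or_ne b 0 with rfl | hb
  · exact ⟨0, _, norm_pos_iff.2 h, fun ζ _ => by simp⟩
  have hσ' : 0 < ‖σ‖ := norm_pos_iff.2 hσ
  obtain ⟨M, hM⟩ : ∃ M : ℝ, ∀ t : ℝ, M ≤ |t| →
      Real.exp t ≤ ‖σ‖ / 2 ∨ 2 * ‖σ‖ ≤ Real.exp t := by
    obtain ⟨u, hu⟩ := eventually_atTop.1 (Real.tendsto_exp_atTop.eventually_ge_atTop (2 * ‖σ‖))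
    obtain ⟨l, hl⟩ := eventually_atBot.1 (Real.tendsto_exp_atBot.eventually
      (ge_mem_nhds (half_pos hσ')))
    refine ⟨max u (-l), fun t ht => ?_⟩
    rcases le_total 0 t with h0 | h0
    · rw [abs_of_nonneg h0] at ht
      exact Or.inr (hu t ((le_max_left _ _).trans ht))
    · rw [abs_of_nonpos h0] at ht
      exact Or.inl (hl t (by have := (le_max_right _ _).trans ht; linarith))
  refine ⟨(|M| + |a|) / |b|, ‖σ‖ / 2, half_pos hσ', fun ζ hζ => ?_⟩
  have hb' := abs_pos.2 hb
  rw [div_le_iff₀ hb'] at hζ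
  have h1 : M ≤ |a + b * ζ.re| := by
    have h2 : |b * ζ.re| ≤ |a + b * ζ.re| + |a| := by
      have := abs_sub (a + b * ζ.re) a
      rwa [add_sub_cancel_left] at this
    rw [abs_mul] at h2
    have := le_abs_self M
    nlinarith
  have h3 : ‖cexp (a + b * ζ)‖ = Real.exp (a + b * ζ.re) := by
    rw [Complex.norm_exp]; simp
  rcases hM _ h1 with h4 | h4
  · have := norm_sub_norm_le σ (cexp (a + b * ζ))
    rw [norm_sub_rev] at this
    rw [h3] at this
    linarith
  · have := norm_sub_norm_le (cexp (a + b * ζ)) σ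
    rw [h3] at this
    linarith

/-- A continuous exponentially decaying function `V` on `ℝ^m` that is the restriction of the quotient
of an entire function `N` of exponential growth by a product of functions `e^Λ - σ`. -/
structure ExpQuotient (V : RealLie m → ℂ) (N : (Fin m → ℂ) → ℂ) (Λ : κ → Fin m → ℝ) (σ : κ → ℂ) :
    Prop where
  cont : Continuous V
  decay : ExpDecay V
  num : Differentiable ℂ N
  growth : ∃ C : ℝ, 0 ≤ C ∧ ∀ z, ‖N z‖ ≤ C * Real.exp (C * ‖z‖)
  lam_ne : ∀ j, Λ j ≠ 0
  sigma_ne : ∀ j, σ j ≠ 0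
  eq : ∀ x, expDen Λ σ (cpx x) * V x = N (cpx x)

namespace ExpQuotient

variable {V : RealLie m → ℂ} {N : (Fin m → ℂ) → ℂ} {Λ : κ → Fin m → ℝ} {σ : κ → ℂ}

/-- The condition at `x` is needed for the factors with `Λ(l) = 0`: they are constant along the line
and must not be zero. -/
theorem lineQuotient (h : ExpQuotient V N Λ σ) {x l : RealLie m} (hl : l ≠ 0)
    (hx : expDen Λ σ (cpx x) ≠ 0) :
    LineQuotient (fun s => V (x + s • l)) (fun ζ => N (cpx x + ζ • cpx l))
      (fun ζ => expDen Λ σ (cpx x + ζ • cpx l)) where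
  cont := h.cont.comp (by fun_prop)
  decay := by
    obtain ⟨C, ε, hε, hC⟩ := h.decay
    have hC0 := ExpDecay.const_nonneg hC
    refine ⟨C * Real.exp (ε * ‖x‖), ε * ‖l‖, mul_pos hε (norm_pos_iff.2 hl), fun s => ?_⟩
    refine (hC _).trans ?_
    rw [mul_assoc, ← Real.exp_add]
    have h2 : |s| * ‖l‖ ≤ ‖x + s • l‖ + ‖x‖ := by
      rw [← Real.norm_eq_abs, ← norm_smul]
      calc ‖s • l‖ = ‖(x + s • l) - x‖ := by rw [add_sub_cancel_left]
        _ ≤ _ := norm_sub_le _ _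
    gcongr
    nlinarith
  num := h.num.comp (by fun_prop)
  den := (differentiable_expDen Λ σ).comp (by fun_prop)
  eq := fun s => by
    rw [← cpx_smul, ← map_add]
    exact h.eq _
  growth := by
    have hx' : ∀ j, cexp ((∑ k, Λ j k * x k : ℝ) : ℂ) - σ j ≠ 0 := fun j => by
      rw [← cdot_cpx]
      exact Finset.prod_ne_zero_iff.1 hx j (Finset.mem_univ j)
    choose R δ hδ hR using fun j => exists_le_norm_exp_sub (b := ∑ k, Λ j k * l k) (h.sigma_ne j) (hx' j)
    obtain ⟨C, hC, hN⟩ := h.growth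
    refine ⟨∑ j, |R j|, max (C * Real.exp (C * (‖x‖ + ‖l‖))) (C * ‖l‖), ∏ j, δ j,
      Finset.prod_pos fun j _ => hδ j, le_max_of_le_right (by positivity), fun z hz1 hz2 => ⟨?_, ?_⟩⟩
    · rw [expDen, norm_prod]
      refine Finset.prod_le_prod (fun j _ => (hδ j).le) fun j _ => ?_
      rw [expFactor, cdot_line]
      refine hR j z (le_trans ?_ hz2)
      exact (le_abs_self _).trans
        (Finset.single_le_sum (f := fun j => |R j|) (fun j _ => abs_nonneg _) (Finset.mem_univ j))
    · have h1 : ‖cpx x + z • cpx l‖ ≤ ‖x‖ + (|z.re| + 1) * ‖l‖ := by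
        refine (norm_add_le _ _).trans (add_le_add (norm_cpx_le x) ?_)
        rw [norm_smul]
        gcongr
        · exact norm_le_of_strip hz1
        · exact norm_cpx_le l
      calc _ ≤ C * Real.exp (C * (‖x‖ + (|z.re| + 1) * ‖l‖)) := by
            refine (hN _).trans ?_
            gcongr
        _ = C * Real.exp (C * (‖x‖ + ‖l‖)) * Real.exp (C * ‖l‖ * |z.re|) := by
            rw [mul_assoc, ← Real.exp_add]; congr 2; ring
        _ ≤ _ := by
            gcongr
            · exact le_max_left _ _
            · exact le_max_right _ _

theorem exists_expFactor_ne_zero {Λ : Fin m → ℝ} (hΛ : Λ ≠ 0) (σ : ℂ) : ∃ z, expFactor Λ σ z ≠ 0 := by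
  obtain ⟨k, hk⟩ := Function.ne_iff.1 hΛ
  have hk' : (Λ k : ℂ) ≠ 0 := by exact_mod_cast hk
  have : ∀ w : ℂ, cdot Λ (Pi.single k (w / Λ k)) = w := fun w => by
    rw [cdot_apply, Finset.sum_eq_single k]
    · rw [Pi.single_eq_same, mul_div_cancel₀ _ hk']
    · intro j _ hj
      rw [Pi.single_eq_of_ne hj, mul_zero]
    · simp
  by_contra hcon
  push Not at hcon
  -- The exponential takes the values `1` and `-1`, and `σ` cannot equal both.
  have h1 := hcon (Pi.single k (0 / Λ k))
  have h2 := hcon (Pi.single k (Real.pi * I / Λ k))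
  rw [expFactor, this] at h1 h2
  rw [Complex.exp_zero] at h1
  rw [Complex.exp_pi_mul_I] at h2
  have : (2 : ℂ) = 0 := by linear_combination h1 - h2
  norm_num at this

theorem exists_prod_ne_zero {κ : Type*} (s : Finset κ) (f : κ → (Fin m → ℂ) → ℂ)
    (hf : ∀ j, Differentiable ℂ (f j)) (h : ∀ j ∈ s, ∃ z, f j z ≠ 0) :
    ∃ z, ∏ j ∈ s, f j z ≠ 0 := by
  classical
  induction s using Finset.induction_on with
  | empty => exact ⟨0, by simp⟩
  | insert a s ha ih =>
    simp only [Finset.prod_insert ha]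
    refine exists_mul_ne_zero (hf a) (differentiable_finsetProd _ _ hf) (h a (Finset.mem_insert_self _ _))
      (ih fun j hj => h j (Finset.mem_insert_of_mem hj))

theorem exists_expDen_ne_zero (h : ExpQuotient V N Λ σ) : ∃ z, expDen Λ σ z ≠ 0 :=
  exists_prod_ne_zero _ _ (fun _ => differentiable_expFactor _ _) fun j _ =>
    exists_expFactor_ne_zero (h.lam_ne j) _

theorem dense_expDen_ne_zero (h : ExpQuotient V N Λ σ) :
    Dense {x : RealLie m | expDen Λ σ (cpx x) ≠ 0} :=
  dense_real_ne_zero (differentiable_expDen Λ σ) h.exists_expDen_ne_zero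

theorem integrable_line (h : ExpQuotient V N Λ σ) {l : RealLie m} (hl : l ≠ 0) (x : RealLie m)
    (p : Polynomial ℂ) (t : ℝ) (ht : |t| ≤ 1) :
    Integrable fun s : ℝ => p.eval ((s : ℂ) + t * I) * V (x + s • l) := by
  obtain ⟨C, ε, hε, hC⟩ := h.decay
  have hC0 := ExpDecay.const_nonneg hC
  obtain ⟨C', hC', hp⟩ := exists_bound_polynomial_strip p (a := ε * ‖l‖ / 2)
    (by have := norm_pos_iff.2 hl; positivity)
  have hpos : 0 < ε * ‖l‖ / 2 := by have := norm_pos_iff.2 hl; positivity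
  have hcont : Continuous fun s : ℝ => p.eval ((s : ℂ) + t * I) * V (x + s • l) := by
    have := h.cont
    have := p.continuous
    fun_prop
  refine ((integrable_exp_neg_mul_norm (E := ℝ) volume hpos).const_mul
    (C' * (C * Real.exp (ε * ‖x‖)))).mono' hcont.aestronglyMeasurable (Eventually.of_forall fun s => ?_)
  have h2 : ‖s‖ * ‖l‖ ≤ ‖x + s • l‖ + ‖x‖ := by
    rw [← norm_smul]
    calc ‖s • l‖ = ‖(x + s • l) - x‖ := by rw [add_sub_cancel_left]
      _ ≤ _ := norm_sub_le _ _
  rw [norm_mul]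
  calc _ ≤ C' * Real.exp (ε * ‖l‖ / 2 * ‖s‖) * (C * Real.exp (ε * ‖x‖ - ε * ‖l‖ * ‖s‖)) := by
        gcongr
        · simpa using hp ((s : ℂ) + t * I) (by simpa using ht)
        · refine (hC _).trans ?_
          gcongr
          nlinarith
    _ = C' * (C * Real.exp (ε * ‖x‖)) *
        (Real.exp (ε * ‖l‖ / 2 * ‖s‖) * Real.exp (- (ε * ‖l‖ * ‖s‖))) := by
        rw [sub_eq_add_neg, Real.exp_add]; ring
    _ = _ := by rw [← Real.exp_add]; congr 2; ring

variable {l : RealLie m} {c : ℂ} {q P Q : CPoly m}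

theorem shiftIdentity_line (h : ExpQuotient V N Λ σ) (hl : l ≠ 0) (hQ : MvShiftIdentity V l c Q)
    (x : RealLie m) : ShiftIdentity (fun s => V (x + s • l)) c (linePoly x l Q) :=
  hQ.line h.cont h.decay hl x (h.integrable_line hl x)

theorem exists_eval_I_ne_zero (hQ : Q ≠ 0) : ∃ z : Fin m → ℂ, MvPolynomial.eval (I • z) Q ≠ 0 := by
  by_contra hcon
  push Not at hcon
  refine hQ (MvPolynomial.funext fun z => ?_)
  have := hcon (-I • z)
  have e : I • -I • z = z := by rw [smul_smul]; simp
  rwa [e] at this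

theorem differentiable_eval_I (Q : CPoly m) :
    Differentiable ℂ fun z : Fin m → ℂ => MvPolynomial.eval (I • z) Q :=
  (differentiable_eval Q).comp (by fun_prop : Differentiable ℂ fun z : Fin m → ℂ => I • z)

theorem linePoly_ne_zero {x : RealLie m} (hx : MvPolynomial.eval (I • cpx x) Q ≠ 0) :
    linePoly x l Q ≠ 0 := fun h0 => by
  have := eval_linePoly x l Q 0
  rw [h0, Polynomial.eval_zero, zero_smul, add_zero] at this
  exact hx this.symm

/-- The points `x` at which neither the denominator nor `Q` vanish. -/
theorem dense_generic (h : ExpQuotient V N Λ σ) (hQ : Q ≠ 0) :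
    Dense {x : RealLie m | expDen Λ σ (cpx x) ≠ 0 ∧ MvPolynomial.eval (I • cpx x) Q ≠ 0} :=
  h.dense_expDen_ne_zero.inter_of_isOpen_left
    (dense_real_ne_zero (differentiable_eval_I Q) (exists_eval_I_ne_zero hQ))
    (isOpen_real_ne_zero (differentiable_expDen Λ σ))

/-- The result for lines, taken at parameter `0`, gives this at generic real points. Density and
continuity give it on `ℝ^m`, and the identity theorem on `ℂ^m`. -/
theorem quasi_periodic (h : ExpQuotient V N Λ σ) (hl : l ≠ 0) (hQ0 : Q ≠ 0)
    (hQ : MvShiftIdentity V l c Q) (z : Fin m → ℂ) :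
    N (z + I • cpx l) * expDen Λ σ z = c * N z * expDen Λ σ (z + I • cpx l) := by
  have hN := h.num
  have hD := differentiable_expDen Λ σ
  refine eq_of_real_eq (F := fun z => N (z + I • cpx l) * expDen Λ σ z)
    (G := fun z => c * N z * expDen Λ σ (z + I • cpx l)) (by fun_prop) (by fun_prop) (fun x => ?_) z
  have hd := h.dense_generic hQ0
  have hNc := hN.continuous
  have hDc := hD.continuous
  have e : (fun x : RealLie m => N (cpx x + I • cpx l) * expDen Λ σ (cpx x)) =
      fun x => c * N (cpx x) * expDen Λ σ (cpx x + I • cpx l) := by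
    refine Continuous.ext_on hd (by fun_prop) (by fun_prop) fun x hx => ?_
    have := (h.lineQuotient hl hx.1).quasi_periodic (h.shiftIdentity_line hl hQ x)
      (linePoly_ne_zero hx.2) 0
    simpa using this
  exact congrFun e x

/-- `q(i·)` does not vanish inside the strips `x + ζ l`, `-1 < Im ζ < 0`, unless it vanishes at `x`. -/
def StripNonvanishing (q : CPoly m) (l : RealLie m) : Prop :=
  ∀ x : RealLie m, MvPolynomial.eval (I • cpx x) q ≠ 0 → ∀ ζ : ℂ, -1 < ζ.im → ζ.im < 0 →
    MvPolynomial.eval (I • (cpx x + ζ • cpx l)) q ≠ 0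

/-- On each generic line `q` restricts to a polynomial without zeros in the open strip, so it can be
removed there; integration over the lines gives the identity on `ℝ^m`. -/
theorem mvShiftIdentity_of_mul (h : ExpQuotient V N Λ σ) (hl : l ≠ 0) (hc : c ≠ 0)
    (hq : StripNonvanishing q l) (hqP : q * P ≠ 0) (hQ : MvShiftIdentity V l c (q * P)) :
    MvShiftIdentity V l c P := by
  refine MvShiftIdentity.of_line h.cont h.decay hl (h.dense_generic hqP)
    (fun x _ => h.integrable_line hl x) fun x hx => ?_
  have h1 := h.shiftIdentity_line hl hQ x
  have h2 := linePoly_ne_zero (l := l) hx.2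
  rw [map_mul] at h1 h2
  refine (h.lineQuotient hl hx.1).shiftIdentity_of_mul hc h1 h2 fun ζ h3 h4 => ?_
  rw [eval_linePoly]
  refine hq x ?_ ζ h3 h4
  intro h0
  exact hx.2 (by rw [map_mul, h0, zero_mul])

theorem order_nonneg (h : ExpQuotient V N Λ σ) (hl : l ≠ 0) (hc : c ≠ 0)
    (hQ : MvShiftIdentity V l c Q) {x : RealLie m} (hx : expDen Λ σ (cpx x) ≠ 0)
    (hxQ : MvPolynomial.eval (I • cpx x) Q ≠ 0) {a : ℂ} (ha : -1 < a.im) (ha' : a.im < 0) :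
    0 ≤ meromorphicOrderAt (fun ζ => MvPolynomial.eval (I • (cpx x + ζ • cpx l)) Q *
      (N (cpx x + ζ • cpx l) / expDen Λ σ (cpx x + ζ • cpx l))) a := by
  have := (h.lineQuotient hl hx).order_nonneg hc (h.shiftIdentity_line hl hQ x)
    (linePoly_ne_zero hxQ) ha ha'
  simpa only [eval_linePoly] using this

end ExpQuotient

end ExpQuotient

/-! ### Division of entire functions by `e^Λ - σ` -/

section Division

variable {m : ℕ}

theorem differentiable_intervalIntegral {Φ : (Fin m → ℂ) → ℝ → ℂ}
    (hc : Continuous (Function.uncurry Φ)) (hd : ∀ t, Differentiable ℂ fun z => Φ z t) (a b : ℝ) :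
    Differentiable ℂ fun z => ∫ t in a..b, Φ z t := by
  intro z₀
  obtain ⟨M, hM⟩ := ((isCompact_closedBall z₀ 2).prod (isCompact_uIcc (a := a) (b := b))).exists_bound_of_continuousOn
    hc.continuousOn
  have hcz : ∀ z, Continuous (Φ z) := fun z => hc.comp (by fun_prop : Continuous fun t : ℝ => (z, t))
  have hc' : Continuous (Function.uncurry fun (t : ℝ) (z : Fin m → ℂ) => Φ z t) :=
    hc.comp continuous_swap
  refine (intervalIntegral.hasFDerivAt_integral_of_dominated_of_fderiv_le
    -- Cauchy's estimate: on a unit ball the values lie within `2 M` of the value at the centre,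
    -- which bounds the derivative uniformly in `t`.
    (F' := fun z t => fderiv ℂ (fun z => Φ z t) z) (bound := fun _ => 2 * M / 1)
    (Metric.ball_mem_nhds z₀ one_pos) (Eventually.of_forall fun z => (hcz z).aestronglyMeasurable)
    ((hcz z₀).intervalIntegrable _ _) ?_ ?_ (by simp) ?_).differentiableAt
  · have := (measurable_fderiv_with_param ℂ hc').comp (measurable_id.prodMk measurable_const :
      Measurable fun t : ℝ => (t, z₀))
    exact (this.aestronglyMeasurable :)
  · refine Eventually.of_forall fun t ht z hz => ?_
    have ht' := Set.uIoc_subset_uIcc ht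
    have hb : ∀ y ∈ Metric.ball z 1, ‖Φ y t‖ ≤ M := fun y hy => hM (y, t) ⟨by
      rw [Metric.mem_closedBall]
      have := dist_triangle y z z₀
      rw [Metric.mem_ball] at hz hy
      linarith, ht'⟩
    refine Complex.norm_fderiv_le_div_of_mapsTo_ball ((hd t).differentiableOn) (fun y hy => ?_) one_pos
    rw [mem_closedBall_iff_norm]
    have h1 := hb y hy
    have h2 := hb z (Metric.mem_ball_self one_pos)
    exact (norm_sub_le _ _).trans (by linarith)
  · exact Eventually.of_forall fun t _ z _ => (hd t z).hasFDerivAt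

/-- The derivative of an entire function in a direction is entire. -/
theorem differentiable_deriv_line {F : (Fin m → ℂ) → ℂ} (hF : Differentiable ℂ F) (u : Fin m → ℂ) :
    Differentiable ℂ fun z => deriv (fun ζ : ℂ => F (z + ζ • u)) 0 := by
  -- Cauchy's formula writes the derivative as an integral of entire functions of `z` over a circle,
  -- so it is entire in `z`.
  have e : ∀ z, deriv (fun ζ : ℂ => F (z + ζ • u)) 0 = (2 * Real.pi * I : ℂ)⁻¹ •
      ∮ ζ in C(0, 1), (1 / (ζ - 0) ^ 2) • F (z + ζ • u) := fun z => by
    have hd : Differentiable ℂ fun ζ : ℂ => F (z + ζ • u) :=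
      hF.comp (by fun_prop : Differentiable ℂ fun ζ : ℂ => z + ζ • u)
    rw [DifferentiableOn.deriv_eq_smul_circleIntegral one_pos hd.differentiableOn,
      inv_smul_smul₀ two_pi_I_ne_zero]
  rw [funext e]
  refine Differentiable.fun_const_smul ?_ _
  simp only [circleIntegral]
  have hF' := hF.continuous
  refine differentiable_intervalIntegral ?_ (fun t => ?_) _ _
  · have h1 : Continuous fun p : (Fin m → ℂ) × ℝ => 1 / (circleMap 0 1 p.2 - 0) ^ 2 := by
      refine continuous_const.div (by fun_prop) fun p => pow_ne_zero _ ?_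
      rw [sub_zero]
      exact circleMap_ne_center one_ne_zero
    have h2 : Continuous fun p : (Fin m → ℂ) × ℝ => deriv (circleMap 0 1) p.2 := by
      simp only [deriv_circleMap]; fun_prop
    have h3 : Continuous fun p : (Fin m → ℂ) × ℝ => F (p.1 + circleMap 0 1 p.2 • u) := by fun_prop
    exact h2.smul (h1.smul h3)
  · fun_prop

/-- An entire function vanishing on the zero set of `e^Λ - σ` is divisible by it. -/
theorem exists_eq_expFactor_mul {Λ : Fin m → ℝ} (hΛ : Λ ≠ 0) (σ : ℂ) {F : (Fin m → ℂ) → ℂ}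
    (hF : Differentiable ℂ F) (h : ∀ z, expFactor Λ σ z = 0 → F z = 0) :
    ∃ G : (Fin m → ℂ) → ℂ, Differentiable ℂ G ∧ ∀ z, F z = expFactor Λ σ z * G z := by
  classical
  obtain ⟨k, hk⟩ := Function.ne_iff.1 hΛ
  have hk' : (Λ k : ℂ) ≠ 0 := by exact_mod_cast hk
  obtain ⟨u, hu⟩ : ∃ u : Fin m → ℂ, cdot Λ u = 1 := by
    refine ⟨Pi.single k (1 / Λ k), ?_⟩
    rw [cdot_apply, Finset.sum_eq_single k]
    · rw [Pi.single_eq_same, mul_div_cancel₀ _ hk']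
    · intro j _ hj
      rw [Pi.single_eq_of_ne hj, mul_zero]
    · simp
  set H : (Fin m → ℂ) → ℂ := fun z => deriv (fun ζ : ℂ => F (z + ζ • u)) 0 with hH
  have hHd : Differentiable ℂ H := differentiable_deriv_line hF u
  have hgd := differentiable_expFactor Λ σ
  -- On the zero set the quotient takes the limiting value, the ratio of the derivatives in the
  -- direction `u` with `Λ(u) = 1`.
  refine ⟨fun z => if expFactor Λ σ z = 0 then H z / cexp (cdot Λ z) else F z / expFactor Λ σ z,
    fun z₀ => ?_, fun z => ?_⟩
  swap
  · beta_reduce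
    split_ifs with h0
    · rw [h z h0, h0, zero_mul]
    · rw [mul_div_cancel₀ _ h0]
  by_cases hz₀ : expFactor Λ σ z₀ = 0
  swap
  · have he : ∀ᶠ z in 𝓝 z₀, expFactor Λ σ z ≠ 0 := hgd.continuous.continuousAt.eventually_ne hz₀
    refine ((hF z₀).fun_mul ((hgd z₀).fun_inv hz₀)).congr_of_eventuallyEq ?_
    filter_upwards [he] with z hz
    rw [if_neg hz, div_eq_mul_inv]
  -- Near a zero `z₀` the zero set is the hyperplane `w = 0`. Hadamard's lemma along `u` gives `F =
  -- w K`, and `e^Λ - σ = w · k(w)` with `k(0) = σ ≠ 0`; so the quotient is `K / k(w)` there.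
  set w : (Fin m → ℂ) → ℂ := fun z => cdot Λ z - cdot Λ z₀ with hw
  set K : (Fin m → ℂ) → ℂ := fun z => ∫ t in (0 : ℝ)..1, H (z - w z • u + ((t : ℂ) * w z) • u) with hK
  have hwd : Differentiable ℂ w := by rw [hw]; fun_prop
  have hKd : Differentiable ℂ K := by
    have := hHd.continuous
    have := hwd.continuous
    refine differentiable_intervalIntegral ?_ (fun t => ?_) _ _
    · simp only [Function.uncurry_def]; fun_prop
    · fun_prop
  have hexp : cexp (cdot Λ z₀) = σ := sub_eq_zero.1 hz₀
  have hσ : σ ≠ 0 := hexp ▸ exp_ne_zero _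
  set e : ℂ → ℂ := fun ζ => σ * (cexp ζ - 1) with he
  have hed : Differentiable ℂ e := by rw [he]; fun_prop
  have hkd : Differentiable ℂ (dslope e 0) := by
    rw [← differentiableOn_univ, Complex.differentiableOn_dslope univ_mem]
    exact hed.differentiableOn
  have hk0 : dslope e 0 0 = σ := by
    have h1 : HasDerivAt e (σ * cexp 0) 0 := ((Complex.hasDerivAt_exp 0).sub_const 1).const_mul σ
    rw [dslope_same, h1.deriv, Complex.exp_zero, mul_one]
  have hek : ∀ ζ, e ζ = ζ * dslope e 0 ζ := fun ζ => by
    have := sub_smul_dslope e 0 ζ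
    simp only [sub_zero, smul_eq_mul] at this
    rw [this]; simp [he]
  have hg : ∀ z, expFactor Λ σ z = w z * dslope e 0 (w z) := fun z => by
    rw [← hek]
    simp only [he, hw, expFactor, Complex.exp_sub, hexp]
    field_simp
  have hFK : ∀ z, F z = w z * K z := by
    intro z
    have hπ : expFactor Λ σ (z - w z • u) = 0 := by
      rw [expFactor, map_sub, map_smul, hu]
      simp [hw, hexp]
    have hder : ∀ t : ℝ, HasDerivAt (fun t : ℝ => F (z - w z • u + ((t : ℂ) * w z) • u))
        (w z * H (z - w z • u + ((t : ℂ) * w z) • u)) t := by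
      intro t
      set y := z - w z • u + ((t : ℂ) * w z) • u with hy
      have hd : DifferentiableAt ℂ (fun ζ : ℂ => F (y + ζ • u)) 0 :=
        (hF.comp (by fun_prop : Differentiable ℂ fun ζ : ℂ => y + ζ • u)) 0
      have h1 : HasDerivAt (fun s : ℝ => ((s : ℂ) - t) * w z) (w z) t := by
        have := ((Complex.ofRealCLM.hasDerivAt (x := t)).sub_const (t : ℂ)).mul_const (w z)
        simpa using this
      have h2 := HasDerivAt.comp_of_eq (h₂ := fun ζ : ℂ => F (y + ζ • u)) (x := t)
        (h := fun s : ℝ => ((s : ℂ) - t) * w z) hd.hasDerivAt h1 (by simp)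
      rw [mul_comm]
      refine h2.congr_of_eventuallyEq (Eventually.of_forall fun s => ?_)
      simp only [Function.comp_apply, hy]
      congr 1
      module
    have hint := intervalIntegral.integral_eq_sub_of_hasDerivAt (a := 0) (b := 1)
      (fun t _ => hder t) (by
        have := hHd.continuous
        exact (by fun_prop : Continuous fun t : ℝ =>
          w z * H (z - w z • u + ((t : ℂ) * w z) • u)).intervalIntegrable _ _)
    rw [intervalIntegral.integral_const_mul] at hint
    simp only [ofReal_one, one_mul, ofReal_zero, zero_mul, zero_smul, add_zero, sub_add_cancel] at hint
    rw [h _ hπ, sub_zero] at hint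
    exact hint.symm
  have hev : ∀ᶠ z in 𝓝 z₀, dslope e 0 (w z) ≠ 0 := by
    have : ContinuousAt (fun z => dslope e 0 (w z)) z₀ := (hkd.continuous.comp hwd.continuous).continuousAt
    refine this.eventually_ne ?_
    simp only [hw, sub_self, hk0]
    exact hσ
  have hne₀ : dslope e 0 (w z₀) ≠ 0 := hev.self_of_nhds
  have hcomp : DifferentiableAt ℂ (fun z => dslope e 0 (w z)) z₀ := (hkd.comp hwd) z₀
  refine ((hKd z₀).fun_mul (hcomp.fun_inv hne₀)).congr_of_eventuallyEq ?_
  filter_upwards [hev] with z hz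
  rw [← div_eq_mul_inv]
  by_cases hwz : w z = 0
  · have : cexp (cdot Λ z) = σ := by rw [sub_eq_zero.1 hwz, hexp]
    rw [if_pos (by rw [hg, hwz, zero_mul]), this, hwz, hk0]
    simp [hK, hwz]
  · rw [if_neg (by rw [hg]; exact mul_ne_zero hwz hz), hFK, hg, mul_div_mul_left _ _ hwz]

end Division

/-! ### Integral vectors and contents of weights -/

section Lattice

variable {m n : ℕ}

theorem Finset.exists_sum_mul_eq_gcd {ι : Type*} (s : Finset ι) (f : ι → ℤ) :
    ∃ a : ι → ℤ, ∑ k ∈ s, f k * a k = (s.gcd fun k => (f k).natAbs : ℕ) := by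
  classical
  induction s using Finset.induction_on with
  | empty => exact ⟨0, by simp⟩
  | insert i s hi ih =>
    obtain ⟨a, ha⟩ := ih
    set g : ℕ := s.gcd fun k => (f k).natAbs with hg
    refine ⟨fun k => if k = i then Int.gcdA (f i) g else Int.gcdB (f i) g * a k, ?_⟩
    rw [Finset.sum_insert hi, Finset.gcd_insert]
    simp only [if_true]
    have h1 : ∑ k ∈ s, f k * (if k = i then Int.gcdA (f i) g else Int.gcdB (f i) g * a k) =
        Int.gcdB (f i) g * g := by
      rw [← ha, Finset.mul_sum]
      refine Finset.sum_congr rfl fun k hk => ?_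
      rw [if_neg (by rintro rfl; exact hi hk)]; ring
    rw [h1]
    have := Int.gcd_eq_gcd_ab (f i) g
    rw [mul_comm (Int.gcdB _ _)]
    exact this.symm

theorem content_dvd (D : CoulombData m n) (i : Fin n) (k : Fin m) :
    (D.content i : ℤ) ∣ D.weight i k :=
  Int.natCast_dvd.2 (Finset.gcd_dvd (f := fun k => (D.weight i k).natAbs) (Finset.mem_univ k))

theorem content_dvd_pair (D : CoulombData m n) (i : Fin n) (l : Fin m → ℤ) :
    (D.content i : ℤ) ∣ pair (D.weight i) l :=
  Finset.dvd_sum fun k _ => (content_dvd D i k).mul_right _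

theorem pair_single (ξ : Fin m → ℤ) (k : Fin m) : pair ξ (Pi.single k 1) = ξ k := by
  rw [pair, Finset.sum_eq_single k] <;> simp +contextual

/-- For a nonzero real linear form `Λ` there is a lattice vector on which `Λ` does not vanish and on
which all weights proportional to `Λ` take their minimal value. -/
theorem exists_minimal_direction (D : CoulombData m n) {Λ : Fin m → ℝ} (hΛ : Λ ≠ 0) :
    ∃ l : Fin m → ℤ, ∑ k, Λ k * (l k : ℝ) ≠ 0 ∧
      ∀ i, (∃ r : ℝ, ∀ k, (D.weight i k : ℝ) = r * Λ k) →
        (pair (D.weight i) l).natAbs = D.content i := by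
  have hpair : ∀ i r, (∀ k, (D.weight i k : ℝ) = r * Λ k) → ∀ l : Fin m → ℤ,
      (pair (D.weight i) l : ℝ) = r * ∑ k, Λ k * (l k : ℝ) := by
    intro i r h l
    simp only [pair, Int.cast_sum, Int.cast_mul, h, Finset.mul_sum, mul_assoc]
  by_cases hex : ∃ i, (∃ r : ℝ, ∀ k, (D.weight i k : ℝ) = r * Λ k) ∧ D.weight i ≠ 0
  · obtain ⟨i₀, ⟨r₀, h₀⟩, hne⟩ := hex
    obtain ⟨l, hl⟩ := Finset.exists_sum_mul_eq_gcd Finset.univ (D.weight i₀)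
    change pair (D.weight i₀) l = (D.content i₀ : ℕ) at hl
    have hc₀ : D.content i₀ ≠ 0 := by
      intro h0
      refine hne (funext fun k => ?_)
      have := Finset.gcd_eq_zero_iff.1 h0 k (Finset.mem_univ k)
      simpa using this
    have hc₀' : (D.content i₀ : ℝ) ≠ 0 := by exact_mod_cast hc₀
    have h1 : (D.content i₀ : ℝ) = r₀ * ∑ k, Λ k * (l k : ℝ) := by
      rw [← hpair i₀ r₀ h₀ l, hl]; simp
    have ht : ∑ k, Λ k * (l k : ℝ) ≠ 0 := fun h => by rw [h, mul_zero] at h1; exact hc₀' h1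
    have hr₀ : r₀ ≠ 0 := by rintro rfl; rw [zero_mul] at h1; exact hc₀' h1
    refine ⟨l, ht, fun i ⟨r, h⟩ => ?_⟩
    -- The vector `l` is a Bézout vector of `ξ_{i₀}`, and `Λ / Λ(l)` is the primitive integral
    -- vector `ξ_{i₀} / content`. Every weight proportional to it is its value at `l` times this
    -- vector, so this value divides all its coordinates.
    refine Nat.dvd_antisymm (Finset.dvd_gcd fun k _ => ?_) ?_
    · rw [Int.natAbs_dvd_natAbs]
      obtain ⟨e, he⟩ := content_dvd D i₀ k
      refine ⟨e, ?_⟩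
      have h2 : (D.weight i k : ℝ) = (pair (D.weight i) l : ℝ) * e := by
        have h3 : (D.weight i₀ k : ℝ) = D.content i₀ * e := by rw [he]; push_cast; rfl
        rw [h₀, h1] at h3
        rw [hpair i r h, h]
        have : Λ k = (∑ k, Λ k * (l k : ℝ)) * e := by
          refine mul_left_cancel₀ hr₀ ?_
          rw [h3]; ring
        rw [this]; ring
      exact_mod_cast h2
    · exact Int.natCast_dvd.1 (content_dvd_pair D i l)
  · push Not at hex
    -- All weights proportional to `Λ` are zero here, with content `0`, so any lattice vector on
    -- which `Λ` does not vanish will do.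
    obtain ⟨k, hk⟩ := Function.ne_iff.1 hΛ
    refine ⟨Pi.single k 1, ?_, fun i hi => ?_⟩
    · rw [Finset.sum_eq_single k] <;> simp +contextual
      exact hk
    · have := hex i hi
      rw [pair_single, CoulombData.content, this]
      simp only [Pi.zero_apply, Int.natAbs_zero]
      rw [eq_comm, Finset.gcd_eq_zero_iff]
      simp

end Lattice

/-! ### Zeros of structure constants and zeros of `denom` -/

section Factors

variable {m n : ℕ}

theorem factor_neg_left_of_nonneg {B : Type*} [CommRing B] [Algebra ℂ B] (x : B) {k : ℤ} (hk : 0 ≤ k) :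
    factor x (-k) k = ∏ r ∈ Finset.range k.natAbs, (x - algebraMap ℂ B (r + 1 / 2)) := by
  obtain ⟨a, rfl⟩ := Int.eq_ofNat_of_zero_le hk
  rcases a.eq_zero_or_pos with rfl | ha
  · simp [factor]
  rw [factor, if_neg (by omega), if_pos (by omega)]
  simp only [Int.natAbs_neg, Int.natAbs_natCast, min_self]
  rw [← Finset.prod_range_reflect]
  refine Finset.prod_congr rfl fun j hj => ?_
  have hj' := Finset.mem_range.1 hj
  rw [sub_eq_add_neg x, ← map_neg]; congr 2
  have : ((a - 1 - j : ℕ) : ℂ) = a - 1 - j := by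
    rw [Nat.cast_sub (by omega), Nat.cast_sub (by omega)]; simp
  rw [this]; push_cast; ring

theorem factor_neg_left_of_nonpos {B : Type*} [CommRing B] [Algebra ℂ B] (x : B) {k : ℤ} (hk : k ≤ 0) :
    factor x (-k) k = ∏ r ∈ Finset.range k.natAbs, (x + algebraMap ℂ B (r + 1 / 2)) := by
  obtain ⟨a, ha⟩ := Int.eq_ofNat_of_zero_le (neg_nonneg.2 hk)
  obtain rfl : k = -(a : ℤ) := by omega
  rw [factor, if_pos (by omega)]
  simp only [Int.natAbs_neg, neg_neg, Int.natAbs_natCast, min_self]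
  rw [← Finset.prod_range_reflect]
  refine Finset.prod_congr rfl fun j hj => ?_
  have hj' := Finset.mem_range.1 hj
  congr 2
  have : ((a - 1 - j : ℕ) : ℂ) = a - 1 - j := by
    rw [Nat.cast_sub (by omega), Nat.cast_sub (by omega)]; simp
  rw [this]; push_cast; ring

/-- In a single form: the roots are `r + 1/2` times the sign of `k`. -/
theorem factor_neg_left {B : Type*} [CommRing B] [Algebra ℂ B] (x : B) (k : ℤ) :
    ∃ s : ℤ, (s = 1 ∨ s = -1) ∧ k = s * k.natAbs ∧
      factor x (-k) k = ∏ r ∈ Finset.range k.natAbs, (x - algebraMap ℂ B (s * (r + 1 / 2))) := by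
  rcases le_total 0 k with hk | hk
  · refine ⟨1, Or.inl rfl, by omega, ?_⟩
    rw [factor_neg_left_of_nonneg x hk]; simp
  · refine ⟨-1, Or.inr rfl, by omega, ?_⟩
    rw [factor_neg_left_of_nonpos x hk]
    refine Finset.prod_congr rfl fun r _ => ?_
    rw [sub_eq_add_neg x, ← map_neg]; congr 2; push_cast; ring

theorem eval_factor {k : ℕ} (z : Fin k → ℂ) (f : CPoly k) (a b : ℤ) :
    MvPolynomial.eval z (factor f a b) = factor (MvPolynomial.eval z f) a b := by
  have := map_factor (MvPolynomial.aeval z : CPoly k →ₐ[ℂ] ℂ) f a b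
  simpa using this

theorem eval_form (D : CoulombData m n) (i : Fin n) (z : Fin m → ℂ) :
    MvPolynomial.eval z (D.form i) = ∑ k, (D.weight i k : ℂ) * z k + D.flavor i := by
  simp [CoulombData.form]

theorem sum_mul_toReal (ξ l : Fin m → ℤ) :
    ∑ k, (ξ k : ℂ) * cpx (toReal l) k = (pair ξ l : ℂ) := by
  simp [pair, toReal]

/-- The factor of one weight in `denom`. -/
noncomputable def AbelianCoulomb.CoulombData.denomFactor (D : CoulombData m n) (i : Fin n) (z : Fin m → ℂ) : ℂ :=
  open Classical in
  ∏ q ∈ (Finset.range (D.content i)).filter fun q => |(D.primFlavor i q).re| < 1 / 2,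
    (Complex.exp (2 * Real.pi * ((∑ k, (D.weight i k : ℂ) * z k) / D.content i)) +
      Complex.exp (2 * Real.pi * Complex.I * D.primFlavor i q))

theorem denom_eq_prod (D : CoulombData m n) (z : Fin m → ℂ) :
    D.denom z = ∏ i, D.denomFactor i z := rfl

theorem differentiable_denomFactor (D : CoulombData m n) (i : Fin n) :
    Differentiable ℂ (D.denomFactor i) := by
  unfold CoulombData.denomFactor
  refine differentiable_finsetProd _ _ fun q => ?_
  simp only [div_eq_mul_inv]
  fun_prop

theorem differentiable_denom (D : CoulombData m n) : Differentiable ℂ D.denom :=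
  differentiable_finsetProd _ _ fun i => differentiable_denomFactor D i

/-- `denom` is periodic under `iℤ^m`. -/
theorem denom_add_I (D : CoulombData m n) (l : Fin m → ℤ) (z : Fin m → ℂ) :
    D.denom (z + I • cpx (toReal l)) = D.denom z := by
  rw [denom_eq_prod, denom_eq_prod]
  refine Finset.prod_congr rfl fun i _ => ?_
  unfold CoulombData.denomFactor
  refine Finset.prod_congr rfl fun q hq => ?_
  congr 1
  obtain ⟨e, he⟩ := content_dvd_pair D i l
  have hc : (D.content i : ℂ) ≠ 0 := by
    have := (Finset.mem_filter.1 hq).1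
    rw [Finset.mem_range] at this
    exact_mod_cast (Nat.ne_of_gt (Nat.zero_lt_of_lt this))
  rw [Complex.exp_eq_exp_iff_exists_int]
  refine ⟨e, ?_⟩
  have h1 : ∑ k, (D.weight i k : ℂ) * (z + I • cpx (toReal l)) k =
      ∑ k, (D.weight i k : ℂ) * z k + I * (D.content i * e) := by
    have : ∑ k, (D.weight i k : ℂ) * (z + I • cpx (toReal l)) k =
      ∑ k, (D.weight i k : ℂ) * z k + I * ∑ k, (D.weight i k : ℂ) * cpx (toReal l) k := by
      rw [Finset.mul_sum, ← Finset.sum_add_distrib]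
      refine Finset.sum_congr rfl fun k _ => ?_
      simp only [Pi.add_apply, Pi.smul_apply, smul_eq_mul]; ring
    rw [this, sum_mul_toReal, he]; push_cast; rfl
  rw [h1]
  field_simp

/-- A zero in the open strip of the factor of a weight in `r^{-λ} r^λ`, where `ξ(λ) = ±k` is minimal,
is a zero of the factor of that weight in `denom`. -/
theorem denomFactor_eq_zero (D : CoulombData m n) (i : Fin n) {z : Fin m → ℂ} {s : ℤ}
    (hs : s = 1 ∨ s = -1) {r : ℕ} (hr : r < D.content i)
    (h : I * (∑ k, (D.weight i k : ℂ) * z k) + D.flavor i = s * (r + 1 / 2))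
    {t : ℝ} (ht : -1 < t) (ht' : t < 0)
    (him : (∑ k, (D.weight i k : ℂ) * z k).im = t * (s * D.content i)) : D.denomFactor i z = 0 := by
  set y := ∑ k, (D.weight i k : ℂ) * z k with hy
  have hc : (0 : ℝ) < D.content i := by exact_mod_cast Nat.zero_lt_of_lt hr
  have hc' : (D.content i : ℂ) ≠ 0 := by exact_mod_cast hc.ne'
  have hb : D.flavor i = s * (r + 1 / 2) - I * y := by linear_combination h
  have hbre : (D.flavor i).re = s * (r + 1 / 2) + t * (s * D.content i) := by
    rw [hb, ← him]
    have : ((s : ℂ) * (r + 1 / 2)) = ((s * (r + 1 / 2) : ℝ) : ℂ) := by push_cast; rfl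
    rw [this]
    simp
  have hre : ∀ q : ℕ, (D.primFlavor i q).re =
      ((D.flavor i).re + (D.content i - 1) / 2 - q) / D.content i := by
    intro q
    have : D.primFlavor i q = (D.flavor i + (((D.content i - 1) / 2 - q : ℝ) : ℂ)) / (D.content i : ℝ) := by
      rw [CoulombData.primFlavor]; push_cast; ring
    rw [this, div_ofReal_re, add_re, ofReal_re]; ring
  unfold CoulombData.denomFactor
  -- The congruence of the flavor modulo `ℤ` makes the two exponentials cancel. The formula for its
  -- real part, with `-1 < t < 0`, is exactly `|Re| < 1/2`.
  have key : ∀ q : ℕ, ∀ e : ℤ, (q : ℤ) < D.content i →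
      (D.primFlavor i q).re = s * (t + 1 / 2) →
      D.primFlavor i q = -I * y / D.content i + 1 / 2 + e →
      ∃ q ∈ (Finset.range (D.content i)).filter (fun q => |(D.primFlavor i q).re| < 1 / 2),
      Complex.exp (2 * Real.pi * (y / D.content i)) +
      Complex.exp (2 * Real.pi * Complex.I * D.primFlavor i q) = 0 := by
    intro q e hq h1 h2
    refine ⟨q, Finset.mem_filter.2 ⟨Finset.mem_range.2 (by exact_mod_cast hq), ?_⟩, ?_⟩
    · rw [h1, abs_lt]
      rcases hs with rfl | rfl <;> push_cast <;> constructor <;> linarith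
    · have : 2 * Real.pi * I * D.primFlavor i q =
          2 * Real.pi * (y / D.content i) + Real.pi * I + e * (2 * Real.pi * I) := by
        rw [h2]
        linear_combination (-2 * Real.pi * (y / D.content i)) * I_mul_I
      rw [this, Complex.exp_periodic.int_mul, Complex.exp_add, Complex.exp_pi_mul_I]
      ring
  -- For `s = 1` the root numbered `r` belongs to `q = r`. For `s = -1` the order is reversed, `q =
  -- content - 1 - r`, and the congruence holds with the integer `-1`.
  have hfin : ∃ q ∈ (Finset.range (D.content i)).filter (fun q => |(D.primFlavor i q).re| < 1 / 2),
      Complex.exp (2 * Real.pi * (y / D.content i)) +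
      Complex.exp (2 * Real.pi * Complex.I * D.primFlavor i q) = 0 := by
    rcases hs with rfl | rfl
    · refine key r 0 (by exact_mod_cast hr) ?_ ?_
      · rw [hre, hbre, div_eq_iff hc.ne']; push_cast; ring
      · rw [CoulombData.primFlavor, hb, div_eq_iff hc']
        push_cast
        field_simp
        ring
    · have hq : ((D.content i - 1 - r : ℕ) : ℂ) = D.content i - 1 - r := by
        rw [Nat.cast_sub (by omega), Nat.cast_sub (by omega)]; simp
      have hq' : ((D.content i - 1 - r : ℕ) : ℝ) = D.content i - 1 - r := by
        rw [Nat.cast_sub (by omega), Nat.cast_sub (by omega)]; simp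
      refine key (D.content i - 1 - r) (-1) (by omega) ?_ ?_
      · rw [hre, hbre, hq', div_eq_iff hc.ne']; push_cast; ring
      · rw [CoulombData.primFlavor, hb, hq, div_eq_iff hc']
        push_cast
        field_simp
        ring
  obtain ⟨q, hq, h0⟩ := hfin
  refine Finset.prod_eq_zero (i := q) ?_ h0
  convert hq

end Factors

theorem meromorphicOrderAt_pos_of_eq_zero {f : ℂ → ℂ} (hf : Differentiable ℂ f) {a : ℂ} (h : f a = 0) :
    0 < meromorphicOrderAt f a := by
  rw [← tendsto_zero_iff_meromorphicOrderAt_pos (hf.analyticAt a).meromorphicAt]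
  have := hf.continuous.tendsto a
  rw [h] at this
  exact this.mono_left nhdsWithin_le_nhds

theorem meromorphicOrderAt_eq_zero_of_ne_zero {f : ℂ → ℂ} (hf : Differentiable ℂ f) {a : ℂ}
    (h : f a ≠ 0) : meromorphicOrderAt f a = 0 := by
  rw [← tendsto_ne_zero_iff_meromorphicOrderAt_eq_zero (hf.analyticAt a).meromorphicAt]
  exact ⟨f a, h, (hf.continuous.tendsto a).mono_left nhdsWithin_le_nhds⟩

theorem WithTop.one_le_of_pos {x : WithTop ℤ} (h : 0 < x) : 1 ≤ x := by
  induction x using WithTop.recTopCoe with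
  | top => exact le_top
  | coe a =>
    have : (0 : ℤ) < a := by exact_mod_cast h
    exact_mod_cast this

/-! ### Poles allowed by the trace condition -/

section Poles

variable {m n : ℕ} {D : CoulombData m n}

theorem line_add_I (x l : RealLie m) (ζ w : ℂ) :
    cpx x + (ζ + w) • cpx l = (cpx x + ζ • cpx l) + w • cpx l := by
  rw [add_smul, add_assoc]

theorem sum_weight_line (D : CoulombData m n) (i : Fin n) (x : RealLie m) (l : Fin m → ℤ) (ζ : ℂ) :
    ∑ k, (D.weight i k : ℂ) * (cpx x + ζ • cpx (toReal l)) k =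
      ((∑ k, D.weight i k * x k : ℝ) : ℂ) + ζ * (pair (D.weight i) l : ℂ) := by
  rw [← sum_mul_toReal, Finset.mul_sum]
  push_cast
  rw [← Finset.sum_add_distrib]
  refine Finset.sum_congr rfl fun k _ => ?_
  simp only [Pi.add_apply, Pi.smul_apply, smul_eq_mul, cpx_apply]; ring

theorem eval_form_I (D : CoulombData m n) (i : Fin n) (z : Fin m → ℂ) :
    MvPolynomial.eval (I • z) (D.form i) = I * (∑ k, (D.weight i k : ℂ) * z k) + D.flavor i := by
  rw [eval_form, Finset.mul_sum]
  congr 1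
  refine Finset.sum_congr rfl fun k _ => ?_
  simp only [Pi.smul_apply, smul_eq_mul]; ring

/-- Where the factor does not vanish its order is `0`. Where it does, its roots along the line are
distinct, so the order is `1`, and minimality of `ξ(l)` makes the factor of `denom` vanish as well.
-/
theorem order_factor_le (D : CoulombData m n) (i : Fin n) (x : RealLie m) (l : Fin m → ℤ) {ζ₁ : ℂ}
    (h1 : -1 < ζ₁.im) (h2 : ζ₁.im < 0)
    (h : MvPolynomial.eval (I • (cpx x + ζ₁ • cpx (toReal l)))
        (factor (D.form i) (-pair (D.weight i) l) (pair (D.weight i) l)) ≠ 0 ∨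
      (pair (D.weight i) l).natAbs = D.content i) :
    meromorphicOrderAt (fun ζ => MvPolynomial.eval (I • (cpx x + ζ • cpx (toReal l)))
        (factor (D.form i) (-pair (D.weight i) l) (pair (D.weight i) l))) ζ₁ ≤
      meromorphicOrderAt (fun ζ => D.denomFactor i (cpx x + ζ • cpx (toReal l))) ζ₁ := by
  set k := pair (D.weight i) l with hk
  have hline : Differentiable ℂ fun ζ : ℂ => cpx x + ζ • cpx (toReal l) := by fun_prop
  have hdd : Differentiable ℂ fun ζ : ℂ => D.denomFactor i (cpx x + ζ • cpx (toReal l)) :=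
    (differentiable_denomFactor D i).comp hline
  have hPd : Differentiable ℂ fun ζ : ℂ => MvPolynomial.eval (I • (cpx x + ζ • cpx (toReal l)))
      (factor (D.form i) (-k) k) :=
    (ExpQuotient.differentiable_eval_I _).comp hline
  by_cases hP : MvPolynomial.eval (I • (cpx x + ζ₁ • cpx (toReal l))) (factor (D.form i) (-k) k) = 0
  swap
  · rw [meromorphicOrderAt_eq_zero_of_ne_zero hPd hP]
    exact (hdd.analyticAt ζ₁).meromorphicOrderAt_nonneg
  have hc := h.resolve_left (not_not.2 hP)
  obtain ⟨s, hs, hks, -⟩ := factor_neg_left (0 : ℂ) k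
  have hfac : ∀ ζ : ℂ, MvPolynomial.eval (I • (cpx x + ζ • cpx (toReal l))) (factor (D.form i) (-k) k) =
      ∏ r ∈ Finset.range k.natAbs, (I * (((∑ k, D.weight i k * x k : ℝ) : ℂ) + ζ * k) + D.flavor i -
        s * (r + 1 / 2)) := by
    intro ζ
    rw [eval_factor]
    obtain ⟨s', hs', hks', hf⟩ := factor_neg_left
      (MvPolynomial.eval (I • (cpx x + ζ • cpx (toReal l))) (D.form i)) k
    rw [hf, eval_form_I, sum_weight_line, ← hk]
    rcases eq_or_ne k 0 with h0 | h0
    · rw [h0]; simp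
    · have : s' = s := by
        have h0' : (k.natAbs : ℤ) ≠ 0 := by omega
        exact mul_right_cancel₀ h0' (hks'.symm.trans hks)
      rw [this]; rfl
  rw [hfac, Finset.prod_eq_zero_iff] at hP
  obtain ⟨r, hr, hr0⟩ := hP
  have hkpos : k ≠ 0 := by
    rintro h0
    rw [h0] at hr
    simp at hr
  have hkc : (k : ℂ) ≠ 0 := by exact_mod_cast hkpos
  have hrr := Finset.mem_range.1 hr
  have hone : meromorphicOrderAt (fun ζ => MvPolynomial.eval (I • (cpx x + ζ • cpx (toReal l)))
      (factor (D.form i) (-k) k)) ζ₁ = ((1 : ℤ) : WithTop ℤ) := by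
    rw [meromorphicOrderAt_eq_int_iff (hPd.analyticAt ζ₁).meromorphicAt]
    refine ⟨fun ζ => I * k * ∏ r' ∈ (Finset.range k.natAbs).erase r,
      (I * (((∑ k, D.weight i k * x k : ℝ) : ℂ) + ζ * k) + D.flavor i - s * (r' + 1 / 2)), ?_, ?_, ?_⟩
    · have : Differentiable ℂ fun ζ : ℂ => I * k * ∏ r' ∈ (Finset.range k.natAbs).erase r,
          (I * (((∑ k, D.weight i k * x k : ℝ) : ℂ) + ζ * k) + D.flavor i - s * (r' + 1 / 2)) := by
        refine (differentiable_const _).fun_mul ?_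
        exact Differentiable.fun_finsetProd fun r' _ => by fun_prop
      exact this.analyticAt ζ₁
    · refine mul_ne_zero (mul_ne_zero I_ne_zero hkc) (Finset.prod_ne_zero_iff.2 fun r' hr' h0 => ?_)
      have h3 : (s : ℂ) * (r' - r) = 0 := by linear_combination hr0 - h0
      rcases mul_eq_zero.1 h3 with h3 | h3
      · rcases hs with rfl | rfl <;> norm_num at h3
      · rw [sub_eq_zero] at h3
        exact (Finset.mem_erase.1 hr').1 (by exact_mod_cast h3)
    · refine Eventually.of_forall fun ζ => ?_
      rw [hfac, ← Finset.mul_prod_erase _ _ hr, zpow_one, smul_eq_mul, ← mul_assoc]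
      congr 1
      linear_combination hr0
  rw [hone]
  refine WithTop.one_le_of_pos (meromorphicOrderAt_pos_of_eq_zero hdd ?_)
  have hcs : (k : ℂ) = s * D.content i := by
    rw [← hc, ← Int.cast_natCast, ← Int.cast_mul, ← hks]
  refine denomFactor_eq_zero D i hs (r := r) (hc ▸ hrr) ?_ h1 h2 ?_
  · rw [sum_weight_line, ← hk]
    linear_combination hr0
  · rw [sum_weight_line, ← hk, hcs]
    have : ((s : ℂ) * D.content i) = ((s * D.content i : ℝ) : ℂ) := by push_cast; rfl
    rw [this]
    simp

/-- The trace condition up to multiples of a polynomial. -/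
def WeakTraceIdentity (D : CoulombData m n) (ζ : Fin m → ℂ) (V : RealLie m → ℂ) : Prop :=
  ∀ l : Fin m → ℤ, l ≠ 0 → ∃ q : CPoly m, q ≠ 0 ∧ ExpQuotient.StripNonvanishing q (toReal l) ∧
    MvShiftIdentity V (toReal l) (CoulombBranch.phase ζ l) (q * D.structConst (-l) l)

theorem pair_neg (ξ l : Fin m → ℤ) : pair ξ (-l) = -pair ξ l := by simp [pair]

theorem structConst_neg_left (D : CoulombData m n) (l : Fin m → ℤ) :
    D.structConst (-l) l = ∏ i, factor (D.form i) (-pair (D.weight i) l) (pair (D.weight i) l) := by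
  simp only [CoulombData.structConst, pair_neg]

theorem structConst_neg_left_ne_zero (D : CoulombData m n) (l : Fin m → ℤ) :
    D.structConst (-l) l ≠ 0 := by
  rw [structConst_neg_left]
  refine Finset.prod_ne_zero_iff.2 fun i _ => ?_
  obtain ⟨s, -, hk, hf⟩ := factor_neg_left (D.form i) (pair (D.weight i) l)
  rw [hf]
  refine Finset.prod_ne_zero_iff.2 fun r hr h0 => ?_
  have h1 := congrArg (MvPolynomial.eval fun k => ((0 : ℤ) : ℂ)) h0
  have h2 := congrArg (MvPolynomial.eval fun k => (l k : ℂ)) h0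
  simp only [map_sub, eval_form, MvPolynomial.algebraMap_eq, MvPolynomial.eval_C, map_zero,
    Int.cast_zero, mul_zero, Finset.sum_const_zero] at h1 h2
  have h3 : (pair (D.weight i) l : ℂ) = 0 := by
    have : (pair (D.weight i) l : ℂ) = ∑ k, (D.weight i k : ℂ) * l k := by simp [pair]
    rw [this]; linear_combination h2 - h1
  have h4 : pair (D.weight i) l = 0 := by exact_mod_cast h3
  rw [h4] at hr
  simp at hr

theorem phase_ne_zero (ζ : Fin m → ℂ) (l : Fin m → ℤ) : CoulombBranch.phase ζ l ≠ 0 := exp_ne_zero _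

theorem phase_zero (ζ : Fin m → ℂ) : CoulombBranch.phase ζ 0 = 1 := by simp [CoulombBranch.phase]

theorem toReal_ne_zero {l : Fin m → ℤ} (hl : l ≠ 0) : toReal l ≠ 0 := by
  obtain ⟨k, hk⟩ := Function.ne_iff.1 hl
  intro h
  have := congrArg (fun v : RealLie m => v k) h
  simp only [toReal, PiLp.zero_apply, Int.cast_eq_zero] at this
  exact hk this

theorem cpx_toReal_smul (r : ℤ) (l : Fin m → ℤ) : cpx (toReal (r • l)) = (r : ℂ) • cpx (toReal l) := by
  ext k; simp [toReal]

variable {κ : Type*} [Fintype κ] {V : RealLie m → ℂ} {N : (Fin m → ℂ) → ℂ} {Λ : κ → Fin m → ℝ}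
  {σ : κ → ℂ} {ζ : Fin m → ℂ}

theorem WeakTraceIdentity.quasi_periodic (h : ExpQuotient V N Λ σ) (hT : WeakTraceIdentity D ζ V)
    (l : Fin m → ℤ) (z : Fin m → ℂ) :
    N (z + I • cpx (toReal l)) * expDen Λ σ z =
      CoulombBranch.phase ζ l * N z * expDen Λ σ (z + I • cpx (toReal l)) := by
  rcases eq_or_ne l 0 with rfl | hl
  · have : cpx (toReal (0 : Fin m → ℤ)) = 0 := by ext k; simp [toReal]
    rw [this, smul_zero, add_zero, phase_zero, one_mul]
  · obtain ⟨q, hq, -, hm⟩ := hT l hl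
    exact h.quasi_periodic (toReal_ne_zero hl) (mul_ne_zero hq (structConst_neg_left_ne_zero D l)) hm z

/-- If `F` did not vanish at `z₀`, then `denom · N / expDen` would have a pole along a generic line
through the hyperplane `Λ_a = Λ_a(z₀)` in a minimal direction `l`. Quasi-periodicity moves this pole
into `-1 < Im ≤ 0`. The weights not proportional to `Λ_a` are nonzero there by genericity, and the
proportional ones are controlled by `order_factor_le`; so there is no pole. -/
theorem WeakTraceIdentity.numerator_eq_zero (h : ExpQuotient V N Λ σ) (hT : WeakTraceIdentity D ζ V)
    {a : κ} {S : Finset κ} (haS : a ∉ S) {F : (Fin m → ℂ) → ℂ} (hF : Differentiable ℂ F)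
    (hFeq : ∀ z, D.denom z * N z = F z * ∏ j ∈ S, expFactor (Λ j) (σ j) z) {z₀ : Fin m → ℂ}
    (hz₀ : expFactor (Λ a) (σ a) z₀ = 0) : F z₀ = 0 := by
  classical
  by_contra hne
  obtain ⟨l, ht, hmin⟩ := exists_minimal_direction D (h.lam_ne a)
  set A := cdot (Λ a) z₀ with hA
  set t := ∑ k, Λ a k * (l k : ℝ) with ht_def
  have htc : (t : ℂ) ≠ 0 := by exact_mod_cast ht
  have hl : l ≠ 0 := by rintro rfl; simp [ht_def] at ht
  have hL := toReal_ne_zero hl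
  -- The integer that brings the imaginary part of the crossing parameter into `(-1, 0]`.
  set r : ℤ := -⌈A.im / t⌉ with hr
  obtain ⟨q, hq0, hq, hm⟩ := hT l hl
  have hP0 := structConst_neg_left_ne_zero D l
  have hΛl : cdot (Λ a) (cpx (toReal l)) = t := by
    rw [cdot_cpx]; simp [toReal, ht_def]
  -- The parameter at which the line through `z` in the direction `l` meets the hyperplane `Λ_a =
  -- A`.
  set ζ₀ : (Fin m → ℂ) → ℂ := fun z => (A - cdot (Λ a) z) / t with hζ₀
  have hζd : Differentiable ℂ ζ₀ := by
    rw [hζ₀]; simp only [div_eq_mul_inv]; fun_prop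
  -- a generic real point
  obtain ⟨x, hxD, hxQ, hxF, hxP⟩ : ∃ x : RealLie m, expDen Λ σ (cpx x) ≠ 0 ∧
      MvPolynomial.eval (I • cpx x) (q * D.structConst (-l) l) ≠ 0 ∧
      F (cpx x + ζ₀ (cpx x) • cpx (toReal l)) ≠ 0 ∧
      ∀ i, (¬ ∃ r : ℝ, ∀ k, (D.weight i k : ℝ) = r * Λ a k) →
        MvPolynomial.eval (I • (cpx x + (ζ₀ (cpx x) + r * I) • cpx (toReal l)))
          (factor (D.form i) (-pair (D.weight i) l) (pair (D.weight i) l)) ≠ 0 := by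
    have d1 := differentiable_expDen Λ σ
    have d2 := ExpQuotient.differentiable_eval_I (q * D.structConst (-l) l)
    have d3 : Differentiable ℂ fun z => F (z + ζ₀ z • cpx (toReal l)) := by fun_prop
    have d4 : ∀ i, Differentiable ℂ fun z => MvPolynomial.eval
        (I • (z + (ζ₀ z + r * I) • cpx (toReal l)))
          (factor (D.form i) (-pair (D.weight i) l) (pair (D.weight i) l)) := fun i =>
      (ExpQuotient.differentiable_eval_I _).comp
        (by fun_prop : Differentiable ℂ fun z => z + (ζ₀ z + r * I) • cpx (toReal l))
    have n4 : ∃ z, ∏ i ∈ Finset.univ.filter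
        (fun i => ¬ ∃ r : ℝ, ∀ k, (D.weight i k : ℝ) = r * Λ a k),
        MvPolynomial.eval (I • (z + (ζ₀ z + r * I) • cpx (toReal l)))
          (factor (D.form i) (-pair (D.weight i) l) (pair (D.weight i) l)) ≠ 0 := by
      refine ExpQuotient.exists_prod_ne_zero _ _ d4 fun i hi => ?_
      have hi' := (Finset.mem_filter.1 hi).2
      by_contra hcon
      push Not at hcon
      obtain ⟨s, -, -, hf⟩ := factor_neg_left (D.form i) (pair (D.weight i) l)
      have := ExpQuotient.exists_prod_ne_zero (Finset.range (pair (D.weight i) l).natAbs)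
        (fun r' z => MvPolynomial.eval (I • (z + (ζ₀ z + r * I) • cpx (toReal l)))
          (D.form i - algebraMap ℂ (CPoly m) (s * (r' + 1 / 2)))) (fun r' =>
          (ExpQuotient.differentiable_eval_I _).comp
          (by fun_prop : Differentiable ℂ fun z => z + (ζ₀ z + r * I) • cpx (toReal l)))
        (fun r' _ => ?_)
      · obtain ⟨z, hz⟩ := this
        refine hz ?_
        rw [← map_prod, ← hf]
        exact hcon z
      -- An affine factor that vanishes on the whole translated hyperplane has its weight
      -- proportional to `Λ_a`; comparing the values at `0` and at a unit vector gives the ratio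
      -- `ξ(l) / t`.
      · by_contra hcon'
        push Not at hcon'
        refine hi' ⟨pair (D.weight i) l / t, fun k => ?_⟩
        have e : ∀ z, ∑ k, (D.weight i k : ℂ) * (z + (ζ₀ z + r * I) • cpx (toReal l)) k =
            ∑ k, (D.weight i k : ℂ) * z k + (ζ₀ z + r * I) * pair (D.weight i) l := by
          intro z
          rw [← sum_mul_toReal, Finset.mul_sum, ← Finset.sum_add_distrib]
          refine Finset.sum_congr rfl fun k _ => ?_
          simp only [Pi.add_apply, Pi.smul_apply, smul_eq_mul]; ring
        have h1 := hcon' 0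
        have h2 := hcon' (Pi.single k 1)
        simp only [map_sub, eval_form_I, MvPolynomial.algebraMap_eq, MvPolynomial.eval_C, e] at h1 h2
        have h3 : ∑ k', (D.weight i k' : ℂ) * (Pi.single k 1 : Fin m → ℂ) k' = D.weight i k := by
          rw [Finset.sum_eq_single k] <;> simp +contextual
        have h4 : ζ₀ (Pi.single k 1) = (A - Λ a k) / t := by
          simp only [hζ₀, cdot_apply]
          rw [Finset.sum_eq_single k] <;> simp +contextual
        have h5 : ζ₀ 0 = A / t := by simp [hζ₀]
        rw [h3, h4] at h2
        rw [h5] at h1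
        simp only [Pi.zero_apply, mul_zero, Finset.sum_const_zero] at h1
        have h6 : I * ((D.weight i k : ℂ) - pair (D.weight i) l / t * Λ a k) = 0 := by
          linear_combination h2 - h1
        have h7 := sub_eq_zero.1 ((mul_eq_zero.1 h6).resolve_left I_ne_zero)
        exact_mod_cast h7
    have n3 : ∃ z, F (z + ζ₀ z • cpx (toReal l)) ≠ 0 := by
      refine ⟨z₀, ?_⟩
      have : ζ₀ z₀ = 0 := by simp [hζ₀, hA]
      rwa [this, zero_smul, add_zero]
    obtain ⟨x, hx⟩ := (dense_real_ne_zero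
      (((d1.mul d2).mul d3).mul (differentiable_finsetProd _ _ d4))
      (exists_mul_ne_zero ((d1.mul d2).mul d3) (differentiable_finsetProd _ _ d4)
        (exists_mul_ne_zero (d1.mul d2) d3
          (exists_mul_ne_zero d1 d2 h.exists_expDen_ne_zero
            (ExpQuotient.exists_eval_I_ne_zero (mul_ne_zero hq0 hP0))) n3) n4)).nonempty
    simp only [Set.mem_ofPred_eq, Pi.mul_apply, mul_ne_zero_iff] at hx
    refine ⟨x, hx.1.1.1, hx.1.1.2, hx.1.2, fun i hi => ?_⟩
    exact Finset.prod_ne_zero_iff.1 hx.2 i (Finset.mem_filter.2 ⟨Finset.mem_univ i, hi⟩)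
  set w₀ := ζ₀ (cpx x) with hw₀
  set w₁ := w₀ + r * I with hw₁
  have him : w₁.im = A.im / t + r := by
    have : w₀ = (A - ((∑ k, Λ a k * x k : ℝ) : ℂ)) / (t : ℂ) := by
      rw [hw₀, hζ₀, ← cdot_cpx]
    rw [hw₁, this, add_im, div_ofReal_im, sub_im, ofReal_im]
    simp
  have him1 : -1 < w₁.im := by
    rw [him, hr]; push_cast
    have := Int.ceil_lt_add_one (A.im / t); linarith
  have him0 : w₁.im ≤ 0 := by
    rw [him, hr]; push_cast
    have := Int.le_ceil (A.im / t); linarith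
  have hLQ := h.lineQuotient hL hxD
  have hline : Differentiable ℂ fun ζ : ℂ => cpx x + ζ • cpx (toReal l) := by fun_prop
  set dn : ℂ → ℂ := fun ζ => D.denom (cpx x + ζ • cpx (toReal l)) with hdn
  have hdnd : Differentiable ℂ dn := (differentiable_denom D).comp hline
  set W : ℂ → ℂ := fun ζ => N (cpx x + ζ • cpx (toReal l)) / expDen Λ σ (cpx x + ζ • cpx (toReal l))
    with hW
  have hWm : ∀ z, MeromorphicAt W z := hLQ.meromorphicAt
  -- the pole at `w₀`
  have hpole : meromorphicOrderAt (fun ζ => dn ζ * W ζ) w₀ < 0 := by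
    by_contra hnn
    rw [not_lt] at hnn
    set g : ℂ → ℂ := fun ζ => expFactor (Λ a) (σ a) (cpx x + ζ • cpx (toReal l)) with hg
    have hgd : Differentiable ℂ g := (differentiable_expFactor _ _).comp hline
    set rest : ℂ → ℂ := fun ζ => ∏ j ∈ Sᶜ.erase a,
      expFactor (Λ j) (σ j) (cpx x + ζ • cpx (toReal l)) with hrest
    have hrd : Differentiable ℂ rest :=
      (differentiable_finsetProd _ _ fun j => differentiable_expFactor (Λ j) (σ j)).comp hline
    set f : ℂ → ℂ := fun ζ => F (cpx x + ζ • cpx (toReal l)) with hf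
    have hfd : Differentiable ℂ f := hF.comp hline
    -- The factors indexed by `S` have already been divided out, so `F` equals `dn W` times the
    -- remaining ones. Among them `g` vanishes at `w₀` and `F` does not, which forces a pole of `dn
    -- W`.
    have hev : (fun ζ => dn ζ * W ζ * (g ζ * rest ζ)) =ᶠ[𝓝[≠] w₀] f := by
      filter_upwards [hLQ.eventually_den_ne_zero w₀] with ζ hζ
      have h1 : expDen Λ σ (cpx x + ζ • cpx (toReal l)) =
          (∏ j ∈ S, expFactor (Λ j) (σ j) (cpx x + ζ • cpx (toReal l))) * (g ζ * rest ζ) := by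
        rw [hg, hrest, Finset.mul_prod_erase Sᶜ
          (fun j => expFactor (Λ j) (σ j) (cpx x + ζ • cpx (toReal l))) (Finset.mem_compl.2 haS),
          Finset.prod_mul_prod_compl]
        rfl
      have h2 := hFeq (cpx x + ζ • cpx (toReal l))
      simp only [hdn, hW, hf]
      rw [mul_div_assoc', h2, div_mul_eq_mul_div, div_eq_iff hζ, h1]
      ring
    have h1 := meromorphicOrderAt_congr hev
    rw [meromorphicOrderAt_eq_zero_of_ne_zero hfd hxF,
      fun_meromorphicOrderAt_mul ((hdnd.analyticAt w₀).meromorphicAt.fun_mul (hWm w₀))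
        ((hgd.analyticAt w₀).meromorphicAt.fun_mul (hrd.analyticAt w₀).meromorphicAt),
      fun_meromorphicOrderAt_mul (hgd.analyticAt w₀).meromorphicAt (hrd.analyticAt w₀).meromorphicAt]
      at h1
    have hga : 0 < meromorphicOrderAt g w₀ := by
      refine meromorphicOrderAt_pos_of_eq_zero hgd ?_
      have : cdot (Λ a) (cpx x + w₀ • cpx (toReal l)) = A := by
        rw [map_add, map_smul, hΛl, smul_eq_mul, hw₀, hζ₀]
        field_simp; ring
      simp only [hg]
      rw [expFactor, this]
      exact hz₀
    have hra := (hrd.analyticAt w₀).meromorphicOrderAt_nonneg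
    exact (hga.trans_le ((le_add_of_nonneg_right hra).trans (le_add_of_nonneg_left hnn))).ne h1.symm
  -- quasi-periodicity moves it to `w₁`
  have hmove : meromorphicOrderAt (fun ζ => dn ζ * W ζ) w₁ < 0 := by
    have hev : (fun ζ => dn ζ * W ζ) =ᶠ[𝓝[≠] w₀]
        (fun _ => (CoulombBranch.phase ζ (r • l))⁻¹) *
          ((fun ζ => dn ζ * W ζ) ∘ fun ζ => ζ + r * I) := by
      have t1 : Tendsto (fun w : ℂ => w + r * I) (𝓝[≠] w₀) (𝓝[≠] w₁) := by
        refine tendsto_nhdsWithin_of_tendsto_nhds_of_eventually_within _ ?_ ?_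
        · exact ((continuous_id.add continuous_const).tendsto w₀).mono_left nhdsWithin_le_nhds
        · filter_upwards [self_mem_nhdsWithin] with w hw h
          exact hw (add_right_cancel h)
      filter_upwards [hLQ.eventually_den_ne_zero w₀, t1.eventually (hLQ.eventually_den_ne_zero w₁)]
        with w h1 h2
      have hp : cpx x + (w + r * I) • cpx (toReal l) =
          (cpx x + w • cpx (toReal l)) + I • cpx (toReal (r • l)) := by
        rw [line_add_I, cpx_toReal_smul, smul_smul, mul_comm I]
      have h3 := hT.quasi_periodic h (r • l) (cpx x + w • cpx (toReal l))
      have h4 := denom_add_I D (r • l) (cpx x + w • cpx (toReal l))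
      have hph := phase_ne_zero ζ (r • l)
      simp only [Pi.mul_apply, Function.comp_apply, hdn, hW]
      rw [hp] at h2 ⊢
      rw [h4]
      field_simp
      linear_combination -D.denom (cpx x + w • cpx (toReal l)) * h3
    have := meromorphicOrderAt_congr hev
    rw [meromorphicOrderAt_mul_of_ne_zero analyticAt_const (inv_ne_zero (phase_ne_zero ζ (r • l))),
      meromorphicOrderAt_comp_add_const_eq_meromorphicOrderAt] at this
    rw [hw₁, ← this]
    exact hpole
  have hdW : meromorphicOrderAt (fun ζ => dn ζ * W ζ) w₁ =
      meromorphicOrderAt dn w₁ + meromorphicOrderAt W w₁ :=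
    fun_meromorphicOrderAt_mul (hdnd.analyticAt w₁).meromorphicAt (hWm w₁)
  rw [hdW] at hmove
  -- On the real line continuity of `V` excludes the pole. In the open strip `q P W` is regular, `q`
  -- is nonzero, and `dn` vanishes at least to the order of `P`.
  rcases him0.eq_or_lt with him0 | him0
  · obtain ⟨s, hs⟩ : ∃ s : ℝ, w₁ = s := ⟨w₁.re, by apply Complex.ext <;> simp [him0]⟩
    have h1 := hLQ.order_nonneg_of_real s
    rw [← hs] at h1
    exact absurd hmove (not_lt.2 (add_nonneg (hdnd.analyticAt w₁).meromorphicOrderAt_nonneg h1))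
  · have h1 := h.order_nonneg hL (phase_ne_zero ζ l) hm hxD hxQ him1 him0
    set P : ℂ → ℂ := fun ζ => MvPolynomial.eval (I • (cpx x + ζ • cpx (toReal l)))
      (D.structConst (-l) l) with hPdef
    have hPd : Differentiable ℂ P := (ExpQuotient.differentiable_eval_I _).comp hline
    have hqd : Differentiable ℂ fun ζ : ℂ => MvPolynomial.eval (I • (cpx x + ζ • cpx (toReal l))) q :=
      (ExpQuotient.differentiable_eval_I _).comp hline
    have e1 : (fun ζ => MvPolynomial.eval (I • (cpx x + ζ • cpx (toReal l)))
        (q * D.structConst (-l) l) * (N (cpx x + ζ • cpx (toReal l)) /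
          expDen Λ σ (cpx x + ζ • cpx (toReal l)))) =
        (fun ζ => MvPolynomial.eval (I • (cpx x + ζ • cpx (toReal l))) q) * fun ζ => P ζ * W ζ := by
      ext ζ
      simp only [Pi.mul_apply, map_mul, hPdef, hW]; ring
    have hqx : MvPolynomial.eval (I • cpx x) q ≠ 0 := fun h0 => hxQ (by rw [map_mul, h0, zero_mul])
    rw [e1, meromorphicOrderAt_mul_of_ne_zero (hqd.analyticAt w₁) (hq x hqx w₁ him1 him0),
      fun_meromorphicOrderAt_mul (hPd.analyticAt w₁).meromorphicAt (hWm w₁)] at h1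
    have h2 : meromorphicOrderAt P w₁ ≤ meromorphicOrderAt dn w₁ := by
      have e2 : P = fun ζ => ∏ i, MvPolynomial.eval (I • (cpx x + ζ • cpx (toReal l)))
          (factor (D.form i) (-pair (D.weight i) l) (pair (D.weight i) l)) := by
        ext ζ; simp only [hPdef, structConst_neg_left, map_prod]
      have e3 : dn = fun ζ => ∏ i, D.denomFactor i (cpx x + ζ • cpx (toReal l)) := rfl
      rw [e2, e3, meromorphicOrderAt_fun_prod, meromorphicOrderAt_fun_prod]
      · refine Finset.sum_le_sum fun i _ => order_factor_le D i x l him1 him0 ?_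
        by_cases hpar : ∃ r : ℝ, ∀ k, (D.weight i k : ℝ) = r * Λ a k
        · exact Or.inr (hmin i hpar)
        · exact Or.inl (hxP i hpar)
      · exact fun i _ => (((differentiable_denomFactor D i).comp hline).analyticAt w₁).meromorphicAt
      · exact fun i _ => (((ExpQuotient.differentiable_eval_I _).comp hline).analyticAt w₁).meromorphicAt
    exact absurd (h1.trans (add_le_add_left h2 _)) (not_le.2 hmove)

end Poles

/-! ### The weight function and the exact trace condition -/

section Weight

variable {m n : ℕ} {D : CoulombData m n} {κ : Type*} [Fintype κ] {V : RealLie m → ℂ}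
  {N : (Fin m → ℂ) → ℂ} {Λ : κ → Fin m → ℝ} {σ : κ → ℂ} {ζ : Fin m → ℂ}

theorem cpx_toReal_zero : cpx (toReal (0 : Fin m → ℤ)) = 0 := by ext k; simp [toReal]

/-- The poles of the weight are those allowed by `denom`. -/
theorem WeakTraceIdentity.exists_entire (h : ExpQuotient V N Λ σ) (hT : WeakTraceIdentity D ζ V) :
    ∃ E : (Fin m → ℂ) → ℂ, Differentiable ℂ E ∧ ∀ z, D.denom z * N z = E z * expDen Λ σ z := by
  classical
  have key : ∀ S : Finset κ, ∃ F : (Fin m → ℂ) → ℂ, Differentiable ℂ F ∧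
      ∀ z, D.denom z * N z = F z * ∏ j ∈ S, expFactor (Λ j) (σ j) z := by
    intro S
    induction S using Finset.induction_on with
    | empty => exact ⟨fun z => D.denom z * N z, (differentiable_denom D).mul h.num, fun z => by simp⟩
    | insert a S ha ih =>
      obtain ⟨F, hF, hFeq⟩ := ih
      obtain ⟨G, hG, hGeq⟩ := exists_eq_expFactor_mul (h.lam_ne a) (σ a) hF
        fun z hz => hT.numerator_eq_zero h ha hF hFeq hz
      refine ⟨G, hG, fun z => ?_⟩
      rw [hFeq, hGeq, Finset.prod_insert ha]; ring
  exact key Finset.univ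

open Classical in
-- The weight is `E / denom` off the real points. At real points it is defined to be `V`, which is
-- consistent because `E = denom · V` there by density; so no nonvanishing of `denom` on `ℝ^m` has
-- to be used.
theorem WeakTraceIdentity.exists_weight (h : ExpQuotient V N Λ σ) (hT : WeakTraceIdentity D ζ V) :
    ∃ v : (Fin m → ℂ) → ℂ, (∀ x, v (cpx x) = V x) ∧ IsTraceWeight D ζ v := by
  obtain ⟨E, hE, hEq⟩ := hT.exists_entire h
  have hDd := differentiable_expDen Λ σ
  have hdd := differentiable_denom D
  have hreal : ∀ x, E (cpx x) = D.denom (cpx x) * V x := by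
    have hc : Continuous fun x => E (cpx x) := hE.continuous.comp cpx.continuous
    have hc' : Continuous fun x => D.denom (cpx x) * V x :=
      (hdd.continuous.comp cpx.continuous).mul h.cont
    refine congrFun (hc.ext_on h.dense_expDen_ne_zero hc' fun x hx => ?_)
    refine mul_right_cancel₀ (show expDen Λ σ (cpx x) ≠ 0 from hx) ?_
    rw [← hEq, ← h.eq]; ring
  have hper : ∀ (l : Fin m → ℤ) (z : Fin m → ℂ),
      E (z + I • cpx (toReal l)) = CoulombBranch.phase ζ l * E z := by
    intro l z
    have hsd : Differentiable ℂ fun z => E (z + I • cpx (toReal l)) - CoulombBranch.phase ζ l * E z := by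
      fun_prop
    by_contra hne
    obtain ⟨w, hw⟩ := exists_mul_ne_zero hsd (hDd.mul (by fun_prop :
      Differentiable ℂ fun z => expDen Λ σ (z + I • cpx (toReal l))))
      ⟨z, sub_ne_zero.2 hne⟩ (exists_mul_ne_zero hDd (by fun_prop) h.exists_expDen_ne_zero (by
        obtain ⟨y, hy⟩ := h.exists_expDen_ne_zero
        exact ⟨y - I • cpx (toReal l), by rwa [sub_add_cancel]⟩))
    refine hw ?_
    have h1 := hEq (w + I • cpx (toReal l))
    have h2 := hEq w
    have h3 := hT.quasi_periodic h l w
    rw [denom_add_I] at h1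
    simp only [Pi.mul_apply]
    linear_combination (-expDen Λ σ w) * h1 + D.denom w * h3 +
      CoulombBranch.phase ζ l * expDen Λ σ (w + I • cpx (toReal l)) * h2
  set v : (Fin m → ℂ) → ℂ := fun z => if hx : ∃ x, cpx x = z then V hx.choose else E z / D.denom z
    with hv
  have hinj : Function.Injective (cpx : RealLie m → Fin m → ℂ) := by
    intro x y hxy
    ext k
    have := congrFun hxy k
    simpa using this
  have hvx : ∀ x, v (cpx x) = V x := by
    intro x
    have hx : ∃ y, cpx y = cpx x := ⟨x, rfl⟩
    simp only [hv, dif_pos hx]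
    rw [hinj hx.choose_spec]
  have hvE : ∀ z, D.denom z ≠ 0 → D.denom z * v z = E z := by
    intro z hz
    by_cases hx : ∃ x, cpx x = z
    · obtain ⟨x, rfl⟩ := hx
      rw [hvx, hreal]
    · simp only [hv, dif_neg hx]
      rw [mul_div_cancel₀ _ hz]
  refine ⟨v, hvx, ?_, fun l z hz => ?_, E, hE, hvE⟩
  · obtain ⟨C, ε, hε, hC⟩ := h.decay
    have hC0 := ExpDecay.const_nonneg hC
    refine ⟨C, ε, hε, fun x => ?_⟩
    have e : (fun k => (x k : ℂ)) = cpx (WithLp.toLp 2 x : RealLie m) := by ext k; simp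
    rw [e, hvx]
    refine (hC _).trans ?_
    have : ‖x‖ ≤ ‖(WithLp.toLp 2 x : RealLie m)‖ :=
      (pi_norm_le_iff_of_nonneg (norm_nonneg _)).2 fun k =>
        PiLp.norm_apply_le (WithLp.toLp 2 x : RealLie m) k
    gcongr C * Real.exp ?_
    nlinarith
  · have e : (fun k => z k + I * (l k : ℂ)) = z + I • cpx (toReal l) := by
      ext k; simp [toReal]
    rw [e]
    have hz' : D.denom (z + I • cpx (toReal l)) ≠ 0 := by rwa [denom_add_I]
    have h1 := hvE _ hz'
    rw [hper, denom_add_I, ← hvE z hz] at h1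
    refine mul_left_cancel₀ hz ?_
    rw [h1]; ring

/-- The trace condition holds exactly. -/
theorem WeakTraceIdentity.mvShiftIdentity (h : ExpQuotient V N Λ σ) (hT : WeakTraceIdentity D ζ V)
    (l : Fin m → ℤ) :
    MvShiftIdentity V (toReal l) (CoulombBranch.phase ζ l) (D.structConst (-l) l) := by
  rcases eq_or_ne l 0 with rfl | hl
  · intro R
    rw [phase_zero, one_mul, cpx_toReal_zero]
    simp
  · obtain ⟨q, hq0, hq, hm⟩ := hT l hl
    exact h.mvShiftIdentity_of_mul (toReal_ne_zero hl) (phase_ne_zero ζ l) hq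
      (mul_ne_zero hq0 (structConst_neg_left_ne_zero D l)) hm

end Weight

/-! ### Twisted traces as functionals on polynomials -/

section Algebra

open CoulombBranch

variable {d n : ℕ} {D : CoulombData d n} {ζ : Fin d → ℂ}

theorem shift_structConst_neg (D : CoulombData d n) (l : Fin d → ℤ) :
    shift l (D.structConst (-l) l) = D.structConst l (-l) := by
  have := structConst_assoc D l (-l) l
  rw [add_neg_cancel, neg_add_cancel, structConst_zero_left, structConst_zero_right, mul_one,
    mul_one] at this
  exact this.symm

theorem eval_shift (l : Fin d → ℤ) (R : CPoly d) (z : Fin d → ℂ) :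
    MvPolynomial.eval z (shift l R) = MvPolynomial.eval (z + cpx (toReal l)) R := by
  have : (MvPolynomial.eval z).comp (shift l : CPoly d →+* CPoly d) =
      MvPolynomial.eval (z + cpx (toReal l)) := by
    refine MvPolynomial.ringHom_ext (fun c => ?_) fun k => ?_
    · simp [shift]
    · simp [shift, toReal]
  exact DFunLike.congr_fun this R

theorem twist_mono (l : Fin d → ℤ) (f : CPoly d) :
    twist D ζ (mono D l f) = phase ζ l • mono D l f := twistLin_mono ζ l f

/-- The twist fixes `X_k`, so `T` vanishes on the commutator of `X_k` with `f r^l`, which is `-l_k f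
r^l`; choose `k` with `l_k ≠ 0`. -/
theorem AbelianCoulomb.CoulombBranch.IsTwistedTrace.mono_eq_zero {T : CoulombBranch D →ₗ[ℂ] ℂ} (hT : IsTwistedTrace ζ T)
    {l : Fin d → ℤ} (hl : l ≠ 0) (f : CPoly d) : T (mono D l f) = 0 := by
  obtain ⟨k, hk⟩ := Function.ne_iff.1 hl
  have h := hT (mono D 0 (MvPolynomial.X k)) (mono D l f)
  rw [twist_mono, phase_zero, one_smul, mono_mul_mono, mono_mul_mono, shift_zero, zero_add, add_zero,
    structConst_zero_left, structConst_zero_right, mul_one, mul_one] at h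
  have e : f * shift l (MvPolynomial.X k) = MvPolynomial.X k * f + (l k : ℂ) • f := by
    simp only [shift, MvPolynomial.aeval_X, MvPolynomial.smul_eq_C_mul]; ring
  rw [e, map_add, map_add, map_smul, map_smul, left_eq_add, smul_eq_mul] at h
  exact (mul_eq_zero.1 h).resolve_left (by exact_mod_cast hk)

/-- The trace condition for `a = r^l` and `b = R r^{-l}`. -/
theorem AbelianCoulomb.CoulombBranch.IsTwistedTrace.shift_eq {T : CoulombBranch D →ₗ[ℂ] ℂ} (hT : IsTwistedTrace ζ T)
    (l : Fin d → ℤ) (R : CPoly d) :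
    T (ofPoly D (shift l (R * D.structConst (-l) l))) =
      phase ζ l * T (ofPoly D (R * D.structConst (-l) l)) := by
  have h := hT (mono D l 1) (mono D (-l) R)
  rw [twist_mono, mul_smul_comm, map_smul, mono_mul_mono, mono_mul_mono, add_neg_cancel,
    neg_add_cancel, map_one, one_mul, mul_one, smul_eq_mul] at h
  rw [map_mul, shift_structConst_neg]
  exact h

/-- The functional `∑ f_λ r^λ ↦ t(f_0)`. -/
noncomputable def zeroPart (D : CoulombData d n) (t : CPoly d →ₗ[ℂ] ℂ) : CoulombBranch D →ₗ[ℂ] ℂ :=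
  t ∘ₗ (Finsupp.lapply 0 : ((Fin d → ℤ) →₀ CPoly d) →ₗ[ℂ] CPoly d)

theorem zeroPart_mono (t : CPoly d →ₗ[ℂ] ℂ) (l : Fin d → ℤ) (f : CPoly d) :
    zeroPart D t (mono D l f) = if l = 0 then t f else 0 := by
  change t ((Finsupp.single l f) 0) = _
  rw [Finsupp.single_apply]
  split_ifs <;> simp

theorem zeroPart_ofPoly (t : CPoly d →ₗ[ℂ] ℂ) (f : CPoly d) : zeroPart D t (ofPoly D f) = t f := by
  rw [ofPoly, zeroPart_mono, if_pos rfl]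

/-- Only products of degree zero contribute, that is, `f r^l` against `g r^{-l}`; for these the
condition is the hypothesis with `R = g · shift (-l) f`. -/
theorem isTwistedTrace_zeroPart {t : CPoly d →ₗ[ℂ] ℂ}
    (h : ∀ (l : Fin d → ℤ) (R : CPoly d), t (shift l (R * D.structConst (-l) l)) =
      phase ζ l * t (R * D.structConst (-l) l)) : IsTwistedTrace ζ (zeroPart D t) := by
  intro a b
  refine induct a (fun a a' ha ha' => ?_) fun l f => ?_
  · rw [add_mul, map_add, map_add, mul_add, map_add, ha, ha']
  refine induct b (fun b b' hb hb' => ?_) fun k g => ?_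
  · rw [mul_add, map_add, add_mul, map_add, hb, hb']
  rw [twist_mono, mul_smul_comm, map_smul, mono_mul_mono, mono_mul_mono, zeroPart_mono, zeroPart_mono]
  by_cases hlk : l + k = 0
  · obtain rfl : k = -l := (neg_eq_of_add_eq_zero_right hlk).symm
    rw [if_pos hlk, if_pos (neg_add_cancel l), smul_eq_mul, ← h]
    congr 1
    rw [map_mul (shift l), map_mul (shift l), ← shift_add, add_neg_cancel, shift_zero,
      shift_structConst_neg]
    ring
  · rw [if_neg hlk, if_neg (by rwa [add_comm]), smul_zero]

theorem AbelianCoulomb.CoulombBranch.IsTwistedTrace.eq_zeroPart {T : CoulombBranch D →ₗ[ℂ] ℂ} (hT : IsTwistedTrace ζ T) :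
    T = zeroPart D (T ∘ₗ ofPoly D) := by
  ext a
  refine induct a (fun a b ha hb => by rw [map_add, map_add, ha, hb]) fun l f => ?_
  rw [zeroPart_mono]
  split_ifs with hl
  · rw [hl]; rfl
  · exact hT.mono_eq_zero hl f

end Algebra

/-! ### Rational subspaces -/

section Lattice

variable {d : ℕ}

/-- Finitely many real numbers are integral combinations of real numbers that are linearly
independent over `ℤ`. -/
theorem exists_int_combination {k : ℕ} (r : Fin k → ℝ) : ∃ (M : ℕ) (e : Fin M → ℝ) (c : Fin M → Fin k → ℤ),
    LinearIndependent ℤ e ∧ ∀ j, r j = ∑ a, (c a j : ℝ) * e a := by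
  set L : Submodule ℤ ℝ := Submodule.span ℤ (Set.range r) with hL
  have hfin : Module.Finite ℤ L := Module.Finite.span_of_finite ℤ (Set.finite_range r)
  have : Module.Free ℤ L := inferInstance
  set b := Module.finBasis ℤ L
  refine ⟨_, fun a => (b a : ℝ), fun a j => b.repr ⟨r j, Submodule.subset_span ⟨j, rfl⟩⟩ a, ?_,
    fun j => ?_⟩
  · exact b.linearIndependent.map' L.subtype L.ker_subtype
  · have := congrArg (fun x : L => (x : ℝ)) (b.sum_repr ⟨r j, Submodule.subset_span ⟨j, rfl⟩⟩)
    simp only [Submodule.coe_sum, Submodule.coe_smul, zsmul_eq_mul] at this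
    exact this.symm

theorem int_combination_relation {M k : ℕ} {e : Fin M → ℝ} (he : LinearIndependent ℤ e)
    {c : Fin M → Fin k → ℤ} {r : Fin k → ℝ} (hr : ∀ j, r j = ∑ a, (c a j : ℝ) * e a) {η : Fin k → ℤ}
    (h : ∑ j, (η j : ℝ) * r j = 0) (a : Fin M) : ∑ j, η j * c a j = 0 := by
  refine Fintype.linearIndependent_iff.1 he (fun a => ∑ j, η j * c a j) ?_ a
  rw [← h]
  simp only [zsmul_eq_mul, Int.cast_sum, Int.cast_mul, hr, Finset.mul_sum, Finset.sum_mul]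
  rw [Finset.sum_comm]
  refine Finset.sum_congr rfl fun j _ => Finset.sum_congr rfl fun a _ => by ring

theorem toReal_sum {κ : Type*} (s : Finset κ) (f : κ → Fin d → ℤ) :
    toReal (∑ j ∈ s, f j) = ∑ j ∈ s, toReal (f j) := by
  ext k; simp [toReal]

theorem toReal_zsmul (a : ℤ) (l : Fin d → ℤ) : toReal (a • l) = (a : ℝ) • toReal l := by
  ext k; simp [toReal]

/-- A subspace whose lattice vectors are cut out by weights vanishing on it is rational. -/
theorem span_latticeIn_eq {n : ℕ} {D : CoulombData d n} {W : Submodule ℝ (RealLie d)}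
    (h : ∀ l ∉ latticeIn W, ∃ i, (∀ u ∈ W, ∑ k, (D.weight i k : ℝ) * u k = 0) ∧
      pair (D.weight i) l ≠ 0) :
    Submodule.span ℝ (toReal '' (latticeIn W : Set (Fin d → ℤ))) = W := by
  refine le_antisymm (Submodule.span_le.2 ?_) fun x hx => ?_
  · rintro _ ⟨l, hl, rfl⟩
    exact hl
  -- Expanding the coordinates of `x` in reals independent over `ℤ` writes `x` as a real combination
  -- of integral vectors `c_a`. A weight that vanishes on `x` vanishes on every `c_a`, so the
  -- hypothesis puts each `c_a` in the lattice of `W`.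
  · obtain ⟨M, e, c, he, hr⟩ := exists_int_combination fun k => x k
    have hc : ∀ a, c a ∈ latticeIn W := by
      intro a
      by_contra hca
      obtain ⟨i, hi, hne⟩ := h _ hca
      exact hne (int_combination_relation he hr (hi x hx) a)
    have hx' : x = ∑ a, e a • toReal (c a) := by
      ext k
      rw [hr k]
      simp [toReal, mul_comm]
    rw [hx']
    exact Submodule.sum_mem _ fun a _ => Submodule.smul_mem _ _ (Submodule.subset_span ⟨_, hc a, rfl⟩)

/-- A real relation, with its coefficients expanded in reals independent over `ℤ`, splits into
integral relations. -/
theorem linearIndependent_toReal {k : ℕ} {B : Fin k → Fin d → ℤ} (hB : LinearIndependent ℤ B) :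
    LinearIndependent ℝ fun j => toReal (B j) := by
  rw [Fintype.linearIndependent_iff]
  intro r hr j
  obtain ⟨M, e, c, he, hc⟩ := exists_int_combination r
  have h0 : ∀ a, c a = 0 := by
    intro a
    ext j
    refine Fintype.linearIndependent_iff.1 hB (c a) ?_ j
    ext l
    have h1 := congrArg (fun x : RealLie d => x l) hr
    have h2 := int_combination_relation he hc (η := fun j => B j l) (by
      simpa [toReal, mul_comm] using h1) a
    simp only [Finset.sum_apply, Pi.smul_apply, smul_eq_mul, Pi.zero_apply]
    rw [← h2]
    exact Finset.sum_congr rfl fun j _ => mul_comm _ _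
  rw [hc j]
  simp [h0]

variable {W : Submodule ℝ (RealLie d)}

/-- A basis of the lattice of a rational subspace, as a basis of the subspace. -/
noncomputable def realBasis {k : ℕ} (hW : Submodule.span ℝ (toReal '' (latticeIn W : Set (Fin d → ℤ))) = W)
    (B : Module.Basis (Fin k) ℤ (latticeIn W)) : Module.Basis (Fin k) ℝ W :=
  Module.Basis.mk (v := fun j => (⟨toReal (B j : Fin d → ℤ), (B j).2⟩ : W))
    (by
      have h1 := linearIndependent_toReal (B := fun j => (B j : Fin d → ℤ))
        (B.linearIndependent.map' (latticeIn W).subtype (latticeIn W).ker_subtype)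
      exact LinearIndependent.of_comp W.subtype h1)
    (by
      rw [← Submodule.map_le_map_iff_of_injective W.injective_subtype, Submodule.map_subtype_top,
        Submodule.map_span]
      conv_lhs => rw [← hW]
      rw [Submodule.span_le]
      rintro _ ⟨l, hl, rfl⟩
      have h1 := congrArg (fun x : latticeIn W => toReal (x : Fin d → ℤ)) (B.sum_repr ⟨l, hl⟩)
      simp only [Submodule.coe_sum, Submodule.coe_smul, toReal_sum, toReal_zsmul] at h1
      rw [← h1]
      exact Submodule.sum_mem _ fun j _ => Submodule.smul_mem _ _
        (Submodule.subset_span ⟨_, ⟨j, rfl⟩, rfl⟩))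

theorem coe_realBasis {k : ℕ} (hW : Submodule.span ℝ (toReal '' (latticeIn W : Set (Fin d → ℤ))) = W)
    (B : Module.Basis (Fin k) ℤ (latticeIn W)) (j : Fin k) :
    (realBasis hW B j : RealLie d) = toReal (B j : Fin d → ℤ) := by
  rw [realBasis, Module.Basis.mk_apply]

theorem nonempty_basis_latticeIn
    (hW : Submodule.span ℝ (toReal '' (latticeIn W : Set (Fin d → ℤ))) = W) :
    Nonempty (Module.Basis (Fin (Module.finrank ℝ W)) ℤ (latticeIn W)) := by
  have B := Module.finBasis ℤ (latticeIn W)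
  have h : Module.finrank ℝ W = Module.finrank ℤ (latticeIn W) := by
    simpa using Module.finrank_eq_card_basis (realBasis hW B)
  rw [h]
  exact ⟨B⟩

end Lattice

/-! ### Integrals and exponential fractions in coordinates of an affine subspace -/

section Affine

variable {d k : ℕ}

/-- The linear map `y ↦ ∑ y_j b_j`. -/
noncomputable def linComb (b : Fin k → RealLie d) : RealLie k →L[ℝ] RealLie d :=
  ∑ j, (EuclideanSpace.proj j : RealLie k →L[ℝ] ℝ).smulRight (b j)

theorem linComb_apply (b : Fin k → RealLie d) (y : RealLie k) : linComb b y = ∑ j, y j • b j := by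
  simp [linComb]

/-- The complexification of `linComb`. -/
noncomputable def linCombC (b : Fin k → RealLie d) : (Fin k → ℂ) →L[ℂ] (Fin d → ℂ) :=
  ∑ j, (ContinuousLinearMap.proj j : (Fin k → ℂ) →L[ℂ] ℂ).smulRight (cpx (b j))

theorem linCombC_apply (b : Fin k → RealLie d) (z : Fin k → ℂ) :
    linCombC b z = ∑ j, z j • cpx (b j) := by
  simp [linCombC]

theorem linCombC_cpx (b : Fin k → RealLie d) (y : RealLie k) :
    linCombC b (cpx y) = cpx (linComb b y) := by
  simp [linCombC_apply, linComb_apply, map_sum]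

/-- The restriction of polynomials to the complexification of `i(p + W)` in coordinates. -/
noncomputable def affRestrict (b : Fin k → RealLie d) (p : RealLie d) : CPoly d →ₐ[ℂ] CPoly k :=
  MvPolynomial.aeval fun l =>
    ∑ j, MvPolynomial.C ((b j l : ℝ) : ℂ) * MvPolynomial.X j + MvPolynomial.C (I * (p l : ℂ))

theorem eval_affRestrict (b : Fin k → RealLie d) (p : RealLie d) (R : CPoly d) (z : Fin k → ℂ) :
    MvPolynomial.eval z (affRestrict b p R) = MvPolynomial.eval (I • cpx p + linCombC b z) R := by
  have : (MvPolynomial.eval z).comp (affRestrict b p : CPoly d →+* CPoly k) =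
      MvPolynomial.eval (I • cpx p + linCombC b z) := by
    refine MvPolynomial.ringHom_ext (fun c => ?_) fun l => ?_
    · simp [affRestrict]
    · simp [affRestrict, linCombC_apply, mul_comm, add_comm]
  exact DFunLike.congr_fun this R

theorem eval_affRestrict_line (b : Fin k → RealLie d) (p : RealLie d) (R : CPoly d) (y a : RealLie k)
    (ζ : ℂ) : MvPolynomial.eval (I • (cpx y + ζ • cpx a)) (affRestrict b p R) =
      MvPolynomial.eval (I • (cpx (p + linComb b y) + ζ • cpx (linComb b a))) R := by
  rw [eval_affRestrict]
  congr 1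
  simp only [map_add, map_smul, smul_add, linCombC_cpx, add_assoc]

theorem eval_affRestrict_cpx (b : Fin k → RealLie d) (p : RealLie d) (R : CPoly d) (y : RealLie k) :
    MvPolynomial.eval (I • cpx y) (affRestrict b p R) =
      MvPolynomial.eval (I • cpx (p + linComb b y)) R := by
  simpa using eval_affRestrict_line b p R y 0 0

theorem affRestrict_eq_zero_iff (b : Fin k → RealLie d) (p : RealLie d) (R : CPoly d) :
    affRestrict b p R = 0 ↔ ∀ y, MvPolynomial.eval (I • cpx (p + linComb b y)) R = 0 := by
  constructor
  · intro h y
    rw [← eval_affRestrict_cpx, h, map_zero]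
  · intro h
    by_contra hne
    obtain ⟨z, hz⟩ := ExpQuotient.exists_eval_I_ne_zero hne
    exact hz (eq_zero_of_real_ball (ExpQuotient.differentiable_eval_I _) (x₀ := 0) one_pos
      (fun y _ => by rw [eval_affRestrict_cpx, h]) z)

/-- A left inverse of the injective map `linComb b` expresses each coordinate as the restriction of
an affine polynomial. -/
theorem surjective_affRestrict {b : Fin k → RealLie d} (hb : LinearIndependent ℝ b) (p : RealLie d) :
    Function.Surjective (affRestrict b p) := by
  have hinj : LinearMap.ker (linComb b : RealLie k →ₗ[ℝ] RealLie d) = ⊥ := by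
    rw [LinearMap.ker_eq_bot']
    intro y hy
    ext j
    exact Fintype.linearIndependent_iff.1 hb (fun j => y j) (by rw [← linComb_apply]; exact hy) j
  obtain ⟨g, hg⟩ := LinearMap.exists_leftInverse_of_injective _ hinj
  have hX : ∀ j, ∃ R, affRestrict b p R = MvPolynomial.X j := by
    intro j
    refine ⟨∑ l, MvPolynomial.C ((g (EuclideanSpace.single l 1) j : ℝ) : ℂ) *
      (MvPolynomial.X l - MvPolynomial.C (I * (p l : ℂ))), ?_⟩
    have h1 : ∀ l, affRestrict b p (MvPolynomial.X l - MvPolynomial.C (I * (p l : ℂ))) =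
        ∑ i, MvPolynomial.C ((b i l : ℝ) : ℂ) * MvPolynomial.X i := by
      intro l
      rw [map_sub, affRestrict, MvPolynomial.aeval_X, MvPolynomial.algHom_C, MvPolynomial.algebraMap_eq,
        add_sub_cancel_right]
    have h2 : ∀ i, ∑ l, g (EuclideanSpace.single l 1) j * b i l = if i = j then 1 else 0 := by
      intro i
      have h3 : b i = ∑ l, b i l • (EuclideanSpace.single l 1 : RealLie d) := by
        ext l
        simp only [WithLp.ofLp_sum, Finset.sum_apply, PiLp.smul_apply, smul_eq_mul,
          PiLp.single_apply, mul_ite, mul_one, mul_zero, Finset.sum_ite_eq, Finset.mem_univ,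
          if_true]
      have h4 := LinearMap.congr_fun hg (EuclideanSpace.single i 1)
      have h5 : linComb b (EuclideanSpace.single i 1) = b i := by
        rw [linComb_apply, Finset.sum_eq_single i] <;> simp +contextual
      simp only [LinearMap.comp_apply, ContinuousLinearMap.coe_coe, h5, LinearMap.id_apply] at h4
      have h6 := congrArg (fun y : RealLie k => y j) h4
      rw [h3, map_sum] at h6
      simp only [map_smul, WithLp.ofLp_sum, Finset.sum_apply, PiLp.smul_apply, smul_eq_mul] at h6
      rw [PiLp.single_apply] at h6
      simp only [mul_comm (g _ j), eq_comm (a := i)]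
      exact h6
    rw [map_sum]
    simp only [map_mul (affRestrict b p), h1, MvPolynomial.algHom_C, MvPolynomial.algebraMap_eq,
      Finset.mul_sum]
    rw [Finset.sum_comm]
    have h7 : ∀ i, ∑ l, MvPolynomial.C ((g (EuclideanSpace.single l 1) j : ℝ) : ℂ) *
        (MvPolynomial.C ((b i l : ℝ) : ℂ) * MvPolynomial.X i) =
        MvPolynomial.C (((if i = j then 1 else 0 : ℝ)) : ℂ) * (MvPolynomial.X i : CPoly k) := by
      intro i
      rw [← h2 i]
      push_cast
      rw [map_sum, Finset.sum_mul]
      exact Finset.sum_congr rfl fun l _ => by rw [map_mul, mul_assoc]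
    simp only [h7]
    rw [Finset.sum_eq_single j] <;> simp +contextual
  intro Q
  induction Q using MvPolynomial.induction_on with
  | C a => exact ⟨MvPolynomial.C a, by rw [MvPolynomial.algHom_C, MvPolynomial.algebraMap_eq]⟩
  | add P Q hP hQ =>
    obtain ⟨P', hP⟩ := hP
    obtain ⟨Q', hQ⟩ := hQ
    exact ⟨P' + Q', by rw [map_add, hP, hQ]⟩
  | mul_X P j hP =>
    obtain ⟨P', hP⟩ := hP
    obtain ⟨Q', hQ⟩ := hX j
    exact ⟨P' * Q', by rw [map_mul, hP, hQ]⟩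

variable {U : AffineSubspace ℝ (RealLie d)} {p : RealLie d}

theorem linComb_mem_direction (b : Module.Basis (Fin k) ℝ U.direction) (y : RealLie k) :
    linComb (fun j => (b j : RealLie d)) y ∈ U.direction := by
  rw [linComb_apply]
  exact Submodule.sum_mem _ fun j _ => Submodule.smul_mem _ _ (b j).2

theorem add_linComb_mem (hp : p ∈ U) (b : Module.Basis (Fin k) ℝ U.direction) (y : RealLie k) :
    p + linComb (fun j => (b j : RealLie d)) y ∈ U := by
  rw [add_comm]
  exact AffineSubspace.vadd_mem_of_mem_direction (linComb_mem_direction b y) hp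

theorem exists_eq_linComb (b : Module.Basis (Fin k) ℝ U.direction) {u : RealLie d} (hu : u ∈ U.direction) :
    ∃ y, u = linComb (fun j => (b j : RealLie d)) y := by
  refine ⟨WithLp.toLp 2 (b.equivFun ⟨u, hu⟩), ?_⟩
  have := congrArg (fun x : U.direction => (x : RealLie d)) (b.sum_equivFun ⟨u, hu⟩)
  simp only [Submodule.coe_sum, Submodule.coe_smul] at this
  rw [linComb_apply]
  exact this.symm

theorem exists_eq_add_linComb (hp : p ∈ U) (b : Module.Basis (Fin k) ℝ U.direction) {x : RealLie d}
    (hx : x ∈ U) : ∃ y, x = p + linComb (fun j => (b j : RealLie d)) y := by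
  obtain ⟨y, hy⟩ := exists_eq_linComb b (AffineSubspace.vsub_mem_direction hx hp)
  refine ⟨y, ?_⟩
  rw [← hy, vsub_eq_sub, add_sub_cancel]

theorem linearIndependent_coe_basis (b : Module.Basis (Fin k) ℝ U.direction) :
    LinearIndependent ℝ fun j => (b j : RealLie d) :=
  b.linearIndependent.map' U.direction.subtype U.direction.ker_subtype

/-- The coordinates of a basis as a continuous linear equivalence. -/
noncomputable def coordEquiv (b : Module.Basis (Fin k) ℝ U.direction) : RealLie k ≃L[ℝ] U.direction :=
  ((WithLp.linearEquiv 2 ℝ (Fin k → ℝ)).trans b.equivFun.symm).toContinuousLinearEquiv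

theorem coe_coordEquiv (b : Module.Basis (Fin k) ℝ U.direction) (y : RealLie k) :
    (coordEquiv b y : RealLie d) = linComb (fun j => (b j : RealLie d)) y := by
  rw [linComb_apply]
  change ((b.equivFun.symm fun j => y j : U.direction) : RealLie d) = _
  rw [Module.Basis.equivFun_symm_apply]
  simp

/-- The integral over `U` in coordinates. -/
theorem exists_termIntegral_eq (b : Module.Basis (Fin k) ℝ U.direction) (p : RealLie d) :
    ∃ c : ℝ, 0 < c ∧ ∀ (w : RealLie d → ℂ) (R : CPoly d), termIntegral U p w R =
      ∫ y : RealLie k, MvPolynomial.eval (I • cpx y) (affRestrict (fun j => (b j : RealLie d)) p R) *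
        (c * w (p + linComb (fun j => (b j : RealLie d)) y)) := by
  set μ := (stdOrthonormalBasis ℝ U.direction).toBasis.addHaar with hμ
  have hh : ((volume : Measure (RealLie k)).map (coordEquiv b)).IsAddHaarMeasure :=
    ContinuousLinearEquiv.isAddHaarMeasure_map _ _
  -- The ratio of two Haar measures on the direction; this is the positive constant between the
  -- weight function and `w`.
  set c := Measure.addHaarScalarFactor μ ((volume : Measure (RealLie k)).map (coordEquiv b)) with hc
  have hpos : 0 < c := Measure.addHaarScalarFactor_pos_of_isAddHaarMeasure _ _
  have heq : μ = c • (volume : Measure (RealLie k)).map (coordEquiv b) :=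
    Measure.isAddLeftInvariant_eq_smul _ _
  refine ⟨c, by exact_mod_cast hpos, fun w R => ?_⟩
  rw [termIntegral, ← hμ, heq, integral_smul_nnreal_measure, NNReal.smul_def, Complex.real_smul,
    ← integral_const_mul]
  have e : (volume : Measure (RealLie k)).map (coordEquiv b) =
    (volume : Measure (RealLie k)).map (coordEquiv b).toHomeomorph.toMeasurableEquiv := rfl
  rw [e, MeasureTheory.integral_map_equiv]
  refine integral_congr_fun fun y => ?_
  have e1 : (((coordEquiv b).toHomeomorph.toMeasurableEquiv y : U.direction) : RealLie d) + p =
      p + linComb (fun j => (b j : RealLie d)) y := by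
    rw [add_comm, ← coe_coordEquiv]; rfl
  rw [e1, eval_affRestrict_cpx]
  have e2 : (fun l => I * ((p + linComb (fun j => (b j : RealLie d)) y) l : ℂ)) =
      I • cpx (p + linComb (fun j => (b j : RealLie d)) y) := by
    ext l; simp
  rw [e2]; ring

theorem expDecay_coord {w : RealLie d → ℂ} (hp : p ∈ U) (hw : ExpDecayOn U w)
    (b : Module.Basis (Fin k) ℝ U.direction) (c : ℂ) :
    ExpDecay fun y : RealLie k => c * w (p + linComb (fun j => (b j : RealLie d)) y) := by
  refine ExpDecay.const_mul ?_ c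
  obtain ⟨C, ε, hε, hC⟩ := hw
  have hC0 : 0 ≤ C := by
    have := (norm_nonneg _).trans (hC p hp)
    exact nonneg_of_mul_nonneg_left this (Real.exp_pos _)
  set K := ‖((coordEquiv b).symm : U.direction →L[ℝ] RealLie k)‖ + 1 with hK
  have hK0 : 0 < K := by positivity
  refine ⟨C * Real.exp (ε * ‖p‖), ε / K, by positivity, fun y => ?_⟩
  refine (hC _ (add_linComb_mem hp b y)).trans ?_
  rw [mul_assoc, ← Real.exp_add]
  have h1 : ‖y‖ ≤ K * ‖linComb (fun j => (b j : RealLie d)) y‖ := by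
    have h2 := ((coordEquiv b).symm : U.direction →L[ℝ] RealLie k).le_opNorm (coordEquiv b y)
    rw [ContinuousLinearEquiv.coe_coe, ContinuousLinearEquiv.symm_apply_apply, ← Submodule.norm_coe,
      coe_coordEquiv] at h2
    refine h2.trans ?_
    gcongr
    rw [hK]; linarith
  have h3 : ‖linComb (fun j => (b j : RealLie d)) y‖ ≤
      ‖p + linComb (fun j => (b j : RealLie d)) y‖ + ‖p‖ := by
    calc _ = ‖(p + linComb (fun j => (b j : RealLie d)) y) - p‖ := by rw [add_sub_cancel_left]
      _ ≤ _ := norm_sub_le _ _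
  have h4 : ‖y‖ / K ≤ ‖p + linComb (fun j => (b j : RealLie d)) y‖ + ‖p‖ := by
    rw [div_le_iff₀ hK0]
    nlinarith
  gcongr C * Real.exp ?_
  have : ε / K * ‖y‖ = ε * (‖y‖ / K) := by ring
  nlinarith

theorem continuous_coord {w : RealLie d → ℂ} (hp : p ∈ U) (hw : ContinuousOn w (U : Set (RealLie d)))
    (b : Module.Basis (Fin k) ℝ U.direction) (c : ℂ) :
    Continuous fun y : RealLie k => c * w (p + linComb (fun j => (b j : RealLie d)) y) :=
  continuous_const.mul (hw.comp_continuous (by fun_prop) fun y => add_linComb_mem hp b y)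

/-- At most exponential growth on `ℂ^k`. -/
def ExpGrowth (f : (Fin k → ℂ) → ℂ) : Prop := ∃ C : ℝ, 0 ≤ C ∧ ∀ z, ‖f z‖ ≤ C * Real.exp (C * ‖z‖)

namespace ExpGrowth

variable {f g : (Fin k → ℂ) → ℂ}

theorem of_le {A B : ℝ} (h : ∀ z, ‖f z‖ ≤ A * Real.exp (B * ‖z‖)) : ExpGrowth f := by
  refine ⟨max |A| B, le_max_of_le_left (abs_nonneg _), fun z => (h z).trans ?_⟩
  calc A * Real.exp (B * ‖z‖) ≤ |A| * Real.exp (B * ‖z‖) := by gcongr; exact le_abs_self A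
    _ ≤ _ := by
      gcongr
      · exact le_max_left _ _
      · exact le_max_right _ _

theorem const (c : ℂ) : ExpGrowth fun _ : Fin k → ℂ => c :=
  of_le (A := ‖c‖) (B := 0) fun z => by simp

theorem mul (hf : ExpGrowth f) (hg : ExpGrowth g) : ExpGrowth fun z => f z * g z := by
  obtain ⟨C, hC, h⟩ := hf
  obtain ⟨C', hC', h'⟩ := hg
  refine of_le (A := C * C') (B := C + C') fun z => ?_
  rw [norm_mul]
  calc _ ≤ C * Real.exp (C * ‖z‖) * (C' * Real.exp (C' * ‖z‖)) := by
        gcongr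
        · exact h z
        · exact h' z
    _ = _ := by rw [add_mul, Real.exp_add]; ring

theorem add (hf : ExpGrowth f) (hg : ExpGrowth g) : ExpGrowth fun z => f z + g z := by
  obtain ⟨C, hC, h⟩ := hf
  obtain ⟨C', hC', h'⟩ := hg
  refine of_le (A := C + C') (B := max C C') fun z => ?_
  refine (norm_add_le _ _).trans ?_
  rw [add_mul]
  refine add_le_add ((h z).trans ?_) ((h' z).trans ?_)
  · gcongr; exact le_max_left _ _
  · gcongr; exact le_max_right _ _

theorem sum {ι : Type*} (s : Finset ι) {F : ι → (Fin k → ℂ) → ℂ} (h : ∀ i, ExpGrowth (F i)) :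
    ExpGrowth fun z => ∑ i ∈ s, F i z := by
  classical
  induction s using Finset.induction_on with
  | empty => simpa using const 0
  | insert a s ha ih => simpa only [Finset.sum_insert ha] using (h a).add ih

theorem prod {ι : Type*} (s : Finset ι) {F : ι → (Fin k → ℂ) → ℂ} (h : ∀ i, ExpGrowth (F i)) :
    ExpGrowth fun z => ∏ i ∈ s, F i z := by
  classical
  induction s using Finset.induction_on with
  | empty => simpa using const 1
  | insert a s ha ih => simpa only [Finset.prod_insert ha] using (h a).mul ih

theorem cexp_clm (L : (Fin k → ℂ) →L[ℂ] ℂ) : ExpGrowth fun z => cexp (L z) :=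
  of_le (A := 1) (B := ‖L‖) fun z => by
    rw [one_mul]
    exact (Complex.norm_exp_le_exp_norm _).trans (Real.exp_le_exp.2 (L.le_opNorm z))

theorem eval {d : ℕ} (R : CPoly d) (p : Fin d → ℂ) (L : (Fin k → ℂ) →L[ℂ] (Fin d → ℂ)) :
    ExpGrowth fun z => MvPolynomial.eval (p + L z) R := by
  obtain ⟨C, hC, h⟩ := exists_norm_eval_le R 1 one_pos
  refine of_le (A := C * Real.exp ‖p‖) (B := ‖L‖) fun z => (h _).trans ?_
  rw [mul_assoc, ← Real.exp_add, one_mul]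
  gcongr
  exact (norm_add_le _ _).trans (by gcongr; exact L.le_opNorm z)

end ExpGrowth

/-- An exponential fraction on `U` in coordinates. -/
theorem exists_expQuotient {w : RealLie d → ℂ} (hp : p ∈ U) (hw : IsExpFractionOn U w)
    (hd : ExpDecayOn U w) (b : Module.Basis (Fin k) ℝ U.direction) (c : ℂ) :
    ∃ (J : ℕ) (N : (Fin k → ℂ) → ℂ) (Λ : Fin J → Fin k → ℝ) (σ : Fin J → ℂ),
      ExpQuotient (fun y => c * w (p + linComb (fun j => (b j : RealLie d)) y)) N Λ σ := by
  obtain ⟨hcont, M, J, S, μ, lam, s, hlam, heq⟩ := hw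
  set b' : Fin k → RealLie d := fun j => (b j : RealLie d) with hb'
  set α : Fin J → ℝ := fun j => ∑ l, lam j l * p l with hα
  set Λ : Fin J → Fin k → ℝ := fun j i => ∑ l, lam j l * b' i l with hΛ
  -- On `U` the form `λ` is `α + Λ(y)` with `α = λ(p)`. Multiplying `e^{λ/2} - e^{2πis} e^{-λ/2}` by
  -- `e^{-α/2} e^{Λ/2}` turns it into `e^Λ - σ`, and the same multipliers go into `N`.
  set σ : Fin J → ℂ := fun j => cexp (2 * Real.pi * I * s j) * cexp (-(α j : ℂ)) with hσ
  set m : Fin M → ((Fin k → ℂ) →L[ℂ] ℂ) := fun t =>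
    (∑ l, μ t l • (ContinuousLinearMap.proj l : (Fin d → ℂ) →L[ℂ] ℂ)).comp (linCombC b') with hm
  set N : (Fin k → ℂ) → ℂ := fun z => (c * ∏ j, cexp (-(α j : ℂ) / 2)) *
    ((∏ j, cexp ((((1 / 2 : ℂ)) • cdot (Λ j)) z)) *
      ∑ t, MvPolynomial.eval (cpx p + linCombC b' z) (S t) *
        (cexp (∑ l, μ t l * (p l : ℂ)) * cexp (m t z))) with hN
  refine ⟨J, N, Λ, σ, ⟨continuous_coord hp hcont b c, expDecay_coord hp hd b c, ?_, ?_, ?_, ?_, ?_⟩⟩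
  · have h1 : ∀ t, Differentiable ℂ fun z => MvPolynomial.eval (cpx p + linCombC b' z) (S t) :=
      fun t => (differentiable_eval (S t)).comp
        (by fun_prop : Differentiable ℂ fun z => cpx p + linCombC b' z)
    have h2 : Differentiable ℂ fun z => ∏ j, cexp ((((1 / 2 : ℂ)) • cdot (Λ j)) z) :=
      differentiable_finsetProd _ _ fun j => by fun_prop
    rw [hN]
    fun_prop
  · exact (ExpGrowth.const _).mul ((ExpGrowth.prod _ fun j => ExpGrowth.cexp_clm _).mul
      (ExpGrowth.sum _ fun t => (ExpGrowth.eval _ _ _).mul ((ExpGrowth.const _).mul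
        (ExpGrowth.cexp_clm _))))
  · intro j h0
    obtain ⟨u, hu, hne⟩ := hlam j
    obtain ⟨y, rfl⟩ := exists_eq_linComb b hu
    refine hne ?_
    have : ∑ l, lam j l * linComb b' y l = ∑ i, y i * Λ j i := by
      simp only [linComb_apply, WithLp.ofLp_sum, Finset.sum_apply, PiLp.smul_apply, smul_eq_mul,
        Finset.mul_sum, hΛ]
      rw [Finset.sum_comm]
      exact Finset.sum_congr rfl fun i _ => Finset.sum_congr rfl fun l _ => by ring
    rw [this, h0]
    simp
  · exact fun j => mul_ne_zero (exp_ne_zero _) (exp_ne_zero _)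
  · intro y
    have hx := heq _ (add_linComb_mem hp b y)
    set x := p + linComb b' y with hxdef
    have hlx : ∀ j, ((∑ l, lam j l * x l : ℝ) : ℂ) = α j + cdot (Λ j) (cpx y) := by
      intro j
      rw [cdot_cpx, ← ofReal_add]
      congr 1
      simp only [hxdef, PiLp.add_apply, mul_add, Finset.sum_add_distrib, hα]
      congr 1
      simp only [linComb_apply, WithLp.ofLp_sum, Finset.sum_apply, PiLp.smul_apply, smul_eq_mul,
        Finset.mul_sum, hΛ, Finset.sum_mul]
      rw [Finset.sum_comm]
      exact Finset.sum_congr rfl fun i _ => Finset.sum_congr rfl fun l _ => by ring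
    have hmx : ∀ t, ∑ l, μ t l * (x l : ℂ) = ∑ l, μ t l * (p l : ℂ) + m t (cpx y) := by
      intro t
      have : m t (cpx y) = ∑ l, μ t l * (linComb b' y l : ℂ) := by
        simp [hm, linCombC_cpx]
      rw [this, ← Finset.sum_add_distrib]
      refine Finset.sum_congr rfl fun l _ => ?_
      simp only [hxdef, PiLp.add_apply, ofReal_add]; ring
    have hpx : cpx p + linCombC b' (cpx y) = fun l => (x l : ℂ) := by
      rw [linCombC_cpx, ← map_add]; rfl
    have hfac : ∀ j, expFactor (Λ j) (σ j) (cpx y) =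
        cexp (-(α j : ℂ) / 2) * cexp ((((1 / 2 : ℂ)) • cdot (Λ j)) (cpx y)) *
        (cexp (((∑ l, lam j l * x l : ℝ) : ℂ) / 2) - cexp (2 * Real.pi * I * s j) *
          cexp (-(((∑ l, lam j l * x l : ℝ) : ℂ) / 2))) := by
      intro j
      simp only [hlx, expFactor, hσ, _root_.smul_apply, smul_eq_mul, mul_sub]
      congr 1
      · rw [← Complex.exp_add, ← Complex.exp_add]; congr 1; ring
      · rw [mul_left_comm, ← Complex.exp_add, ← Complex.exp_add, ← Complex.exp_add,
          ← Complex.exp_add]; congr 1; ring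
    have hmx' : ∀ t, cexp (∑ l, μ t l * (p l : ℂ)) * cexp (m t (cpx y)) =
        cexp (∑ l, μ t l * (x l : ℂ)) := fun t => by rw [← Complex.exp_add, ← hmx]
    simp only [expDen, hfac, Finset.prod_mul_distrib, hN, hpx, hmx']
    rw [← hx]
    ring

end Affine

/-! ### The term of one affine subspace; rationality of its direction -/

section SingleTerm

open ExpQuotient (StripNonvanishing)

variable {d n k : ℕ} {D : CoulombData d n} {ζ : Fin d → ℂ} {U : AffineSubspace ℝ (RealLie d)}
  {p : RealLie d} {w : RealLie d → ℂ}

/-- The twisted trace condition for the term of one affine subspace, up to polynomial factors that do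
not vanish on it. -/
def WeakTermTrace (D : CoulombData d n) (ζ : Fin d → ℂ) (U : AffineSubspace ℝ (RealLie d))
    (p : RealLie d) (w : RealLie d → ℂ) : Prop :=
  ∀ l : Fin d → ℤ, ∃ q : CPoly d, (∃ x ∈ U, MvPolynomial.eval (I • cpx x) q ≠ 0) ∧
    StripNonvanishing q (toReal l) ∧
    ∀ R : CPoly d, termIntegral U p w (shift l (R * (q * D.structConst (-l) l))) =
      CoulombBranch.phase ζ l * termIntegral U p w (R * (q * D.structConst (-l) l))

theorem affRestrict_ne_zero (hp : p ∈ U) (b : Module.Basis (Fin k) ℝ U.direction) {q : CPoly d}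
    (hq : ∃ x ∈ U, MvPolynomial.eval (I • cpx x) q ≠ 0) :
    affRestrict (fun j => (b j : RealLie d)) p q ≠ 0 := by
  obtain ⟨x, hx, hne⟩ := hq
  obtain ⟨y, rfl⟩ := exists_eq_add_linComb hp b hx
  exact fun h0 => hne ((affRestrict_eq_zero_iff _ _ _).1 h0 y)

theorem eq_zero_of_mul_eq_zero {V : RealLie k → ℂ} (hV : Continuous V) (hne : ∃ y, V y ≠ 0)
    {Q : CPoly k} (h : ∀ y, MvPolynomial.eval (I • cpx y) Q * V y = 0) : Q = 0 := by
  obtain ⟨y₀, hy₀⟩ := hne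
  obtain ⟨r, hr, hball⟩ := Metric.isOpen_iff.1 (isOpen_ne.preimage hV) y₀ hy₀
  by_contra hQ
  obtain ⟨z, hz⟩ := ExpQuotient.exists_eval_I_ne_zero hQ
  exact hz (eq_zero_of_real_ball (ExpQuotient.differentiable_eval_I _) hr
    (fun y hy => (mul_eq_zero.1 (h y)).resolve_right (hball hy)) z)

theorem eval_mul_eq_zero_of_integral {V : RealLie k → ℂ} (hV : Continuous V) (hd : ExpDecay V)
    {Q : CPoly k} (h : ∀ R : CPoly k, ∫ y, MvPolynomial.eval (I • cpx y) (R * Q) * V y = 0)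
    (y : RealLie k) : MvPolynomial.eval (I • cpx y) Q * V y = 0 := by
  refine (hd.eval_mul' Q).eq_zero_of_moments ?_ (fun a N => ?_) y
  · have : Continuous fun y : RealLie k => I • cpx y := by fun_prop
    exact ((continuous_eval Q).comp this).mul hV
  · rw [← h ((∑ j, MvPolynomial.C (-I * (a j : ℂ)) * MvPolynomial.X j) ^ N)]
    refine integral_congr_fun fun y => ?_
    rw [map_mul, mul_assoc]
    congr 1
    simp only [map_pow, map_sum, map_mul, MvPolynomial.eval_C, MvPolynomial.eval_X, Pi.smul_apply,
      cpx_apply, smul_eq_mul, PiLp.inner_apply, RCLike.inner_apply, conj_trivial, ofReal_sum, ofReal_mul]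
    congr 1
    refine Finset.sum_congr rfl fun j _ => ?_
    linear_combination ((a j : ℂ) * (y j : ℂ)) * I_mul_I

/-- A real linear form `f` as the polynomial `z ↦ f(-iz)`. -/
noncomputable def linPoly (f : RealLie d →ₗ[ℝ] ℝ) : CPoly d :=
  ∑ j, MvPolynomial.C (-I * (f (EuclideanSpace.single j 1) : ℂ)) * MvPolynomial.X j

theorem eval_linPoly (f : RealLie d →ₗ[ℝ] ℝ) (x l : RealLie d) (ξ : ℂ) :
    MvPolynomial.eval (I • (cpx x + ξ • cpx l)) (linPoly f) = f x + ξ * f l := by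
  have hfs : ∀ x : RealLie d, (f x : ℂ) = ∑ j, (f (EuclideanSpace.single j 1) : ℂ) * (x j : ℂ) := by
    intro x
    have h1 : x = ∑ j, x j • (EuclideanSpace.single j 1 : RealLie d) := by
      ext l
      simp only [WithLp.ofLp_sum, Finset.sum_apply, PiLp.smul_apply, smul_eq_mul,
        PiLp.single_apply, mul_ite, mul_one, mul_zero, Finset.sum_ite_eq, Finset.mem_univ, if_true]
    conv_lhs => rw [h1]
    rw [map_sum, ofReal_sum]
    refine Finset.sum_congr rfl fun j _ => ?_
    rw [map_smul, smul_eq_mul, ofReal_mul, mul_comm]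
  rw [hfs x, hfs l, Finset.mul_sum, ← Finset.sum_add_distrib, linPoly, map_sum]
  refine Finset.sum_congr rfl fun j _ => ?_
  simp only [map_mul, MvPolynomial.eval_C, MvPolynomial.eval_X, Pi.smul_apply, Pi.add_apply, cpx_apply,
    smul_eq_mul]
  linear_combination (-(f (EuclideanSpace.single j 1) : ℂ) * ((x j : ℂ) + ξ * l j)) * I_mul_I

theorem exists_linear_form_of_notMem {x : RealLie d} (hp : p ∈ U) (hx : x - p ∉ U.direction) :
    ∃ f : RealLie d →ₗ[ℝ] ℝ, f x ≠ f p ∧ ∀ y ∈ U, f y = f p := by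
  obtain ⟨f, hfl, hf⟩ := Submodule.exists_le_ker_of_notMem hx
  refine ⟨f, fun h => hfl (by rw [map_sub, h, sub_self]), fun y hy => ?_⟩
  have := hf (AffineSubspace.vsub_mem_direction hy hp)
  rw [LinearMap.mem_ker, vsub_eq_sub, map_sub, sub_eq_zero] at this
  exact this

/-- A polynomial that separates `i U` from its shift by a vector transversal to `U`. -/
theorem exists_separating_poly (hp : p ∈ U) {l : RealLie d} (hl : l ∉ U.direction) :
    ∃ (K : CPoly d) (a : ℂ), a ≠ 0 ∧ ∀ x ∈ U, MvPolynomial.eval (I • cpx x) K = a ∧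
      MvPolynomial.eval (I • cpx x + cpx l) K = 0 := by
  obtain ⟨f, hfl, hf⟩ := exists_linear_form_of_notMem (x := p + l) hp (by rwa [add_sub_cancel_left])
  rw [map_add, Ne, add_eq_left] at hfl
  refine ⟨linPoly f - MvPolynomial.C (f p - I * f l), I * f l,
    mul_ne_zero I_ne_zero (by exact_mod_cast hfl), fun x hx => ?_⟩
  constructor
  · have := eval_linPoly f x 0 0
    rw [zero_smul, add_zero] at this
    rw [map_sub, this, MvPolynomial.eval_C, hf x hx]
    ring
  · have h1 : I • cpx x + cpx l = I • (cpx x + (-I) • cpx l) := by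
      rw [smul_add, smul_smul, mul_neg, I_mul_I, neg_neg, one_smul]
    rw [h1, map_sub, eval_linPoly, MvPolynomial.eval_C, hf x hx]
    ring

/-- A cocharacter transversal to `U` is seen by a weight that is constant on `U`. -/
theorem WeakTermTrace.exists_factor_eq_zero (hT : WeakTermTrace D ζ U p w) (hp : p ∈ U)
    (hw : ContinuousOn w (U : Set (RealLie d))) (hd : ExpDecayOn U w) (hne : ∃ z ∈ U, w z ≠ 0)
    (b : Module.Basis (Fin k) ℝ U.direction) {l : Fin d → ℤ} (hl : l ∉ latticeIn U.direction) :
    ∃ i, affRestrict (fun j => (b j : RealLie d)) p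
      (factor (D.form i) (-pair (D.weight i) l) (pair (D.weight i) l)) = 0 := by
  obtain ⟨c, hc, hint⟩ := exists_termIntegral_eq b p
  obtain ⟨q, hq, -, hq'⟩ := hT l
  obtain ⟨K, a, ha, hK⟩ := exists_separating_poly hp hl
  set b' : Fin k → RealLie d := fun j => (b j : RealLie d) with hb'
  set V : RealLie k → ℂ := fun y => c * w (p + linComb b' y) with hVdef
  have hV : Continuous V := continuous_coord hp hw b c
  have hVd : ExpDecay V := expDecay_coord hp hd b c
  have hVne : ∃ y, V y ≠ 0 := by
    obtain ⟨z, hz, hzne⟩ := hne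
    obtain ⟨y, rfl⟩ := exists_eq_add_linComb hp b hz
    exact ⟨y, mul_ne_zero (by exact_mod_cast hc.ne') hzne⟩
  -- Test the identity on `K R`. The shifted side vanishes because `K = 0` on `iU + l`, and the
  -- other side is a nonzero constant times the integral of `R q P w`. So all moments of `q P w` on
  -- `U` vanish, and `w` is not identically zero.
  have hzero : affRestrict b' p (q * D.structConst (-l) l) = 0 := by
    refine eq_zero_of_mul_eq_zero hV hVne (eval_mul_eq_zero_of_integral hV hVd fun R' => ?_)
    obtain ⟨R, rfl⟩ := surjective_affRestrict (linearIndependent_coe_basis b) p R'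
    have h1 := hq' (K * R)
    rw [hint, hint] at h1
    have h2 : ∀ y, MvPolynomial.eval (I • cpx y)
        (affRestrict b' p (shift l (K * R * (q * D.structConst (-l) l)))) * V y = 0 := by
      intro y
      rw [eval_affRestrict_cpx, eval_shift, map_mul, map_mul, (hK _ (add_linComb_mem hp b y)).2]
      ring
    have h3 : ∀ y, MvPolynomial.eval (I • cpx y)
        (affRestrict b' p (K * R * (q * D.structConst (-l) l))) * V y =
        a * (MvPolynomial.eval (I • cpx y)
          (affRestrict b' p R * affRestrict b' p (q * D.structConst (-l) l)) * V y) := by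
      intro y
      rw [mul_assoc K, map_mul, map_mul, eval_affRestrict_cpx, (hK _ (add_linComb_mem hp b y)).1,
        map_mul (affRestrict b' p), mul_assoc]
    rw [integral_congr_fun h2, integral_congr_fun h3, integral_zero, integral_const_mul] at h1
    exact (mul_eq_zero.1 ((mul_eq_zero.1 h1.symm).resolve_left (phase_ne_zero ζ l))).resolve_left ha
  rw [map_mul, structConst_neg_left, map_prod] at hzero
  obtain ⟨i, -, hi⟩ := Finset.prod_eq_zero_iff.1
    ((mul_eq_zero.1 hzero).resolve_left (affRestrict_ne_zero hp b hq))
  exact ⟨i, hi⟩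

/-- Polynomials on `U` form a domain, so one affine factor `ξ + b - s(r + 1/2)` vanishes on `iU` and
`ξ` is constant on `U`. The product is not empty, so `ξ(l) ≠ 0`. -/
theorem weight_of_factor_eq_zero (b : Module.Basis (Fin k) ℝ U.direction) {l : Fin d → ℤ} {i : Fin n}
    (h : affRestrict (fun j => (b j : RealLie d)) p
      (factor (D.form i) (-pair (D.weight i) l) (pair (D.weight i) l)) = 0) :
    (∀ u ∈ U.direction, ∑ k, (D.weight i k : ℝ) * u k = 0) ∧ pair (D.weight i) l ≠ 0 := by
  rw [map_factor] at h
  obtain ⟨s, -, -, hs⟩ := factor_neg_left (affRestrict (fun j => (b j : RealLie d)) p (D.form i))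
    (pair (D.weight i) l)
  rw [hs, Finset.prod_eq_zero_iff] at h
  obtain ⟨r, hr, h⟩ := h
  refine ⟨fun u hu => ?_, fun h0 => by rw [h0] at hr; simp at hr⟩
  obtain ⟨y, rfl⟩ := exists_eq_linComb b hu
  have e : ∀ y, I * ∑ k, (D.weight i k : ℂ) *
      cpx (p + linComb (fun j => (b j : RealLie d)) y) k + D.flavor i - s * (r + 1 / 2) = 0 := by
    intro y
    have := congrArg (MvPolynomial.eval (I • cpx y)) h
    rwa [map_sub, eval_affRestrict_cpx, eval_form_I, MvPolynomial.algebraMap_eq, MvPolynomial.eval_C,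
      map_zero] at this
  have e1 := e y
  have e0 := e 0
  simp only [map_add, map_zero, add_zero, Pi.add_apply, mul_add, Finset.sum_add_distrib] at e0 e1
  have e2 : I * ∑ k, (D.weight i k : ℂ) * cpx (linComb (fun j => (b j : RealLie d)) y) k = 0 := by
    linear_combination e1 - e0
  have e3 := (mul_eq_zero.1 e2).resolve_left I_ne_zero
  have : ((∑ k, (D.weight i k : ℝ) * linComb (fun j => (b j : RealLie d)) y k : ℝ) : ℂ) = 0 := by
    rw [← e3]
    push_cast
    rfl
  exact_mod_cast this

/-- The direction of `U` is rational. -/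
theorem WeakTermTrace.span_latticeIn_eq (hT : WeakTermTrace D ζ U p w) (hp : p ∈ U)
    (hw : ContinuousOn w (U : Set (RealLie d))) (hd : ExpDecayOn U w) (hne : ∃ z ∈ U, w z ≠ 0) :
    Submodule.span ℝ (toReal '' (latticeIn U.direction : Set (Fin d → ℤ))) = U.direction := by
  refine _root_.span_latticeIn_eq (D := D) fun l hl => ?_
  obtain ⟨i, hi⟩ := hT.exists_factor_eq_zero hp hw hd hne (Module.finBasis ℝ U.direction) hl
  exact ⟨i, weight_of_factor_eq_zero _ hi⟩

end SingleTerm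

/-! ### Compatibility of restriction with shifts, structure constants and twists -/

section Restriction

open CoulombBranch

variable {d n k : ℕ} {D : CoulombData d n} {W : Submodule ℝ (RealLie d)}
  (B : Module.Basis (Fin k) ℤ (latticeIn W)) (p : RealLie d)

theorem restrictPoly_eq_affRestrict :
    restrictPoly B p = affRestrict (fun j => toReal (B j : Fin d → ℤ)) p := by
  refine MvPolynomial.algHom_ext fun l => ?_
  simp [restrictPoly, affRestrict, toReal]

theorem latticePoint_eq (a : Fin k → ℤ) :
    latticePoint B a = ((B.equivFun.symm a : latticeIn W) : Fin d → ℤ) := by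
  rw [Module.Basis.equivFun_symm_apply, latticePoint]
  simp

theorem latticePoint_mem (a : Fin k → ℤ) : latticePoint B a ∈ latticeIn W := by
  rw [latticePoint_eq]; exact Subtype.property _

theorem latticePoint_equivFun {l : Fin d → ℤ} (hl : l ∈ latticeIn W) :
    latticePoint B (B.equivFun ⟨l, hl⟩) = l := by
  rw [latticePoint_eq, LinearEquiv.symm_apply_apply]

theorem latticePoint_add (a a' : Fin k → ℤ) :
    latticePoint B (a + a') = latticePoint B a + latticePoint B a' := by
  simp [latticePoint, add_smul, Finset.sum_add_distrib]

theorem latticePoint_neg (a : Fin k → ℤ) : latticePoint B (-a) = -latticePoint B a := by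
  simp [latticePoint]

theorem toReal_latticePoint (a : Fin k → ℤ) :
    toReal (latticePoint B a) = linComb (fun j => toReal (B j : Fin d → ℤ)) (toReal a) := by
  rw [latticePoint, toReal_sum, linComb_apply]
  exact Finset.sum_congr rfl fun j _ => toReal_zsmul _ _

theorem realPoint_eq (x : RealLie k) :
    realPoint B p x = p + linComb (fun j => toReal (B j : Fin d → ℤ)) x := by
  rw [realPoint, linComb_apply]

theorem pair_restrict_weight (i : Fin n) (a : Fin k → ℤ) :
    pair ((D.restrict B p).weight i) a = pair (D.weight i) (latticePoint B a) := by
  simp only [pair, CoulombData.restrict, latticePoint, Finset.sum_apply, Pi.smul_apply, smul_eq_mul,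
    Finset.sum_mul, Finset.mul_sum]
  rw [Finset.sum_comm]
  exact Finset.sum_congr rfl fun _ _ => Finset.sum_congr rfl fun _ _ => by ring

theorem restrictPoly_form (i : Fin n) : restrictPoly B p (D.form i) = (D.restrict B p).form i := by
  refine MvPolynomial.funext fun z => ?_
  rw [restrictPoly_eq_affRestrict, eval_affRestrict, eval_form, eval_form]
  simp only [CoulombData.restrict, pair, Pi.add_apply, Pi.smul_apply, cpx_apply, smul_eq_mul, mul_add,
    Finset.sum_add_distrib, linCombC_apply, Finset.sum_apply, Finset.mul_sum]
  have h1 : ∑ j, ∑ l, (D.weight i j : ℂ) * (z l * ((toReal (B l : Fin d → ℤ) j : ℝ) : ℂ)) =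
      ∑ l, ((∑ j, D.weight i j * (B l : Fin d → ℤ) j : ℤ) : ℂ) * z l := by
    rw [Finset.sum_comm]
    refine Finset.sum_congr rfl fun l _ => ?_
    push_cast
    rw [Finset.sum_mul]
    refine Finset.sum_congr rfl fun j _ => ?_
    simp only [toReal, ofReal_intCast]; ring
  rw [h1]
  have h2 : ∑ j, (D.weight i j : ℂ) * (I * (p j : ℂ)) = ∑ j, I * ((D.weight i j : ℂ) * (p j : ℂ)) :=
    Finset.sum_congr rfl fun j _ => by ring
  rw [h2]; ring

theorem restrictPoly_structConst (a a' : Fin k → ℤ) :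
    restrictPoly B p (D.structConst (latticePoint B a) (latticePoint B a')) =
      (D.restrict B p).structConst a a' := by
  simp only [CoulombData.structConst, map_prod, map_factor, restrictPoly_form, pair_restrict_weight]

theorem restrictPoly_shift (a : Fin k → ℤ) (R : CPoly d) :
    restrictPoly B p (shift (latticePoint B a) R) = shift a (restrictPoly B p R) := by
  refine MvPolynomial.funext fun z => ?_
  rw [restrictPoly_eq_affRestrict, eval_affRestrict, eval_shift, eval_shift, eval_affRestrict, map_add,
    linCombC_cpx, toReal_latticePoint, add_assoc]

theorem phase_restrictTwist (ζ : Fin d → ℂ) (a : Fin k → ℤ) :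
    phase (restrictTwist B ζ) a = phase ζ (latticePoint B a) := by
  simp only [phase, restrictTwist, latticePoint, Finset.sum_apply, Pi.smul_apply, smul_eq_mul]
  congr 2
  push_cast
  simp only [Finset.sum_mul, Finset.mul_sum]
  rw [Finset.sum_comm]
  exact Finset.sum_congr rfl fun _ _ => Finset.sum_congr rfl fun _ _ => by ring

end Restriction

/-! ### Weight function and exact trace condition of one term -/

section TermWeight

open CoulombBranch
open ExpQuotient (StripNonvanishing)

variable {d n k : ℕ} {D : CoulombData d n} {ζ : Fin d → ℂ} {U : AffineSubspace ℝ (RealLie d)}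
  {p : RealLie d} {w : RealLie d → ℂ}

/-- The integral over `U` is linear in the polynomial. -/
theorem exists_linear_termIntegral (hp : p ∈ U) (hw : ContinuousOn w (U : Set (RealLie d)))
    (hd : ExpDecayOn U w) : ∃ t : CPoly d →ₗ[ℂ] ℂ, ∀ R, t R = termIntegral U p w R := by
  set b := Module.finBasis ℝ U.direction
  obtain ⟨c, hc, hint⟩ := exists_termIntegral_eq b p
  have hI : ∀ R : CPoly d, Integrable fun y => MvPolynomial.eval (I • cpx y)
      (affRestrict (fun j => (b j : RealLie d)) p R) *
        (c * w (p + linComb (fun j => (b j : RealLie d)) y)) := by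
    intro R
    have : Continuous fun y : RealLie (Module.finrank ℝ U.direction) => I • cpx y := by fun_prop
    exact ((expDecay_coord hp hd b c).eval_mul' _).integrable
      (((continuous_eval _).comp this).mul (continuous_coord hp hw b c))
  refine ⟨{ toFun := termIntegral U p w, map_add' := fun R R' => ?_, map_smul' := fun a R => ?_ },
    fun R => rfl⟩
  · rw [hint, hint, hint, ← integral_add (hI R) (hI R')]
    refine integral_congr_fun fun y => ?_
    rw [map_add, map_add]; ring
  · rw [hint, hint, RingHom.id_apply, smul_eq_mul, ← integral_const_mul]
    refine integral_congr_fun fun y => ?_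
    rw [map_smul, MvPolynomial.smul_eval]; ring

theorem coe_realBasis_fun
    (hW : Submodule.span ℝ (toReal '' (latticeIn U.direction : Set (Fin d → ℤ))) = U.direction)
    (B : Module.Basis (Fin k) ℤ (latticeIn U.direction)) :
    (fun j => (realBasis hW B j : RealLie d)) = fun j => toReal (B j : Fin d → ℤ) :=
  funext (coe_realBasis hW B)

/-- The condition in the coordinates of a basis of the lattice. -/
theorem WeakTermTrace.weakTraceIdentity (hT : WeakTermTrace D ζ U p w) (hp : p ∈ U)
    (hW : Submodule.span ℝ (toReal '' (latticeIn U.direction : Set (Fin d → ℤ))) = U.direction)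
    (B : Module.Basis (Fin k) ℤ (latticeIn U.direction)) {V : RealLie k → ℂ}
    (hV : ∀ R, termIntegral U p w R =
      ∫ y, MvPolynomial.eval (I • cpx y) (restrictPoly B p R) * V y) :
    WeakTraceIdentity (D.restrict B p) (restrictTwist B ζ) V := by
  intro a ha
  obtain ⟨q, hq, hstrip, hq'⟩ := hT (latticePoint B a)
  have hne := affRestrict_ne_zero hp (realBasis hW B) hq
  rw [coe_realBasis_fun hW B, ← restrictPoly_eq_affRestrict] at hne
  refine ⟨restrictPoly B p q, hne, fun y hy ξ h1 h2 => ?_, fun R' => ?_⟩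
  · rw [restrictPoly_eq_affRestrict] at hy ⊢
    rw [eval_affRestrict_cpx] at hy
    rw [eval_affRestrict_line, ← toReal_latticePoint]
    exact hstrip _ hy ξ h1 h2
  · have hsurj := surjective_affRestrict (linearIndependent_coe_basis (realBasis hW B)) p
    rw [coe_realBasis_fun hW B, ← restrictPoly_eq_affRestrict] at hsurj
    obtain ⟨R, rfl⟩ := hsurj R'
    have h := hq' R
    rw [hV, hV, ← latticePoint_neg, restrictPoly_shift, map_mul (restrictPoly B p),
      map_mul (restrictPoly B p), restrictPoly_structConst, ← phase_restrictTwist] at h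
    simpa only [eval_shift] using h

theorem integral_realLie {F : RealLie k → ℂ} :
    ∫ y, F y = ∫ x : Fin k → ℝ, F (WithLp.toLp 2 x) :=
  ((EuclideanSpace.volume_preserving_symm_measurableEquiv_toLp (Fin k)).integral_comp'
    (f := (MeasurableEquiv.toLp 2 (Fin k → ℝ)).symm) (g := fun x => F (WithLp.toLp 2 x)))

theorem WeakTermTrace.exists_traceWeight (hT : WeakTermTrace D ζ U p w) (hp : p ∈ U)
    (hw : IsExpFractionOn U w) (hd : ExpDecayOn U w)
    (hW : Submodule.span ℝ (toReal '' (latticeIn U.direction : Set (Fin d → ℤ))) = U.direction)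
    (B : Module.Basis (Fin k) ℤ (latticeIn U.direction)) :
    ∃ (c : ℝ) (v : (Fin k → ℂ) → ℂ) (t : CPoly k →ₗ[ℂ] ℂ), 0 < c ∧
      (∀ x : Fin k → ℝ, v (fun j => (x j : ℂ)) = c * w (realPoint B p x)) ∧
      IsTraceWeight (D.restrict B p) (restrictTwist B ζ) v ∧
      (∀ Q, t Q = ∫ x : Fin k → ℝ, MvPolynomial.eval (fun j => I * (x j : ℂ)) Q *
        v (fun j => (x j : ℂ))) ∧
      (∀ R, termIntegral U p w R = t (restrictPoly B p R)) ∧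
      ∀ (a : Fin k → ℤ) (Q : CPoly k), t (shift a (Q * (D.restrict B p).structConst (-a) a)) =
        phase (restrictTwist B ζ) a * t (Q * (D.restrict B p).structConst (-a) a) := by
  obtain ⟨c, hc, hint⟩ := exists_termIntegral_eq (realBasis hW B) p
  obtain ⟨J, N, Λ, σ, hE⟩ := exists_expQuotient hp hw hd (realBasis hW B) c
  rw [coe_realBasis_fun hW B] at hint hE
  set V : RealLie k → ℂ := fun y => c * w (p + linComb (fun j => toReal (B j : Fin d → ℤ)) y) with hV
  have hVint : ∀ R, termIntegral U p w R =
      ∫ y, MvPolynomial.eval (I • cpx y) (restrictPoly B p R) * V y := by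
    intro R
    rw [restrictPoly_eq_affRestrict]
    exact hint w R
  have hweak := hT.weakTraceIdentity hp hW B hVint
  obtain ⟨v, hv, htw⟩ := hweak.exists_weight hE
  have hI : ∀ Q : CPoly k, Integrable fun y => MvPolynomial.eval (I • cpx y) Q * V y := by
    intro Q
    have : Continuous fun y : RealLie k => I • cpx y := by fun_prop
    exact (hE.decay.eval_mul' _).integrable (((continuous_eval _).comp this).mul hE.cont)
  refine ⟨c, v, { toFun := fun Q => ∫ y, MvPolynomial.eval (I • cpx y) Q * V y
                  map_add' := fun Q Q' => ?_
                  map_smul' := fun a Q => ?_ }, hc, fun x => ?_, htw, fun Q => ?_, hVint, fun a Q => ?_⟩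
  · rw [← integral_add (hI Q) (hI Q')]
    refine integral_congr_fun fun y => ?_
    rw [map_add]; ring
  · rw [RingHom.id_apply, smul_eq_mul, ← integral_const_mul]
    refine integral_congr_fun fun y => ?_
    rw [MvPolynomial.smul_eval]; ring
  · have := hv (WithLp.toLp 2 x)
    rw [hV] at this
    simp only [← realPoint_eq] at this
    exact this
  · change ∫ y, MvPolynomial.eval (I • cpx y) Q * V y = _
    rw [integral_realLie]
    refine integral_congr_fun fun x => ?_
    rw [← hv]
    rfl
  · have := hweak.mvShiftIdentity hE a Q
    change ∫ y, MvPolynomial.eval (I • cpx y) (shift a _) * V y = _ * ∫ y, _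
    simpa only [eval_shift] using this

/-- The twisted trace condition for the term of one affine subspace. -/
theorem WeakTermTrace.shift_eq (hT : WeakTermTrace D ζ U p w) (hp : p ∈ U)
    (hw : IsExpFractionOn U w) (hd : ExpDecayOn U w) (l : Fin d → ℤ) (R : CPoly d) :
    termIntegral U p w (shift l (R * D.structConst (-l) l)) =
      phase ζ l * termIntegral U p w (R * D.structConst (-l) l) := by
  by_cases hne : ∃ z ∈ U, w z ≠ 0
  swap
  · push Not at hne
    have h0 : ∀ R, termIntegral U p w R = 0 := by
      intro R
      rw [termIntegral, ← integral_zero]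
      refine integral_congr_fun fun u => ?_
      have : w ((u : RealLie d) + p) = 0 := hne _ (AffineSubspace.vadd_mem_of_mem_direction u.2 hp)
      rw [this, mul_zero]
    rw [h0, h0, mul_zero]
  have hW := hT.span_latticeIn_eq hp hw.1 hd hne
  by_cases hl : l ∈ latticeIn U.direction
  · obtain ⟨B⟩ := nonempty_basis_latticeIn hW
    obtain ⟨c, v, t, -, -, -, -, ht, hs⟩ := hT.exists_traceWeight hp hw hd hW B
    rw [ht, ht]
    obtain ⟨a, rfl⟩ : ∃ a, latticePoint B a = l := ⟨_, latticePoint_equivFun B hl⟩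
    rw [← latticePoint_neg, restrictPoly_shift, map_mul (restrictPoly B p), restrictPoly_structConst,
      ← phase_restrictTwist]
    exact hs a _
  -- For `l` transversal to `U` both sides are zero: the two structure constants, of `(-l, l)` and
  -- of `(l, -l)`, vanish on `iU`, and the shift by `l` takes the first to the second.
  · set b := Module.finBasis ℝ U.direction
    obtain ⟨c, hc, hint⟩ := exists_termIntegral_eq b p
    have h0 : ∀ l ∉ latticeIn U.direction,
        affRestrict (fun j => (b j : RealLie d)) p (D.structConst (-l) l) = 0 := by
      intro l hl
      obtain ⟨i, hi⟩ := hT.exists_factor_eq_zero hp hw.1 hd hne b hl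
      rw [structConst_neg_left, map_prod]
      exact Finset.prod_eq_zero (Finset.mem_univ i) hi
    have h1 := h0 l hl
    have h2 := h0 (-l) (fun h => hl (by simpa using neg_mem h))
    rw [neg_neg] at h2
    rw [hint, hint, map_mul (shift l), shift_structConst_neg, map_mul (affRestrict _ p),
      map_mul (affRestrict _ p), h1, h2]
    simp

end TermWeight

/-! ### Separation of the terms -/

section Separation

open CoulombBranch
open ExpQuotient (StripNonvanishing)

variable {d n : ℕ} {D : CoulombData d n} {ζ : Fin d → ℂ}

theorem ExpQuotient.StripNonvanishing.prod {ι : Type*} (s : Finset ι) {q : ι → CPoly d} {l : RealLie d}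
    (h : ∀ i ∈ s, StripNonvanishing (q i) l) : StripNonvanishing (∏ i ∈ s, q i) l := by
  intro x hx ξ h1 h2
  rw [map_prod, Finset.prod_ne_zero_iff] at hx ⊢
  exact fun i hi => h i hi x (hx i hi) ξ h1 h2

theorem ExpQuotient.StripNonvanishing.mul {q q' : CPoly d} {l : RealLie d}
    (h : StripNonvanishing q l) (h' : StripNonvanishing q' l) : StripNonvanishing (q * q') l := by
  intro x hx ξ h1 h2
  rw [map_mul, mul_ne_zero_iff] at hx ⊢
  exact ⟨h x hx.1 ξ h1 h2, h' x hx.2 ξ h1 h2⟩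

theorem real_add_mul_ne_zero {a b : ℝ} {ξ ξ' : ℂ} (hξ : ξ.im ≠ 0) (h : (a : ℂ) + ξ' * b ≠ 0) :
    (a : ℂ) + ξ * b ≠ 0 := by
  intro h0
  have h1 := congrArg Complex.im h0
  simp only [add_im, ofReal_im, mul_im, ofReal_re, mul_zero, zero_add, zero_im] at h1
  have hb : b = 0 := (mul_eq_zero.1 h1).resolve_left hξ
  rw [hb, ofReal_zero, mul_zero] at h h0
  exact h h0

/-- A polynomial factor that annihilates the trace condition on `U'` but is harmless on `U`. -/
theorem exists_annihilator {U U' : AffineSubspace ℝ (RealLie d)} (hU : ¬U ≤ U') {p' : RealLie d}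
    (hp' : p' ∈ U') (l : Fin d → ℤ) :
    ∃ q : CPoly d, (∃ x ∈ U, MvPolynomial.eval (I • cpx x) q ≠ 0) ∧ StripNonvanishing q (toReal l) ∧
      ∀ x ∈ U', MvPolynomial.eval (I • cpx x) q = 0 ∧
        MvPolynomial.eval (I • cpx x) (shift l q) = 0 := by
  obtain ⟨x, hx, hxU'⟩ := SetLike.not_le_iff_exists.1 hU
  obtain ⟨f, hfx, hf⟩ := exists_linear_form_of_notMem (x := x) hp' (fun h => hxU' (by
    have := AffineSubspace.vadd_mem_of_mem_direction h hp'
    rwa [vadd_eq_add, sub_add_cancel] at this))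
  set H : CPoly d := linPoly f - MvPolynomial.C (f p' : ℂ) with hH
  have hHe : ∀ (y a : RealLie d) (ξ : ℂ), MvPolynomial.eval (I • (cpx y + ξ • cpx a)) H =
      ((f y - f p' : ℝ) : ℂ) + ξ * f a := by
    intro y a ξ
    rw [hH, map_sub, eval_linPoly, MvPolynomial.eval_C]
    push_cast; ring
  have hHe0 : ∀ y : RealLie d, MvPolynomial.eval (I • cpx y) H = ((f y - f p' : ℝ) : ℂ) := by
    intro y
    have := hHe y 0 0
    rwa [zero_smul, add_zero, zero_mul, add_zero] at this
  have hshift : ∀ (y : RealLie d) (ξ : ℂ),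
      MvPolynomial.eval (I • (cpx y + ξ • cpx (toReal l))) (shift (-l) H) =
      ((f y - f p' : ℝ) : ℂ) + (ξ + I) * f (toReal l) := by
    intro y ξ
    rw [eval_shift, ← hHe]
    congr 1
    have : cpx (toReal (-l)) = -cpx (toReal l) := by ext k; simp [toReal]
    rw [this, add_smul, smul_add, smul_add, smul_add, smul_smul I I, I_mul_I, neg_one_smul, add_assoc]
  have hshift0 : ∀ y : RealLie d, MvPolynomial.eval (I • cpx y) (shift (-l) H) =
      ((f y - f p' : ℝ) : ℂ) + I * f (toReal l) := by
    intro y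
    have := hshift y 0
    rwa [zero_smul, add_zero, zero_add] at this
  -- The first factor vanishes on `iU'`; the second becomes `H` after the shift by `l`, so it makes
  -- the shifted product vanish there. Along `x + ξ l` the zeros of the two factors lie on `Im ξ =
  -- 0` and `Im ξ = -1`, unless a factor vanishes identically; hence the open strip is free of
  -- zeros.
  refine ⟨H * shift (-l) H, ⟨x, hx, ?_⟩, ExpQuotient.StripNonvanishing.mul ?_ ?_, fun y hy => ⟨?_, ?_⟩⟩
  · rw [map_mul, hHe0, hshift0]
    have h1 : ((f x - f p' : ℝ) : ℂ) + 0 * f (toReal l) ≠ 0 := by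
      rw [zero_mul, add_zero]
      exact_mod_cast sub_ne_zero.2 hfx
    refine mul_ne_zero (by simpa using h1) (real_add_mul_ne_zero (by simp) h1)
  · intro y hy ξ h1 h2
    rw [hHe]
    refine real_add_mul_ne_zero h2.ne (ξ' := 0) ?_
    rwa [zero_mul, add_zero, ← hHe0]
  · intro y hy ξ h1 h2
    rw [hshift]
    rw [hshift0] at hy
    exact real_add_mul_ne_zero (by simp only [add_im, I_im]; linarith) hy
  · rw [map_mul, hHe0, hf y hy]; simp
  · rw [map_mul (shift l), ← shift_add, add_neg_cancel, shift_zero, map_mul, hHe0, hf y hy]; simp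

/-- The points at which the factors do not vanish may differ, but restriction to `U` lands in a
polynomial ring, which is a domain. -/
theorem exists_eval_prod_ne_zero {U : AffineSubspace ℝ (RealLie d)} {p : RealLie d} (hp : p ∈ U)
    {ι : Type*} (s : Finset ι) {q : ι → CPoly d}
    (h : ∀ i ∈ s, ∃ x ∈ U, MvPolynomial.eval (I • cpx x) (q i) ≠ 0) :
    ∃ x ∈ U, MvPolynomial.eval (I • cpx x) (∏ i ∈ s, q i) ≠ 0 := by
  by_contra! hcon
  have b := Module.finBasis ℝ U.direction
  have h0 : affRestrict (fun j => (b j : RealLie d)) p (∏ i ∈ s, q i) = 0 :=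
    (affRestrict_eq_zero_iff _ _ _).2 fun y => hcon _ (add_linComb_mem hp b y)
  rw [map_prod, Finset.prod_eq_zero_iff] at h0
  obtain ⟨i, hi, h0⟩ := h0
  exact affRestrict_ne_zero hp b (h i hi) h0

variable {ι : Type*} [Fintype ι] {U : ι → AffineSubspace ℝ (RealLie d)} {p : ι → RealLie d}
  {w : ι → RealLie d → ℂ}

theorem termIntegral_eq_zero {U : AffineSubspace ℝ (RealLie d)} {p : RealLie d} (hp : p ∈ U)
    (w : RealLie d → ℂ) {R : CPoly d} (h : ∀ x ∈ U, MvPolynomial.eval (I • cpx x) R = 0) :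
    termIntegral U p w R = 0 := by
  rw [termIntegral, ← integral_zero]
  refine integral_congr_fun fun u => ?_
  have hm : (u : RealLie d) + p ∈ U := AffineSubspace.vadd_mem_of_mem_direction u.2 hp
  have e : (fun k => I * (((u : RealLie d) + p) k : ℂ)) = I • cpx ((u : RealLie d) + p) := by
    ext k; simp
  rw [e, h _ hm, zero_mul]

/-- The twisted trace condition for the sum implies that of each term. -/
theorem weakTermTrace_of_sum (hU : Function.Injective U) (hp : ∀ i, p i ∈ U i)
    (hw : ∀ i, IsExpFractionOn (U i) (w i)) (hd : ∀ i, ExpDecayOn (U i) (w i))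
    (hsum : ∀ (l : Fin d → ℤ) (R : CPoly d),
      ∑ i, termIntegral (U i) (p i) (w i) (shift l (R * D.structConst (-l) l)) =
        phase ζ l * ∑ i, termIntegral (U i) (p i) (w i) (R * D.structConst (-l) l)) (i : ι) :
    WeakTermTrace D ζ (U i) (p i) (w i) := by
  classical
  -- The induction treats larger subspaces first: they cannot be annihilated without annihilating
  -- the smaller one.
  have hwf : WellFounded fun i j => U j < U i :=
    have : IsTrans ι fun i j => U j < U i := ⟨fun _ _ _ h h' => h'.trans h⟩
    have : Std.Irrefl fun i j => U j < U i := ⟨fun _ => lt_irrefl _⟩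
    Finite.wellFounded_of_trans_of_irrefl _
  induction i using hwf.induction with
  | _ i ih =>
  intro l
  have hq : ∀ j, ∃ q : CPoly d, ¬U i ≤ U j →
      (∃ x ∈ U i, MvPolynomial.eval (I • cpx x) q ≠ 0) ∧ StripNonvanishing q (toReal l) ∧
      ∀ x ∈ U j, MvPolynomial.eval (I • cpx x) q = 0 ∧
        MvPolynomial.eval (I • cpx x) (shift l q) = 0 := by
    intro j
    by_cases hj : U i ≤ U j
    · exact ⟨0, fun h => absurd hj h⟩
    · obtain ⟨q, hq⟩ := exists_annihilator hj (hp j) l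
      exact ⟨q, fun _ => hq⟩
  choose q hq using hq
  set s := Finset.univ.filter fun j => ¬U i ≤ U j with hs
  have hmem : ∀ j ∈ s, ¬U i ≤ U j := fun j hj => (Finset.mem_filter.1 hj).2
  refine ⟨∏ j ∈ s, q j, exists_eval_prod_ne_zero (hp i) s fun j hj => (hq j (hmem j hj)).1,
    ExpQuotient.StripNonvanishing.prod s fun j hj => (hq j (hmem j hj)).2.1, fun R => ?_⟩
  have h := hsum l (R * ∏ j ∈ s, q j)
  rw [mul_assoc] at h
  rw [← Finset.add_sum_erase _ _ (Finset.mem_univ i), ← Finset.add_sum_erase _ _ (Finset.mem_univ i),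
    mul_add, Finset.mul_sum] at h
  -- Subspaces that contain `U i` are strictly larger, because the `U j` are distinct, and satisfy
  -- the exact identity by induction. The others contribute zero on both sides because of the factor
  -- `q j`.
  have hrest : ∀ j ∈ Finset.univ.erase i,
      termIntegral (U j) (p j) (w j) (shift l (R * ((∏ j ∈ s, q j) * D.structConst (-l) l))) =
      phase ζ l * termIntegral (U j) (p j) (w j) (R * ((∏ j ∈ s, q j) * D.structConst (-l) l)) := by
    intro j hj
    by_cases hle : U i ≤ U j
    · have := (ih j (lt_of_le_of_ne hle fun e => (Finset.mem_erase.1 hj).1 (hU e).symm)).shift_eq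
        (hp j) (hw j) (hd j) l (R * ∏ j ∈ s, q j)
      rwa [mul_assoc] at this
    · have hjs : j ∈ s := Finset.mem_filter.2 ⟨Finset.mem_univ j, hle⟩
      obtain ⟨-, -, h0⟩ := hq j hle
      rw [← Finset.mul_prod_erase s q hjs, termIntegral_eq_zero (hp j) _ fun x hx => ?_,
        termIntegral_eq_zero (hp j) _ fun x hx => ?_, mul_zero]
      · simp only [map_mul, (h0 x hx).1, zero_mul, mul_zero]
      · simp only [map_mul, (h0 x hx).2, zero_mul, mul_zero]
  rw [Finset.sum_congr rfl hrest] at h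
  exact add_right_cancel h

end Separation

/-! ### The homomorphism to the Coulomb branch of the sublattice -/

section RestrictHom

open CoulombBranch

variable {d n k : ℕ} {D : CoulombData d n} {W : Submodule ℝ (RealLie d)}
  (B : Module.Basis (Fin k) ℤ (latticeIn W)) (p : RealLie d)

open Classical in
/-- The linear map underlying `restrictHom`. -/
noncomputable def restrictLin (D : CoulombData d n) :
    CoulombBranch D →ₗ[ℂ] CoulombBranch (D.restrict B p) :=
  Finsupp.lsum ℂ fun l => if hl : l ∈ latticeIn W then
    mono (D.restrict B p) (B.equivFun ⟨l, hl⟩) ∘ₗ (restrictPoly B p).toLinearMap else 0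

theorem restrictLin_mono_of_notMem {l : Fin d → ℤ} (hl : l ∉ latticeIn W) (f : CPoly d) :
    restrictLin B p D (mono D l f) = 0 := by
  unfold restrictLin
  conv_lhs => unfold mono
  erw [Finsupp.lsum_single]
  rw [dif_neg hl, LinearMap.zero_apply]

theorem equivFun_latticePoint (a : Fin k → ℤ) (h : latticePoint B a ∈ latticeIn W) :
    B.equivFun ⟨latticePoint B a, h⟩ = a := by
  have : (⟨latticePoint B a, h⟩ : latticeIn W) = B.equivFun.symm a := Subtype.ext (latticePoint_eq B a)
  rw [this, LinearEquiv.apply_symm_apply]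

theorem restrictLin_mono_latticePoint (a : Fin k → ℤ) (f : CPoly d) :
    restrictLin B p D (mono D (latticePoint B a) f) =
      mono (D.restrict B p) a (restrictPoly B p f) := by
  unfold restrictLin
  conv_lhs => unfold mono
  erw [Finsupp.lsum_single]
  rw [dif_pos (latticePoint_mem B a), equivFun_latticePoint]
  rfl

theorem latticePoint_zero : latticePoint B 0 = 0 := by simp [latticePoint]

/-- A weight that vanishes on the lattice kills the products that leave it and come back. -/
theorem restrictPoly_structConst_eq_zero
    (h : ∀ l ∉ latticeIn W, ∃ i, (∀ l' ∈ latticeIn W, pair (D.weight i) l' = 0) ∧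
      restrictPoly B p (factor (D.form i) (-pair (D.weight i) l) (pair (D.weight i) l)) = 0)
    {l l' : Fin d → ℤ} (hl' : l' ∉ latticeIn W) (hadd : l + l' ∈ latticeIn W) :
    restrictPoly B p (D.structConst l l') = 0 := by
  obtain ⟨i, hi, hi0⟩ := h l' hl'
  have h1 := hi _ hadd
  rw [pair_add] at h1
  rw [CoulombData.structConst, map_prod]
  refine Finset.prod_eq_zero (Finset.mem_univ i) ?_
  rw [eq_neg_of_add_eq_zero_left h1]
  exact hi0

/-- The restriction of the Coulomb branch to a sublattice. -/
noncomputable def restrictHom (D : CoulombData d n)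
    (h : ∀ l ∉ latticeIn W, ∃ i, (∀ l' ∈ latticeIn W, pair (D.weight i) l' = 0) ∧
      restrictPoly B p (factor (D.form i) (-pair (D.weight i) l) (pair (D.weight i) l)) = 0) :
    CoulombBranch D →ₐ[ℂ] CoulombBranch (D.restrict B p) :=
  AlgHom.ofLinearMap (restrictLin B p D)
    (by
      rw [one_def, ← latticePoint_zero B, restrictLin_mono_latticePoint, map_one]
      rfl)
    (fun a b => by
      refine induct a (fun a a' h h' => ?_) fun l f => ?_
      · rw [add_mul, map_add, h, h', map_add, add_mul]
      refine induct b (fun b b' h h' => ?_) fun l' g => ?_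
      · rw [mul_add, map_add, h, h', map_add, mul_add]
      rw [mono_mul_mono]
      by_cases hl' : l' ∈ latticeIn W
      · by_cases hl : l ∈ latticeIn W
        · rw [← latticePoint_equivFun B hl, ← latticePoint_equivFun B hl', ← latticePoint_add,
            restrictLin_mono_latticePoint, restrictLin_mono_latticePoint, restrictLin_mono_latticePoint,
            mono_mul_mono, map_mul (restrictPoly B p),
            map_mul (restrictPoly B p), restrictPoly_shift, restrictPoly_structConst]
        · rw [restrictLin_mono_of_notMem B p hl, zero_mul]
          exact restrictLin_mono_of_notMem B p (fun h => hl (by simpa using sub_mem h hl')) _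
      · rw [restrictLin_mono_of_notMem B p hl', mul_zero]
        -- The essential case of multiplicativity: a product that leaves the lattice and returns.
        -- Its image must be zero, and it is because the structure constant vanishes on `iU`.
        by_cases hadd : l + l' ∈ latticeIn W
        · rw [← latticePoint_equivFun B hadd, restrictLin_mono_latticePoint, map_mul (restrictPoly B p),
            restrictPoly_structConst_eq_zero B p h hl' hadd, mul_zero, map_zero]
        · exact restrictLin_mono_of_notMem B p hadd _)

theorem r_mul_ofPoly (l : Fin d → ℤ) (R : CPoly d) : r D l * ofPoly D R = mono D l (shift l R) := by
  rw [r, ofPoly, mono_mul_mono, add_zero, one_mul, structConst_zero_right, mul_one]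

theorem surjective_restrictLin (h : Function.Surjective (restrictPoly B p)) :
    Function.Surjective (restrictLin B p D) := by
  intro x
  refine induct x ?_ fun a f => ?_
  · rintro _ _ ⟨x, rfl⟩ ⟨y, rfl⟩
    exact ⟨x + y, map_add _ _ _⟩
  · obtain ⟨g, rfl⟩ := h f
    exact ⟨mono D (latticePoint B a) g, restrictLin_mono_latticePoint B p a g⟩

end RestrictHom

open AbelianCoulomb.CoulombBranch in
/-- The data attached to one affine subspace on which the integrand does not vanish. -/
theorem WeakTermTrace.exists_restrictHom {d n k : ℕ} {D : CoulombData d n} {ζ : Fin d → ℂ}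
    {U : AffineSubspace ℝ (RealLie d)} {p : RealLie d} {w : RealLie d → ℂ}
    (hT : WeakTermTrace D ζ U p w) (hp : p ∈ U) (hw : IsExpFractionOn U w) (hd : ExpDecayOn U w)
    (hne : ∃ z ∈ U, w z ≠ 0) {S : CoulombBranch D →ₗ[ℂ] ℂ} (hS : IsTwistedTrace ζ S)
    (hSint : ∀ R, S (ofPoly D R) = termIntegral U p w R)
    (B : Module.Basis (Fin k) ℤ (latticeIn U.direction)) :
    ∃ φ : CoulombBranch D →ₐ[ℂ] CoulombBranch (D.restrict B p), Function.Surjective φ ∧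
      (∀ l ∉ latticeIn U.direction, ∀ R : CPoly d, φ (r D l * ofPoly D R) = 0) ∧
      (∀ a R, φ (r D (latticePoint B a) * ofPoly D R) =
        r (D.restrict B p) a * ofPoly (D.restrict B p) (restrictPoly B p R)) ∧
      ∃ (c : ℝ) (v : (Fin k → ℂ) → ℂ) (TU : CoulombBranch (D.restrict B p) →ₗ[ℂ] ℂ),
        0 < c ∧ (∀ x : Fin k → ℝ, v (fun j => (x j : ℂ)) = c * w (realPoint B p x)) ∧
        IsTraceWeight (D.restrict B p) (restrictTwist B ζ) v ∧
        IsTwistedTrace (restrictTwist B ζ) TU ∧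
        (∀ Q, TU (ofPoly (D.restrict B p) Q) =
          ∫ x : Fin k → ℝ, MvPolynomial.eval (fun j => I * (x j : ℂ)) Q * v (fun j => (x j : ℂ))) ∧
        ∀ a, S a = TU (φ a) := by
  have hW := hT.span_latticeIn_eq hp hw.1 hd hne
  have hρ : affRestrict (fun j => (realBasis hW B j : RealLie d)) p = restrictPoly B p := by
    rw [coe_realBasis_fun hW B, restrictPoly_eq_affRestrict]
  have hfac : ∀ l ∉ latticeIn U.direction, ∃ i,
      (∀ l' ∈ latticeIn U.direction, pair (D.weight i) l' = 0) ∧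
      restrictPoly B p (factor (D.form i) (-pair (D.weight i) l) (pair (D.weight i) l)) = 0 := by
    intro l hl
    obtain ⟨i, hi⟩ := hT.exists_factor_eq_zero hp hw.1 hd hne (realBasis hW B) hl
    refine ⟨i, fun l' hl' => ?_, by rwa [← hρ]⟩
    have h := (weight_of_factor_eq_zero _ hi).1 _ hl'
    have e : ∑ k, (D.weight i k : ℝ) * toReal l' k = ((pair (D.weight i) l' : ℤ) : ℝ) := by
      simp [pair, toReal]
    rw [e] at h
    exact_mod_cast h
  obtain ⟨c, v, t, hc, hv, htw, ht, hint, hs⟩ := hT.exists_traceWeight hp hw hd hW B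
  have hzero : ∀ a : Fin k → ℤ, latticePoint B a = 0 ↔ a = 0 := by
    intro a
    rw [latticePoint_eq, Submodule.coe_eq_zero, LinearEquiv.map_eq_zero_iff]
  refine ⟨restrictHom B p D hfac, surjective_restrictLin B p ?_, fun l hl R => ?_, fun a R => ?_,
    c, v, zeroPart _ t, hc, hv, htw, isTwistedTrace_zeroPart hs, fun Q => ?_, fun x => ?_⟩
  · rw [← hρ]
    exact surjective_affRestrict (linearIndependent_coe_basis _) p
  · rw [r_mul_ofPoly]
    exact restrictLin_mono_of_notMem B p hl _
  · rw [r_mul_ofPoly, r_mul_ofPoly, ← restrictPoly_shift]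
    exact restrictLin_mono_latticePoint B p a _
  · rw [zeroPart_ofPoly, ht]
  · refine induct x (fun x y hx hy => by rw [map_add, map_add, map_add, hx, hy]) fun l f => ?_
    change S (mono D l f) = zeroPart _ t (restrictLin B p D (mono D l f))
    by_cases hl : l ∈ latticeIn U.direction
    · rw [← latticePoint_equivFun B hl, restrictLin_mono_latticePoint, zeroPart_mono]
      split_ifs with h0
      · rw [h0, latticePoint_zero, ← hint, ← hSint]
        rfl
      · exact hS.mono_eq_zero (fun h => h0 ((hzero _).1 h)) f
    · rw [restrictLin_mono_of_notMem B p hl, map_zero]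
      exact hS.mono_eq_zero (fun h => hl (by rw [h]; exact zero_mem _)) f

end Proof

theorem proposition4p7 {d n : ℕ} (D : CoulombData d n) (ζ : Fin d → ℂ)
    {ι : Type*} [Fintype ι]
    (U : ι → AffineSubspace ℝ (RealLie d)) (hU : Function.Injective U)
    (p : ι → RealLie d) (hp : ∀ i, p i ∈ U i)
    (w : ι → RealLie d → ℂ)
    (hfrac : ∀ i, IsExpFractionOn (U i) (w i)) (hdecay : ∀ i, ExpDecayOn (U i) (w i))
    (T : CoulombBranch D →ₗ[ℂ] ℂ) (hT : CoulombBranch.IsTwistedTrace ζ T)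
    (hTint : ∀ R : CPoly d, T (CoulombBranch.ofPoly D R) = ∑ i, termIntegral (U i) (p i) (w i) R) :
    ∃ S : ι → CoulombBranch D →ₗ[ℂ] ℂ,
      T = ∑ i, S i ∧
      (∀ i, CoulombBranch.IsTwistedTrace ζ (S i) ∧
        ∀ R : CPoly d, S i (CoulombBranch.ofPoly D R) = termIntegral (U i) (p i) (w i) R) ∧
      ∀ i, (∃ z ∈ U i, w i z ≠ 0) →
        -- the direction of `U i` is rational
        Submodule.span ℝ (toReal '' (latticeIn (U i).direction : Set (Fin d → ℤ))) =
          (U i).direction ∧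
        Nonempty (Module.Basis (Fin (Module.finrank ℝ (U i).direction)) ℤ
          (latticeIn (U i).direction)) ∧
        ∀ B : Module.Basis (Fin (Module.finrank ℝ (U i).direction)) ℤ
            (latticeIn (U i).direction),
          ∃ φ : CoulombBranch D →ₐ[ℂ] CoulombBranch (D.restrict B (p i)),
            Function.Surjective φ ∧
            (∀ l ∉ latticeIn (U i).direction, ∀ R : CPoly d, φ (CoulombBranch.r D l * CoulombBranch.ofPoly D R) = 0) ∧
            (∀ a R, φ (CoulombBranch.r D (latticePoint B a) * CoulombBranch.ofPoly D R) =
              CoulombBranch.r (D.restrict B (p i)) a *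
                CoulombBranch.ofPoly (D.restrict B (p i)) (restrictPoly B (p i) R)) ∧
            ∃ (c : ℝ) (v : (Fin (Module.finrank ℝ (U i).direction) → ℂ) → ℂ)
              (TU : CoulombBranch (D.restrict B (p i)) →ₗ[ℂ] ℂ),
              -- `v` is `w i` in the coordinates of the basis, times the covolume `c`
              0 < c ∧ (∀ x : Fin (Module.finrank ℝ (U i).direction) → ℝ,
                v (fun k => (x k : ℂ)) = c * w i (realPoint B (p i) x)) ∧
              IsTraceWeight (D.restrict B (p i)) (restrictTwist B ζ) v ∧
              CoulombBranch.IsTwistedTrace (restrictTwist B ζ) TU ∧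
              (∀ Q, TU (CoulombBranch.ofPoly (D.restrict B (p i)) Q) =
                ∫ x : Fin (Module.finrank ℝ (U i).direction) → ℝ,
                  MvPolynomial.eval (fun k => Complex.I * (x k : ℂ)) Q *
                    v (fun k => (x k : ℂ))) ∧
              ∀ a, S i a = TU (φ a) := by
  choose t ht using fun i => exists_linear_termIntegral (hp i) (hfrac i).1 (hdecay i)
  -- The trace condition of `T`, evaluated on polynomials, is the shift identity for the sum of the
  -- integrals.
  have hweak := weakTermTrace_of_sum (D := D) (ζ := ζ) hU hp hfrac hdecay fun l R => by
    rw [← hTint, ← hTint, hT.shift_eq]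
  have hS : ∀ i, CoulombBranch.IsTwistedTrace ζ (zeroPart D (t i)) := fun i =>
    isTwistedTrace_zeroPart fun l R => by
      rw [ht, ht]
      exact (hweak i).shift_eq (hp i) (hfrac i) (hdecay i) l R
  have hSint : ∀ i R, zeroPart D (t i) (CoulombBranch.ofPoly D R) =
      termIntegral (U i) (p i) (w i) R := fun i R => by rw [zeroPart_ofPoly, ht]
  refine ⟨fun i => zeroPart D (t i), ?_, fun i => ⟨hS i, hSint i⟩, fun i hne => ?_⟩
  -- A twisted trace is determined by its restriction to polynomials, so the decomposition of `T`
  -- can be checked there.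
  · have h1 : T ∘ₗ CoulombBranch.ofPoly D = ∑ i, t i := by
      refine LinearMap.ext fun R => ?_
      rw [LinearMap.comp_apply, hTint, LinearMap.sum_apply]
      exact Finset.sum_congr rfl fun i _ => (ht i R).symm
    rw [hT.eq_zeroPart, h1]
    refine LinearMap.ext fun a => ?_
    rw [LinearMap.sum_apply]
    exact LinearMap.sum_apply _ _ _
  · have hW := (hweak i).span_latticeIn_eq (hp i) (hfrac i).1 (hdecay i) hne
    exact ⟨hW, nonempty_basis_latticeIn hW, fun B =>
      (hweak i).exists_restrictHom (hp i) (hfrac i) (hdecay i) hne (hS i) (hSint i) B⟩
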